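/- **Proposition.** For a Riemannian metric $g$ on the closed three-manifold $SO(3)$, let $\mathcal L_0^g,\dots,\mathcal L_3^g$ be its Lipschitz–Killing curvatures, $$\mathcal L_i^g=\sum_{m=0}^{\lfloor (3-i)/2\rfloor}\frac{(-1)^m(2\pi)^{-(3-i)/2}}{m!\,(3-i-2m)!}\int_{SO(3)}\mathrm{Tr}(R(m,i))\,d\mathrm{Vol}_g,$$ where $R(1,1)=R$ is the Riemann tensor, with trace $\mathrm{Tr}(R)=\sum_{a<b}g\big((\nabla_{E_a}\nabla_{E_b}-\nabla_{E_b}\nabla_{E_a}-\nabla_{[E_a,E_b]})E_a,E_b\big)$ for a $g$-orthonormal frame $E_1,E_2,E_3$, where $\mathrm{Tr}(R(0,3))=1$, and where $R(m,i)=0$ in the remaining cases. (1) Let $s$ be a nonzero integer and let $f=\mathrm{Re}\,X$ be the real random field of spin $s$ on $SO(3)$ with $$X=\sum_{l\ge |s|}c_l\sum_{m=-l}^{l}\gamma^l_{m,s}D^l_{m,s},$$ where the $\gamma^l_{m,s}$ are i.i.d. standard complex Gaussian variables (real and imaginary parts independent $N(0,\tfrac12)$), the $D^l_{m,s}$ are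 the Wigner $D$-functions, $D^l_{m,s}(R_3(\varphi)R_2(\theta)R_3(\psi))=e^{-im\varphi}d^l_{m,s}(\theta)e^{-is\psi}$, and the coefficients $c_l\ge 0$ are such that the series $\sum_{l\ge|s|}c_l^2\,d^l_{s,s}$ converges in $C^\infty(\mathbb R)$ and $\sum_{l\ge|s|}\frac{c_l^2}{2}=1$ (unit variance). Put $$\xi^2=\sum_{l\ge|s|}\frac{c_l^2}{2}\cdot\frac{l(l+1)-s^2}{2}.$$ Then the Adler–Taylor metric $g^f_p(u,v)=\mathbb E[d_pf(u)\,d_pf(v)]$ is a Riemannian metric on $SO(3)$, and its Lipschitz–Killing curvatures $\mathcal L_j^f(SO(3))$ are $$\mathcal L_0^f=\chi(SO(3))=0,\qquad \mathcal L_1^f=4|s|\pi\Big(1-\frac{s^2}{4\xi^2}\Big),\qquad \mathcal L_2^f=0,\qquad \mathcal L_3^f=\mathrm{Vol}^f(SO(3))=8\pi^2\xi^2|s| .$$ (2) For all real $\xi\neq0$ and $s\neq0$, let $g_{\xi,s}$ be the left-invariant Riemannian metric on $SO(3)$ for which the left-invariant fields generated by the infinitesimal rotations about the three coordinate axes are orthogonal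 with squared lengths $\xi^2,\xi^2,s^2$. The same formulas hold for $g_{\xi,s}$: $\mathcal L_0=\mathcal L_2=0$, $\mathcal L_1=4|s|\pi\big(1-\frac{s^2}{4\xi^2}\big)$ and $\mathcal L_3=\mathrm{Vol}=8\pi^2\xi^2|s|$. -/

import Mathlib

open MeasureTheory ProbabilityTheory Filter Topology

noncomputable section

namespace SpinSO3

/-! ### The rotation group, its charts and its tangent spaces -/

/-- The group of real `3 × 3` orthogonal matrices of determinant `1`. -/
abbrev SO3 : Type := Matrix.specialOrthogonalGroup (Fin 3) ℝ

/-- The Borel σ-algebra of `SO3`. -/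
instance instMeasurableSpaceSO3 : MeasurableSpace SO3 := borel SO3

instance instBorelSpaceSO3 : BorelSpace SO3 := ⟨rfl⟩

/-- `ℝ³`. It serves as the coordinate space of the charts, and as the tangent space of `SO3` at
any point `p`: the vector `v` stands for the tangent vector `p * hat v`. A function
`SO3 → R3` is thus a vector field on `SO3`, and a constant one is a left-invariant field. -/
abbrev R3 : Type := Fin 3 → ℝ

/-- The skew-symmetric matrix of the map `x ↦ v × x`. -/
def hat (v : R3) : Matrix (Fin 3) (Fin 3) ℝ :=
  !![0, -v 2, v 1; v 2, 0, -v 0; -v 1, v 0, 0]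

/-- The inverse of `hat` on skew-symmetric matrices. -/
def vee (A : Matrix (Fin 3) (Fin 3) ℝ) : R3 := ![A 2 1, A 0 2, A 1 0]

/-- The standard basis of `ℝ³`. -/
def e (i : Fin 3) : R3 := Pi.single i 1

/-- The Cayley transform `(1 - hat a / 2)⁻¹ (1 + hat a / 2)`, written out. It agrees with
`exp (hat a)` to first order at `a = 0`. -/
def cayleyMatrix (a : R3) : Matrix (Fin 3) (Fin 3) ℝ :=
  (1 + (a ⬝ᵥ a) / 4)⁻¹ •
    ((1 - (a ⬝ᵥ a) / 4) • (1 : Matrix (Fin 3) (Fin 3) ℝ) + hat a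
      + (1 / 2 : ℝ) • Matrix.vecMulVec a a)

theorem cayleyMatrix_mem (a : R3) :
    cayleyMatrix a ∈ Matrix.specialOrthogonalGroup (Fin 3) ℝ := by
  have h : (1 + (a 0 * a 0 + a 1 * a 1 + a 2 * a 2) / 4) ≠ 0 := by
    have := mul_self_nonneg (a 0)
    have := mul_self_nonneg (a 1)
    have := mul_self_nonneg (a 2)
    positivity
  rw [Matrix.mem_specialOrthogonalGroup_iff, Matrix.mem_orthogonalGroup_iff]
  constructor
  · ext i j
    fin_cases i <;> fin_cases j <;>
      simp [cayleyMatrix, hat, Matrix.mul_apply, Fin.sum_univ_three, dotProduct,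
        Matrix.vecMulVec_apply] <;> field_simp <;> ring
  · simp [cayleyMatrix, hat, Matrix.det_fin_three, Fin.sum_univ_three, dotProduct,
        Matrix.vecMulVec_apply]
    field_simp
    ring

/-- The Cayley transform as a map into `SO3`. -/
def cayley (a : R3) : SO3 := ⟨cayleyMatrix a, cayleyMatrix_mem a⟩

/-- The smooth parametrization `a ↦ p * cayley a` of the open set of all `q` for which `p⁻¹ q` is
not a half turn; it sends `0` to `p` and its differential at `0` is `v ↦ p * hat v`. These
parametrizations form the standard smooth atlas of `SO3`. -/
def chart (p : SO3) (a : R3) : SO3 := p * cayley a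

/-- Smooth functions on `SO3`. -/
def IsSmooth (h : SO3 → ℝ) : Prop := ∀ p, ContDiff ℝ (⊤ : ℕ∞) (fun a => h (chart p a))

/-- The differential `d_p h (v)`, for the tangent vector `p * hat v`. -/
def differential (h : SO3 → ℝ) (p : SO3) (v : R3) : ℝ :=
  fderiv ℝ (fun a => h (chart p a)) 0 v

/-! ### Riemannian metrics and curvature -/

/-- `g p u v` is the value at `p` of a Riemannian metric on the tangent vectors `p * hat u` and
`p * hat v`. -/
structure IsRiemannianMetric (g : SO3 → R3 → R3 → ℝ) : Prop where
  add_left : ∀ p u v w, g p (u + v) w = g p u w + g p v w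
  smul_left : ∀ p (t : ℝ) u v, g p (t • u) v = t * g p u v
  symm : ∀ p u v, g p u v = g p v u
  pos : ∀ p u, u ≠ 0 → 0 < g p u u
  smooth : ∀ u v, IsSmooth (fun p => g p u v)

/-- The Gram matrix of a metric in the left-invariant frame. -/
def gram (g : SO3 → R3 → R3 → ℝ) (p : SO3) : Matrix (Fin 3) (Fin 3) ℝ :=
  Matrix.of fun i j => g p (e i) (e j)

/-- The derivative of the function `h` along the vector field `V`. -/
def along (V : SO3 → R3) (h : SO3 → ℝ) (p : SO3) : ℝ := differential h p (V p)

/-- The Lie bracket of two vector fields. For left-invariant fields this is the bracket of the Lie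
algebra, that is, the cross product. -/
def bracket (V W : SO3 → R3) (p : SO3) : R3 :=
  (fun k => along V (fun q => W q k) p - along W (fun q => V q k) p) + crossProduct (V p) (W p)

/-- The right hand side of Koszul's formula, that is, `g (∇_U V, W)`. -/
def koszul (g : SO3 → R3 → R3 → ℝ) (U V W : SO3 → R3) (p : SO3) : ℝ :=
  (along U (fun q => g q (V q) (W q)) p + along V (fun q => g q (U q) (W q)) p
    - along W (fun q => g q (U q) (V q)) p + g p (bracket U V p) (W p)
    - g p (bracket U W p) (V p) - g p (bracket V W p) (U p)) / 2

/-- The Levi-Civita connection: `nabla g U V` is the vector field `∇_U V` that satisfies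
`g (∇_U V, W) = koszul g U V W` for all `W`. -/
def nabla (g : SO3 → R3 → R3 → ℝ) (U V : SO3 → R3) (p : SO3) : R3 :=
  Matrix.mulVec (gram g p)⁻¹ (fun k => koszul g U V (fun _ => e k) p)

/-- The Riemann tensor `R(u,v,w,z) = g (∇_u ∇_v w - ∇_v ∇_u w - ∇_[u,v] w, z)` at `p`, computed
by extending the vectors to left-invariant vector fields. -/
def riemann (g : SO3 → R3 → R3 → ℝ) (p : SO3) (u v w z : R3) : ℝ :=
  g p
    (nabla g (fun _ => u) (nabla g (fun _ => v) (fun _ => w)) p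
      - nabla g (fun _ => v) (nabla g (fun _ => u) (fun _ => w)) p
      - nabla g (bracket (fun _ => u) (fun _ => v)) (fun _ => w) p) z

/-- The trace of the Riemann tensor as a double form, that is, the sum over `a < b` of
`R(E_a, E_b, E_a, E_b)` for any `g`-orthonormal basis `E`, which is half the contraction
`g^{ik} g^{jl} R_{ijkl}` in an arbitrary basis. -/
def traceRiemann (g : SO3 → R3 → R3 → ℝ) (p : SO3) : ℝ :=
  (1 / 2) * ∑ i, ∑ j, ∑ k, ∑ l,
    (gram g p)⁻¹ i k * (gram g p)⁻¹ j l * riemann g p (e i) (e j) (e k) (e l)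

/-! ### Riemannian volume -/

/-- The partial derivative in the direction `v` at `a` of a parametrization `r` of `SO3`, as an
element of the tangent space at `r a`. -/
def velocity (r : R3 → SO3) (a v : R3) : R3 :=
  vee ((r a : Matrix (Fin 3) (Fin 3) ℝ).transpose *
    Matrix.of fun i j => fderiv ℝ (fun x => (r x : Matrix (Fin 3) (Fin 3) ℝ) i j) a v)

/-- The Gram matrix `g (∂_i r, ∂_j r)` of a metric in a parametrization `r`. -/
def chartGram (g : SO3 → R3 → R3 → ℝ) (r : R3 → SO3) (a : R3) : Matrix (Fin 3) (Fin 3) ℝ :=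
  Matrix.of fun i j => g (r a) (velocity r a (e i)) (velocity r a (e j))

/-- The diagonal matrices with entries `±1` in `SO3`: the identity and the half turns about
the coordinate axes. -/
def halfTurnMatrix (k : Fin 4) : Matrix (Fin 3) (Fin 3) ℝ :=
  ![1, Matrix.diagonal ![1, -1, -1], Matrix.diagonal ![-1, 1, -1],
    Matrix.diagonal ![-1, -1, 1]] k

theorem halfTurnMatrix_mem (k : Fin 4) :
    halfTurnMatrix k ∈ Matrix.specialOrthogonalGroup (Fin 3) ℝ := by
  rw [Matrix.mem_specialOrthogonalGroup_iff, Matrix.mem_orthogonalGroup_iff]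
  constructor
  · ext i j
    fin_cases k <;> fin_cases i <;> fin_cases j <;>
      simp [halfTurnMatrix, Matrix.mul_apply, Fin.sum_univ_three]
  · fin_cases k <;> simp [halfTurnMatrix, Fin.prod_univ_three]

def halfTurn (k : Fin 4) : SO3 := ⟨halfTurnMatrix k, halfTurnMatrix_mem k⟩

/-- Four charts whose images cover `SO3`: in terms of unit quaternions `±q`, the image of the
`k`-th one is the set where the `k`-th component of `q` does not vanish. -/
def coverChart (k : Fin 4) : R3 → SO3 := chart (halfTurn k)

/-- The Riemannian volume measure: on each piece of a partition of `SO3` into Borel sets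
contained in chart domains (the `k`-th piece being the image of the `k`-th chart minus the images
of the earlier ones) it is `√(det g_{ij}) da` in the coordinates `a` of that chart. -/
def riemannianVolume (g : SO3 → R3 → R3 → ℝ) : Measure SO3 :=
  Measure.sum fun k : Fin 4 =>
    (((volume : Measure R3).restrict
        {a | ∀ j < k, coverChart k a ∉ Set.range (coverChart j)}).withDensity
      fun a => ENNReal.ofReal (Real.sqrt (chartGram g (coverChart k) a).det)).map (coverChart k)

/-! ### Lipschitz-Killing curvatures -/

/-- The trace of the double form `R^m` that enters the `i`-th Lipschitz-Killing curvature of a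
closed three-dimensional manifold; by convention it is `0` unless `2 * m = 3 - i`. -/
def lkIntegrand (g : SO3 → R3 → R3 → ℝ) (m i : ℕ) (p : SO3) : ℝ :=
  if i = 1 ∧ m = 1 then traceRiemann g p else if i = 3 ∧ m = 0 then 1 else 0

/-- The `i`-th Lipschitz-Killing curvature, `0 ≤ i ≤ 3`, of `SO3` with the metric `g`. As `SO3` has
no boundary, the boundary integrals of the general formula are absent. -/
def lipschitzKilling (g : SO3 → R3 → R3 → ℝ) (i : ℕ) : ℝ :=
  ∑ m ∈ Finset.range ((3 - i) / 2 + 1),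
    (-1 : ℝ) ^ m * (2 * Real.pi) ^ (-((3 - (i : ℝ)) / 2))
        / ((m.factorial : ℝ) * ((3 - i - 2 * m).factorial : ℝ))
      * ∫ p, lkIntegrand g m i p ∂(riemannianVolume g)

/-- `χ` is the Euler characteristic of `X`: the alternating sum of the numbers of cells of a
finite CW structure on `X`. -/
def HasEulerCharacteristic (X : Type*) [TopologicalSpace X] (χ : ℤ) : Prop :=
  ∃ C : Topology.CWComplex (Set.univ : Set X),
    Finite (Σ n, C.cell n) ∧ χ = ∑ᶠ n : ℕ, (-1 : ℤ) ^ n * (Nat.card (C.cell n) : ℤ)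

/-- The left-invariant metric for which the left-invariant frame is orthogonal, with squared
lengths `ξ²`, `ξ²`, `s²`. In Euler angles `R_3(φ) R_2(θ) R_3(ψ)` its Gram matrix at `(0, π/2, 0)`
is diagonal with these entries. -/
def gXiS (ξ s : ℝ) (_ : SO3) (u v : R3) : ℝ :=
  ξ ^ 2 * (u 0 * v 0) + ξ ^ 2 * (u 1 * v 1) + s ^ 2 * (u 2 * v 2)

/-! ### Wigner functions -/

/-- The rotation `R_3(φ)`. -/
def rotZ (φ : ℝ) : Matrix (Fin 3) (Fin 3) ℝ :=
  !![Real.cos φ, -Real.sin φ, 0; Real.sin φ, Real.cos φ, 0; 0, 0, 1]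

/-- The rotation `R_2(θ)`. -/
def rotY (θ : ℝ) : Matrix (Fin 3) (Fin 3) ℝ :=
  !![Real.cos θ, 0, Real.sin θ; 0, 1, 0; -Real.sin θ, 0, Real.cos θ]

/-- Euler angles of `p`, with `p = R_3(φ) R_2(θ) R_3(ψ)`. -/
def eulerTheta (p : SO3) : ℝ := Real.arccos (p.1 2 2)

open Classical in
def eulerPhi (p : SO3) : ℝ :=
  if p.1 0 2 = 0 ∧ p.1 1 2 = 0 then Complex.arg ⟨p.1 1 1, -p.1 0 1⟩
  else Complex.arg ⟨p.1 0 2, p.1 1 2⟩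

open Classical in
def eulerPsi (p : SO3) : ℝ :=
  if p.1 0 2 = 0 ∧ p.1 1 2 = 0 then 0 else Complex.arg ⟨-p.1 2 0, p.1 2 1⟩

/-- The Wigner `d`-function `d^l_{m,s}(θ)`, for integers `-l ≤ m, s ≤ l`, by Wigner's formula. The
sum is the coefficient of `x^(l+m) y^(l-m)` in
`(cos(θ/2) x + sin(θ/2) y)^(l+s) (-sin(θ/2) x + cos(θ/2) y)^(l-s)`. -/
def wignerSmallD (l : ℕ) (m s : ℤ) (θ : ℝ) : ℝ :=
  Real.sqrt (((l + m).toNat.factorial * (l - m).toNat.factorial : ℝ)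
      / ((l + s).toNat.factorial * (l - s).toNat.factorial : ℝ)) *
    ∑ k ∈ Finset.HasAntidiagonal.antidiagonal (l - m).toNat,
      ((l + s).toNat.choose k.1 : ℝ) * ((l - s).toNat.choose k.2 : ℝ)
        * (-1) ^ ((l - s).toNat - k.2)
        * Real.cos (θ / 2) ^ ((l + s).toNat - k.1 + k.2)
        * Real.sin (θ / 2) ^ (k.1 + ((l - s).toNat - k.2))

/-- The Wigner `D`-function `D^l_{m,s}(R(φ,θ,ψ)) = e^{-imφ} d^l_{m,s}(θ) e^{-isψ}`. -/
def wignerD (l : ℕ) (m s : ℤ) (p : SO3) : ℂ :=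
  Complex.exp (-Complex.I * m * eulerPhi p) * (wignerSmallD l m s (eulerTheta p) : ℂ)
    * Complex.exp (-Complex.I * s * eulerPsi p)

/-! ### Spin random fields -/

/-- The law of a standard complex Gaussian variable: independent centred Gaussian real and imaginary
parts of variance `1/2`. -/
def complexGaussian : Measure ℂ :=
  ((gaussianReal 0 (1 / 2)).prod (gaussianReal 0 (1 / 2))).map fun x : ℝ × ℝ => ⟨x.1, x.2⟩

/-- The variables `γ l m`, for `l ≥ |s|` and `-l ≤ m ≤ l`, are i.i.d. standard complex Gaussian. -/
structure IsGaussianFamily {Ω : Type*} [MeasurableSpace Ω] (P : Measure Ω) (s : ℤ)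
    (γ : ℕ → ℤ → Ω → ℂ) : Prop where
  law : ∀ (l : ℕ) (m : ℤ), s.natAbs ≤ l → m.natAbs ≤ l → HasLaw (γ l m) complexGaussian P
  indep : iIndepFun (fun (i : {i : ℕ × ℤ // s.natAbs ≤ i.1 ∧ i.2.natAbs ≤ i.1}) => γ i.1.1 i.1.2) P

/-- The complex spin field `X = ∑_{l ≥ |s|} c_l ∑_{m = -l}^{l} γ^l_{m,s} D^l_{m,s}`; the series is
indexed by `l = |s| + n`. -/
def complexSpinField {Ω : Type*} (s : ℤ) (c : ℕ → ℝ) (γ : ℕ → ℤ → Ω → ℂ) (p : SO3) (ω : Ω) : ℂ :=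
  ∑' n : ℕ, (c (s.natAbs + n) : ℂ) *
    ∑ m ∈ Finset.Icc (-((s.natAbs + n : ℕ) : ℤ)) ((s.natAbs + n : ℕ) : ℤ),
      γ (s.natAbs + n) m ω * wignerD (s.natAbs + n) m s p

/-- The real spin field `f = Re X`. -/
def spinField {Ω : Type*} (s : ℤ) (c : ℕ → ℝ) (γ : ℕ → ℤ → Ω → ℂ) (p : SO3) (ω : Ω) : ℝ :=
  (complexSpinField s c γ p ω).re

/-- The series `∑_{l ≥ |s|} c_l² d^l_{s,s}` of the circular covariance function converges in the
topology of `C^∞(ℝ)`: all its derivatives converge uniformly on compact sets. -/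
def SmoothCovariance (s : ℤ) (c : ℕ → ℝ) : Prop :=
  ∃ k : ℝ → ℝ, ContDiff ℝ (⊤ : ℕ∞) k ∧ ∀ j : ℕ,
    TendstoLocallyUniformly
      (fun (N : ℕ) θ => ∑ n ∈ Finset.range N,
        c (s.natAbs + n) ^ 2 * iteratedDeriv j (wignerSmallD (s.natAbs + n) s s) θ)
      (iteratedDeriv j k) atTop

/-- The Adler-Taylor metric `g^f_p(u,v) = E[d_p f(u) d_p f(v)]` of a random field `f` on `SO3`. -/
def adlerTaylorMetric {Ω : Type*} [MeasurableSpace Ω] (P : Measure Ω) (f : SO3 → Ω → ℝ)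
    (p : SO3) (u v : R3) : ℝ :=
  ∫ ω, differential (fun q => f q ω) p u * differential (fun q => f q ω) p v ∂P

end SpinSO3

end

/-!
The Adler-Taylor metric of a spin field turns out to be the left-invariant metric `gXiS ξ s`
(`adlerTaylorMetric_spinField`), so that both parts concern left-invariant metrics on `SO3`.

For `gXiS ξ s` everything is explicit. On left-invariant fields Koszul's formula is algebraic, and
the trace of the Riemann tensor is the constant `-(1 / ξ²) (1 - s² / (4 ξ²))` (`traceRiemann_gXiS`).
The Cayley chart misses only the half turns, which are a null set, and its Jacobian is
`ξ² |s| (1 + |a|² / 4)⁻²`, a radial function with integral `8 π² ξ² |s|`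
(`riemannianVolume_gXiS_univ`). The Euler characteristic comes from the cell structure of
`SO3 = ℝP³` with one cell in each dimension: a rotation is a unit quaternion up to sign, and its cell
is determined by the index of the first nonzero component (`hasEulerCharacteristic_SO3`).

For the spin field, the Wigner functions are realized as coefficients of the binary forms
`(α x + β y)^(l+s) (-β̄ x + ᾱ y)^(l-s)` with `(α, β) ∈ SU(2)` (`wignerD_quatRot`). This removes the
singularities of the Euler angles, and the derivative along the group is the action of the Lie
algebra by lowering and raising operators (`hasCoeffDerivAt_binForm`). For the invariant inner
product these forms are orthogonal (`formInner_binForm`), which yields the bounds `‖D‖ ≤ 1` and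
`‖dD‖ = O(l)` and the sum over the rows, `Re ∑_m dD_m(u) conj (dD_m(v)) =
(l (l + 1) - s²) / 2 * (u₀ v₀ + u₁ v₁) + s² u₂ v₂` (`re_sum_wignerDeriv`). Weighted by `c_l² / 2` and
summed over `l` these are the coefficients `ξ²` and `s²` of the metric.

What remains is to differentiate the random series term by term and to integrate the double series of
products. Both need `∑ c_l l² < ∞` (`SmoothCovariance.summable`): the sixth derivative of
`d^l_{s,s}` at `0` is `-‖J³ e‖²` for a skew operator `J` and a unit vector `e`, and
`‖J³ e‖² ≥ ‖J e‖⁶ = ((l (l + 1) - s²) / 2)³` by the Cauchy-Schwarz inequality, so convergence of the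
sixth derivatives of the covariance bounds `∑ c_l² l⁶`.
-/

noncomputable section

namespace SpinSO3

/-! ### Rotations and quaternions -/

/-- The squared Euclidean norm of a quaternion `w + x i + y j + z k`, written `![w, x, y, z]`. -/
def quatNormSq (q : Fin 4 → ℝ) : ℝ := q 0 ^ 2 + q 1 ^ 2 + q 2 ^ 2 + q 3 ^ 2

/-- The matrix of the rotation `v ↦ q v q⁻¹` of the imaginary quaternions. -/
def quatMatrix (q : Fin 4 → ℝ) : Matrix (Fin 3) (Fin 3) ℝ :=
  (quatNormSq q)⁻¹ •
    !![q 0 ^ 2 + q 1 ^ 2 - q 2 ^ 2 - q 3 ^ 2, 2 * (q 1 * q 2 - q 0 * q 3),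
        2 * (q 1 * q 3 + q 0 * q 2);
      2 * (q 1 * q 2 + q 0 * q 3), q 0 ^ 2 - q 1 ^ 2 + q 2 ^ 2 - q 3 ^ 2,
        2 * (q 2 * q 3 - q 0 * q 1);
      2 * (q 1 * q 3 - q 0 * q 2), 2 * (q 2 * q 3 + q 0 * q 1),
        q 0 ^ 2 - q 1 ^ 2 - q 2 ^ 2 + q 3 ^ 2]

theorem quatNormSq_nonneg (q : Fin 4 → ℝ) : 0 ≤ quatNormSq q := by
  unfold quatNormSq; positivity

theorem quatNormSq_eq_zero {q : Fin 4 → ℝ} : quatNormSq q = 0 ↔ q = 0 := by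
  constructor
  · intro h
    unfold quatNormSq at h
    have h0 := sq_nonneg (q 0)
    have h1 := sq_nonneg (q 1)
    have h2 := sq_nonneg (q 2)
    have h3 := sq_nonneg (q 3)
    have key : ∀ x : ℝ, x ^ 2 = 0 → x = 0 := fun x hx => by simpa using hx
    have e0 := key (q 0) (by linarith)
    have e1 := key (q 1) (by linarith)
    have e2 := key (q 2) (by linarith)
    have e3 := key (q 3) (by linarith)
    ext i
    fin_cases i <;> assumption
  · rintro rfl; simp [quatNormSq]

theorem quatNormSq_pos {q : Fin 4 → ℝ} (hq : q ≠ 0) : 0 < quatNormSq q :=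
  lt_of_le_of_ne (quatNormSq_nonneg q) fun h => hq (quatNormSq_eq_zero.1 h.symm)

theorem quatMatrix_mem {q : Fin 4 → ℝ} (hq : q ≠ 0) :
    quatMatrix q ∈ Matrix.specialOrthogonalGroup (Fin 3) ℝ := by
  have h := (quatNormSq_pos hq).ne'
  unfold quatNormSq at h
  rw [Matrix.mem_specialOrthogonalGroup_iff, Matrix.mem_orthogonalGroup_iff]
  constructor
  · ext i j
    fin_cases i <;> fin_cases j <;>
      simp [quatMatrix, quatNormSq, Matrix.mul_apply, Fin.sum_univ_three] <;> field_simp <;> ring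
  · simp [quatMatrix, quatNormSq, Matrix.det_fin_three]
    field_simp
    ring

open Classical in
/-- The rotation given by a nonzero quaternion; the value at `0` is irrelevant. -/
def quatRot (q : Fin 4 → ℝ) : SO3 := if hq : q = 0 then 1 else ⟨quatMatrix q, quatMatrix_mem hq⟩

theorem quatRot_val {q : Fin 4 → ℝ} (hq : q ≠ 0) : (quatRot q).1 = quatMatrix q := by
  simp [quatRot, hq]

/-- The product of quaternions. -/
def quatMul (p q : Fin 4 → ℝ) : Fin 4 → ℝ :=
  ![p 0 * q 0 - p 1 * q 1 - p 2 * q 2 - p 3 * q 3,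
    p 0 * q 1 + p 1 * q 0 + p 2 * q 3 - p 3 * q 2,
    p 0 * q 2 - p 1 * q 3 + p 2 * q 0 + p 3 * q 1,
    p 0 * q 3 + p 1 * q 2 - p 2 * q 1 + p 3 * q 0]

theorem quatNormSq_mul (p q : Fin 4 → ℝ) :
    quatNormSq (quatMul p q) = quatNormSq p * quatNormSq q := by
  simp [quatNormSq, quatMul]; ring

theorem quatMul_ne_zero {p q : Fin 4 → ℝ} (hp : p ≠ 0) (hq : q ≠ 0) : quatMul p q ≠ 0 := by
  intro h
  have := quatNormSq_mul p q
  rw [quatNormSq_eq_zero.2 h] at this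
  exact (mul_pos (quatNormSq_pos hp) (quatNormSq_pos hq)).ne this

theorem quatMatrix_mul (p q : Fin 4 → ℝ) :
    quatMatrix p * quatMatrix q = quatMatrix (quatMul p q) := by
  unfold quatMatrix
  rw [quatNormSq_mul, Matrix.smul_mul, Matrix.mul_smul, smul_smul, mul_inv]
  congr 1
  ext i j
  fin_cases i <;> fin_cases j <;>
    simp [quatMul, Matrix.mul_apply, Fin.sum_univ_three] <;> ring

theorem quatRot_mul {p q : Fin 4 → ℝ} (hp : p ≠ 0) (hq : q ≠ 0) :
    quatRot p * quatRot q = quatRot (quatMul p q) := by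
  apply Subtype.ext
  rw [quatRot_val (quatMul_ne_zero hp hq), ← quatMatrix_mul, ← quatRot_val hp, ← quatRot_val hq]
  rfl

theorem quatMatrix_smul {t : ℝ} (ht : t ≠ 0) (q : Fin 4 → ℝ) :
    quatMatrix (t • q) = quatMatrix q := by
  have h : quatNormSq (t • q) = t ^ 2 * quatNormSq q := by simp [quatNormSq]; ring
  unfold quatMatrix
  rw [h, mul_inv, mul_comm, mul_smul]
  congr 1
  ext i j
  fin_cases i <;> fin_cases j <;> simp <;> field_simp

theorem quatRot_smul {t : ℝ} (ht : t ≠ 0) {q : Fin 4 → ℝ} (hq : q ≠ 0) :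
    quatRot (t • q) = quatRot q := by
  apply Subtype.ext
  rw [quatRot_val hq, quatRot_val (smul_ne_zero ht hq), quatMatrix_smul ht]

/-- For the rotation `R` of a unit quaternion `q`, the matrix `q qᵀ`, expressed linearly in `R`. -/
def quatProj (R : Matrix (Fin 3) (Fin 3) ℝ) : Matrix (Fin 4) (Fin 4) ℝ :=
  (1 / 4 : ℝ) •
    !![1 + R 0 0 + R 1 1 + R 2 2, R 2 1 - R 1 2, R 0 2 - R 2 0, R 1 0 - R 0 1;
      R 2 1 - R 1 2, 1 + R 0 0 - R 1 1 - R 2 2, R 0 1 + R 1 0, R 0 2 + R 2 0;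
      R 0 2 - R 2 0, R 0 1 + R 1 0, 1 - R 0 0 + R 1 1 - R 2 2, R 1 2 + R 2 1;
      R 1 0 - R 0 1, R 0 2 + R 2 0, R 1 2 + R 2 1, 1 - R 0 0 - R 1 1 + R 2 2]

theorem quatProj_quatMatrix {q : Fin 4 → ℝ} (hq : q ≠ 0) (i j : Fin 4) :
    quatProj (quatMatrix q) i j = q i * q j / quatNormSq q := by
  have h := (quatNormSq_pos hq).ne'
  unfold quatNormSq at h
  fin_cases i <;> fin_cases j <;> simp [quatProj, quatMatrix, quatNormSq] <;> field_simp <;> ring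

theorem quatProj_injective {R S : Matrix (Fin 3) (Fin 3) ℝ} (h : quatProj R = quatProj S) :
    R = S := by
  have e := fun i j => congrFun (congrFun h i) j
  have h00 := e 0 0
  have h01 := e 0 1
  have h02 := e 0 2
  have h03 := e 0 3
  have h11 := e 1 1
  have h12 := e 1 2
  have h13 := e 1 3
  have h22 := e 2 2
  have h23 := e 2 3
  simp [quatProj] at h00 h01 h02 h03 h11 h12 h13 h22 h23
  ext i j
  fin_cases i <;> fin_cases j <;> simp <;> linarith

set_option maxHeartbeats 1000000 in
/-- `quatProj R` has rank one: this is where `R` being a rotation is used. The relations are linear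
combinations of the entries of `R Rᵀ = 1`, `Rᵀ R = 1` and `adj R = Rᵀ`. -/
theorem quatProj_rank_one (p : SO3) (i j k : Fin 4) :
    quatProj p.1 i k * quatProj p.1 j k = quatProj p.1 i j * quatProj p.1 k k := by
  obtain ⟨R, hR⟩ := p
  have hR' := hR
  rw [Matrix.mem_specialOrthogonalGroup_iff, Matrix.mem_orthogonalGroup_iff] at hR
  rw [Matrix.mem_specialOrthogonalGroup_iff, Matrix.mem_orthogonalGroup_iff'] at hR'
  obtain ⟨h1, hd⟩ := hR
  have h2 := hR'.1
  have hadj : R.adjugate = R.transpose := by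
    have : R.transpose * (R * R.adjugate) = R.transpose := by
      rw [Matrix.mul_adjugate, hd]; simp
    rw [← Matrix.mul_assoc] at this
    have h2' : R.transpose * R = 1 := h2
    rwa [h2', one_mul] at this
  rw [Matrix.adjugate_fin_three] at hadj
  have a := fun i j => congrFun (congrFun h1 i) j
  have b := fun i j => congrFun (congrFun h2 i) j
  have c := fun i j => congrFun (congrFun hadj i) j
  have a00 := a 0 0
  have a01 := a 0 1
  have a02 := a 0 2
  have a11 := a 1 1
  have a12 := a 1 2
  have a22 := a 2 2
  have b00 := b 0 0
  have b01 := b 0 1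
  have b02 := b 0 2
  have b11 := b 1 1
  have b12 := b 1 2
  have b22 := b 2 2
  have c00 := c 0 0
  have c01 := c 0 1
  have c02 := c 0 2
  have c10 := c 1 0
  have c11 := c 1 1
  have c12 := c 1 2
  have c20 := c 2 0
  have c21 := c 2 1
  have c22 := c 2 2
  simp [Matrix.mul_apply, Fin.sum_univ_three] at a00 a01 a02 a11 a12 a22 b00 b01 b02 b11 b12 b22
  simp at c00 c01 c02 c10 c11 c12 c20 c21 c22
  clear a b c hadj h1 h2 hR' hd
  fin_cases i <;> fin_cases j <;> fin_cases k <;> simp [quatProj] <;> linarith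

theorem quatProj_trace (R : Matrix (Fin 3) (Fin 3) ℝ) :
    quatProj R 0 0 + quatProj R 1 1 + quatProj R 2 2 + quatProj R 3 3 = 1 := by
  simp [quatProj]; ring

/-- If `quatProj p` has a nonzero `k`-th diagonal entry, its `k`-th column is a quaternion
of `p`. -/
theorem quatRot_quatProj_col (p : SO3) {k : Fin 4} (hk : quatProj p.1 k k ≠ 0) :
    (fun i => quatProj p.1 i k) ≠ 0 ∧ quatRot (fun i => quatProj p.1 i k) = p := by
  have hne : (fun i => quatProj p.1 i k) ≠ 0 := fun h => hk (congrFun h k)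
  refine ⟨hne, ?_⟩
  apply Subtype.ext
  rw [quatRot_val hne]
  apply quatProj_injective
  ext i j
  rw [quatProj_quatMatrix hne]
  have hn : quatNormSq (fun i => quatProj p.1 i k) = quatProj p.1 k k := by
    have h := fun i => quatProj_rank_one p i i k
    have ht := quatProj_trace p.1
    simp only [quatNormSq]
    linear_combination h 0 + h 1 + h 2 + h 3 + quatProj p.1 k k * ht
  rw [hn, quatProj_rank_one p, mul_div_assoc, div_self hk, mul_one]

theorem exists_quatRot (p : SO3) : ∃ q : Fin 4 → ℝ, q ≠ 0 ∧ quatRot q = p := by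
  have h : ∃ k, quatProj p.1 k k ≠ 0 := by
    by_contra! h
    have := quatProj_trace p.1
    simp [h] at this
  obtain ⟨k, hk⟩ := h
  exact ⟨_, quatRot_quatProj_col p hk⟩

theorem continuousOn_quatRot : ContinuousOn quatRot {0}ᶜ := by
  refine ((Topology.IsInducing.subtypeVal
    (t := ((Matrix.specialOrthogonalGroup (Fin 3) ℝ : Submonoid _) :
      Set (Matrix (Fin 3) (Fin 3) ℝ)))).continuousOn_iff (f := quatRot)).2 ?_
  have : ContinuousOn quatMatrix {0}ᶜ := by
    have hn : Continuous quatNormSq := by unfold quatNormSq; fun_prop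
    have hi : ContinuousOn (fun q => (quatNormSq q)⁻¹) {0}ᶜ :=
      hn.continuousOn.inv₀ fun q hq => (quatNormSq_pos hq).ne'
    unfold quatMatrix
    refine hi.smul ?_
    refine continuousOn_pi.2 fun i => continuousOn_pi.2 fun j => ?_
    fin_cases i <;> fin_cases j <;> simp <;> fun_prop
  exact this.congr fun q hq => quatRot_val hq

/-- The quaternion `1 + a / 2` of the Cayley transform of `a`. -/
def cayleyQuat (a : R3) : Fin 4 → ℝ := ![1, a 0 / 2, a 1 / 2, a 2 / 2]

theorem cayleyQuat_ne_zero (a : R3) : cayleyQuat a ≠ 0 := fun h => by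
  simpa [cayleyQuat] using congrFun h 0

theorem cayley_eq_quatRot (a : R3) : cayley a = quatRot (cayleyQuat a) := by
  apply Subtype.ext
  rw [quatRot_val (cayleyQuat_ne_zero a)]
  have h : quatNormSq (cayleyQuat a) = 1 + (a ⬝ᵥ a) / 4 := by
    simp [quatNormSq, cayleyQuat, dotProduct, Fin.sum_univ_three]; ring
  have h' : 1 + (a 0 * a 0 + a 1 * a 1 + a 2 * a 2) / 4 ≠ 0 := by
    have := mul_self_nonneg (a 0)
    have := mul_self_nonneg (a 1)
    have := mul_self_nonneg (a 2)
    positivity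
  simp only [cayley, cayleyMatrix, quatMatrix, h]
  congr 1
  ext i j
  fin_cases i <;> fin_cases j <;>
    simp [cayleyQuat, dotProduct, Fin.sum_univ_three, hat, Matrix.vecMulVec_apply] <;> ring

theorem chart_quatRot {q : Fin 4 → ℝ} (hq : q ≠ 0) (a : R3) :
    chart (quatRot q) a = quatRot (quatMul q (cayleyQuat a)) := by
  rw [chart, cayley_eq_quatRot, quatRot_mul hq (cayleyQuat_ne_zero a)]

/-! ### A cell structure with one cell in each of the dimensions `0, 1, 2, 3` -/

/-- The quaternion `(0, …, 0, 1 - ‖x‖, x)` of the point `x` of the closed `n`-cell, which is the unit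
ball of the sup norm on `Fin n → ℝ`. -/
def cellQuat (n : ℕ) (x : Fin n → ℝ) : Fin 4 → ℝ := fun i =>
  if h : 4 ≤ i.1 + n then x ⟨i.1 + n - 4, by omega⟩ else if i.1 + n = 3 then 1 - ‖x‖ else 0

theorem cellQuat_lt {n : ℕ} (x : Fin n → ℝ) {i : Fin 4} (h : i.1 + n < 3) : cellQuat n x i = 0 := by
  simp [cellQuat, show ¬ 4 ≤ i.1 + n by omega, show ¬ i.1 + n = 3 by omega]

theorem cellQuat_eq {n : ℕ} (x : Fin n → ℝ) {i : Fin 4} (h : i.1 + n = 3) :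
    cellQuat n x i = 1 - ‖x‖ := by
  simp [cellQuat, h]

theorem cellQuat_gt {n : ℕ} (x : Fin n → ℝ) {i : Fin 4} (h : 4 ≤ i.1 + n) :
    cellQuat n x i = x ⟨i.1 + n - 4, by omega⟩ := by
  simp [cellQuat, h]

/-- The last `n` components of a quaternion. -/
def quatTail {n : ℕ} (hn : n ≤ 3) (q : Fin 4 → ℝ) : Fin n → ℝ :=
  fun j => q ⟨j.1 + (4 - n), by omega⟩

theorem quatTail_cellQuat {n : ℕ} (hn : n ≤ 3) (x : Fin n → ℝ) :
    quatTail hn (cellQuat n x) = x := by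
  ext j
  rw [quatTail, cellQuat_gt _ (show 4 ≤ j.1 + (4 - n) + n by omega)]
  congr 1
  ext
  simp
  omega

theorem cellQuat_ne_zero {n : ℕ} (hn : n ≤ 3) (x : Fin n → ℝ) : cellQuat n x ≠ 0 := fun h => by
  have h1 : x = 0 := by
    rw [← quatTail_cellQuat hn x, h]; rfl
  have h2 : cellQuat n x ⟨3 - n, by omega⟩ = 1 - ‖x‖ :=
    cellQuat_eq x (show 3 - n + n = 3 by omega)
  rw [h, h1] at h2
  simp at h2

theorem continuous_cellQuat (n : ℕ) : Continuous (cellQuat n) := by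
  refine continuous_pi fun i => ?_
  unfold cellQuat
  split_ifs <;> fun_prop

/-- The characteristic map of the `n`-cell. -/
def cellMap (n : ℕ) (x : Fin n → ℝ) : SO3 := quatRot (cellQuat n x)

theorem continuous_cellMap {n : ℕ} (hn : n ≤ 3) : Continuous (cellMap n) :=
  continuousOn_quatRot.comp_continuous (continuous_cellQuat n) fun x => cellQuat_ne_zero hn x

/-- The column of `quatProj p` with index `3 - n`. On the open `n`-cell it is a positive multiple of
the quaternion `cellQuat`. -/
def leadCol (n : ℕ) (p : SO3) : Fin 4 → ℝ := fun i => quatProj p.1 i (Fin.ofNat 4 (3 - n))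

/-- The inverse of `cellMap`. -/
def cellInv {n : ℕ} (hn : n ≤ 3) (p : SO3) : Fin n → ℝ :=
  (leadCol n p (Fin.ofNat 4 (3 - n)) + ‖quatTail hn (leadCol n p)‖)⁻¹ • quatTail hn (leadCol n p)

theorem quatProj_cellMap {n : ℕ} (hn : n ≤ 3) (x : Fin n → ℝ) (i j : Fin 4) :
    quatProj (cellMap n x).1 i j =
      cellQuat n x i * cellQuat n x j / quatNormSq (cellQuat n x) := by
  rw [cellMap, quatRot_val (cellQuat_ne_zero hn x), quatProj_quatMatrix (cellQuat_ne_zero hn x)]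

theorem quatTail_smul {n : ℕ} (hn : n ≤ 3) (t : ℝ) (q : Fin 4 → ℝ) :
    quatTail hn (t • q) = t • quatTail hn q := rfl

theorem ofNat_add {n : ℕ} (hn : n ≤ 3) : (Fin.ofNat 4 (3 - n)).1 + n = 3 := by
  simp [Fin.ofNat]; omega

theorem cellInv_cellMap {n : ℕ} (hn : n ≤ 3) {x : Fin n → ℝ} (hx : ‖x‖ < 1) :
    cellInv hn (cellMap n x) = x := by
  have hpos := quatNormSq_pos (cellQuat_ne_zero hn x)
  have hlead : cellQuat n x (Fin.ofNat 4 (3 - n)) = 1 - ‖x‖ := cellQuat_eq x (ofNat_add hn)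
  have h1 : 0 < 1 - ‖x‖ := by linarith
  have hcol : leadCol n (cellMap n x) =
      ((1 - ‖x‖) / quatNormSq (cellQuat n x)) • cellQuat n x := by
    ext i
    rw [leadCol, quatProj_cellMap hn, hlead]
    simp only [Pi.smul_apply, smul_eq_mul]
    ring
  have ht : 0 < (1 - ‖x‖) / quatNormSq (cellQuat n x) := div_pos h1 hpos
  rw [cellInv, hcol, quatTail_smul, quatTail_cellQuat, Pi.smul_apply, hlead, norm_smul,
    Real.norm_of_nonneg ht.le, smul_eq_mul, ← mul_add, sub_add_cancel, mul_one, smul_smul,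
    inv_mul_cancel₀ ht.ne', one_smul]

/-- The `n`-cell consists of the rotations whose quaternions have `3 - n` as the index of their
first nonzero component. -/
theorem mem_image_cellMap {n : ℕ} (hn : n ≤ 3) (p : SO3) :
    p ∈ cellMap n '' Metric.ball 0 1 ↔
      (∀ i : Fin 4, i.1 + n < 3 → quatProj p.1 i i = 0) ∧
        quatProj p.1 (Fin.ofNat 4 (3 - n)) (Fin.ofNat 4 (3 - n)) ≠ 0 := by
  constructor
  · rintro ⟨x, hx, rfl⟩
    rw [mem_ball_zero_iff] at hx
    constructor
    · intro i hi
      rw [quatProj_cellMap hn, cellQuat_lt x hi]; simp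
    · rw [quatProj_cellMap hn, cellQuat_eq x (ofNat_add hn)]
      have := (quatNormSq_pos (cellQuat_ne_zero hn x)).ne'
      have : 1 - ‖x‖ ≠ 0 := by linarith
      positivity
  · rintro ⟨h0, hk⟩
    set k : Fin 4 := Fin.ofNat 4 (3 - n) with hkdef
    have hkn : k.1 + n = 3 := ofNat_add hn
    obtain ⟨hne, hp⟩ := quatRot_quatProj_col p hk
    set q : Fin 4 → ℝ := fun i => quatProj p.1 i k with hq
    have hqk : 0 < q k := by
      have h1 := quatProj_quatMatrix hne k k
      rw [← quatRot_val hne, hp] at h1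
      change q k = _ at h1
      refine lt_of_le_of_ne ?_ (Ne.symm hk)
      rw [h1]
      exact div_nonneg (mul_self_nonneg _) (quatNormSq_nonneg _)
    set t : ℝ := q k + ‖quatTail hn q‖ with ht
    have htpos : 0 < t := by positivity
    have hnorm : ‖t⁻¹ • quatTail hn q‖ = t⁻¹ * ‖quatTail hn q‖ := by
      rw [norm_smul, Real.norm_of_nonneg (by positivity)]
    refine ⟨t⁻¹ • quatTail hn q, ?_, ?_⟩
    · rw [mem_ball_zero_iff, hnorm, inv_mul_lt_iff₀ htpos]
      linarith
    · rw [cellMap, ← hp, ← quatRot_smul (inv_ne_zero htpos.ne') hne]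
      congr 1
      ext i
      rcases lt_trichotomy (i.1 + n) 3 with hi | hi | hi
      · rw [cellQuat_lt _ hi]
        have := quatProj_rank_one p i i k
        rw [h0 i hi, zero_mul, mul_self_eq_zero] at this
        simp [hq, this]
      · rw [cellQuat_eq _ hi, hnorm, show i = k from Fin.ext (by omega)]
        simp only [Pi.smul_apply, smul_eq_mul]
        field_simp
        linarith
      · rw [cellQuat_gt _ (by omega : 4 ≤ i.1 + n)]
        simp only [Pi.smul_apply, smul_eq_mul, quatTail]
        congr 2
        ext
        simp
        omega

theorem continuousOn_cellInv {n : ℕ} (hn : n ≤ 3) :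
    ContinuousOn (cellInv hn) (cellMap n '' Metric.ball 0 1) := by
  have hproj : ∀ i j, Continuous fun p : SO3 => quatProj p.1 i j := fun i j => by
    have : ∀ a b, Continuous fun p : SO3 => p.1 a b := fun a b =>
      (continuous_apply_apply a b).comp continuous_subtype_val
    have key : ∀ f : Fin 3 → Fin 3 → SO3 → ℝ, (∀ a b, Continuous (f a b)) →
        Continuous fun p => quatProj (Matrix.of fun a b => f a b p) i j := by
      intro f hf
      fin_cases i <;> fin_cases j <;> simp [quatProj] <;> fun_prop
    exact key (fun a b p => p.1 a b) this
  have hcol : Continuous (leadCol n) := continuous_pi fun i => hproj i _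
  have htail : Continuous fun p => quatTail hn (leadCol n p) :=
    continuous_pi fun j => (continuous_apply _).comp hcol
  have hden : Continuous fun p : SO3 =>
      leadCol n p (Fin.ofNat 4 (3 - n)) + ‖quatTail hn (leadCol n p)‖ := (hproj _ _).add htail.norm
  refine (hden.continuousOn.inv₀ ?_).smul htail.continuousOn
  · rintro _ ⟨x, hx, rfl⟩
    rw [mem_ball_zero_iff] at hx
    have h : 0 < leadCol n (cellMap n x) (Fin.ofNat 4 (3 - n)) := by
      rw [leadCol, quatProj_cellMap hn, cellQuat_eq x (ofNat_add hn)]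
      have := quatNormSq_pos (cellQuat_ne_zero hn x)
      have : 0 < 1 - ‖x‖ := by linarith
      positivity
    positivity

/-- `cellMap` as a partial equivalence with the open cell. -/
def cellEquiv {n : ℕ} (hn : n ≤ 3) : PartialEquiv (Fin n → ℝ) SO3 where
  toFun := cellMap n
  invFun := cellInv hn
  source := Metric.ball 0 1
  target := cellMap n '' Metric.ball 0 1
  map_source' x hx := ⟨x, hx, rfl⟩
  map_target' := by
    rintro _ ⟨x, hx, rfl⟩
    rwa [cellInv_cellMap hn (mem_ball_zero_iff.1 hx)]
  left_inv' x hx := cellInv_cellMap hn (mem_ball_zero_iff.1 hx)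
  right_inv' := by
    rintro _ ⟨x, hx, rfl⟩
    rw [cellInv_cellMap hn (mem_ball_zero_iff.1 hx)]

/-- The cell of a rotation, found from the first nonzero component of its quaternions. -/
theorem exists_mem_cell (p : SO3) (n : ℕ) (hn : n ≤ 4)
    (h : ∀ i : Fin 4, i.1 + n < 4 → quatProj p.1 i i = 0) :
    ∃ m < n, m ≤ 3 ∧ p ∈ cellMap m '' Metric.ball 0 1 := by
  induction n with
  | zero =>
    have := quatProj_trace p.1
    simp [h _ (by simp : (0 : Fin 4).1 + 0 < 4), h _ (by simp : (1 : Fin 4).1 + 0 < 4),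
      h _ (by simp : (2 : Fin 4).1 + 0 < 4), h _ (by simp : (3 : Fin 4).1 + 0 < 4)] at this
  | succ n ih =>
    by_cases h0 : quatProj p.1 (Fin.ofNat 4 (3 - n)) (Fin.ofNat 4 (3 - n)) = 0
    · obtain ⟨m, hm, h'⟩ := ih (by omega) fun i hi => by
        by_cases hi' : i.1 + n = 3
        · have := ofNat_add (show n ≤ 3 by omega)
          rwa [show i = Fin.ofNat 4 (3 - n) from Fin.ext (by omega)]
        · exact h i (by omega)
      exact ⟨m, by omega, h'⟩
    · exact ⟨n, by omega, by omega,
        (mem_image_cellMap (by omega) p).2 ⟨fun i hi => h i (by omega), h0⟩⟩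

/-- The cell structure of `SO3`, with one cell in each dimension `n ≤ 3`. -/
abbrev cwComplexSO3 : Topology.CWComplex (Set.univ : Set SO3) :=
  Topology.CWComplex.mkFinite Set.univ (fun n => PLift (n ≤ 3)) (fun _ hn => cellEquiv hn.down)
    (eventually_atTop.2 ⟨4, fun n hn => ⟨fun h => absurd h.down (by omega)⟩⟩)
    (fun n => inferInstance) (fun _ _ => rfl)
    (fun _ hn => (continuous_cellMap hn.down).continuousOn)
    (fun _ hn => continuousOn_cellInv hn.down)
    (by
      have key : ∀ {n m : ℕ} (hn : n ≤ 3) (hm : m ≤ 3), n < m →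
          Disjoint (cellMap n '' Metric.ball 0 1) (cellMap m '' Metric.ball 0 1) := by
        intro n m hn hm hnm
        rw [Set.disjoint_left]
        intro p hp hp'
        rw [mem_image_cellMap hn] at hp
        rw [mem_image_cellMap hm] at hp'
        have := ofNat_add hm
        exact hp'.2 (hp.1 _ (by omega))
      rintro ⟨n, hn⟩ - ⟨m, hm⟩ - hne
      rcases lt_trichotomy n m with h | rfl | h
      · exact key hn.down hm.down h
      · cases hn; cases hm; exact absurd rfl hne
      · exact (key hm.down hn.down h).symm)
    (by
      intro n hn x hx
      have hx' : ‖x‖ = 1 := by simpa using hx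
      obtain ⟨m, hm, hm3, y, hy, hyx⟩ := exists_mem_cell (cellMap n x) n (by have := hn.down; omega)
        (fun i hi => by
          rw [quatProj_cellMap hn.down]
          by_cases hi' : i.1 + n = 3
          · rw [cellQuat_eq x hi', hx']; simp
          · rw [cellQuat_lt x (by omega)]; simp)
      exact Set.mem_iUnion₂.2 ⟨m, hm, Set.mem_iUnion.2
        ⟨⟨hm3⟩, y, Metric.ball_subset_closedBall hy, hyx⟩⟩)
    (by
      refine Set.eq_univ_of_forall fun p => ?_
      obtain ⟨m, -, hm3, y, hy, hyp⟩ := exists_mem_cell p 4 le_rfl fun i hi => absurd hi (by omega)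
      exact Set.mem_iUnion₂.2 ⟨m, ⟨hm3⟩, y, Metric.ball_subset_closedBall hy, hyp⟩)

theorem hasEulerCharacteristic_SO3 : HasEulerCharacteristic SO3 0 := by
  refine ⟨cwComplexSO3, ?_, ?_⟩
  · have : Finite (Σ n, PLift (n ≤ 3)) :=
      Finite.of_injective (β := Fin 4) (fun x => ⟨x.1, by have := x.2.down; omega⟩) (by
        rintro ⟨n, hn⟩ ⟨m, hm⟩ h
        obtain rfl : n = m := by simpa using h
        cases hn; cases hm; rfl)
    exact this
  · have hc : ∀ n, Nat.card (cwComplexSO3.cell n) = if n < 4 then 1 else 0 := fun n => by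
      change Nat.card (PLift (n ≤ 3)) = _
      split_ifs with h
      · have : Unique (PLift (n ≤ 3)) := ⟨⟨⟨by omega⟩⟩, fun _ => rfl⟩
        exact Nat.card_unique
      · have : IsEmpty (PLift (n ≤ 3)) := ⟨fun h' => absurd h'.down (by omega)⟩
        exact Nat.card_of_isEmpty
    rw [finsum_eq_sum_of_support_subset (s := Finset.range 4)]
    · simp [hc, Finset.sum_range_succ]
    · intro n hn
      by_contra h
      simp only [Finset.coe_range, Set.mem_Iio] at h
      simp [hc, h] at hn

/-! ### The left-invariant metrics and their curvature -/

theorem isSmooth_const (t : ℝ) : IsSmooth fun _ => t := fun _ => contDiff_const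

theorem isRiemannianMetric_gXiS {ξ s : ℝ} (hξ : ξ ≠ 0) (hs : s ≠ 0) :
    IsRiemannianMetric (gXiS ξ s) where
  add_left p u v w := by simp [gXiS]; ring
  smul_left p t u v := by simp [gXiS]; ring
  symm p u v := by simp [gXiS]; ring
  pos p u hu := by
    have h : gXiS ξ s p u u = (ξ * u 0) ^ 2 + (ξ * u 1) ^ 2 + (s * u 2) ^ 2 := by
      simp [gXiS]; ring
    rw [h]
    by_contra hle
    apply hu
    have h0 := sq_nonneg (ξ * u 0)
    have h1 := sq_nonneg (ξ * u 1)
    have h2 := sq_nonneg (s * u 2)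
    have e0 : u 0 = 0 := by
      have : (ξ * u 0) ^ 2 = 0 := by linarith
      simpa [hξ] using this
    have e1 : u 1 = 0 := by
      have : (ξ * u 1) ^ 2 = 0 := by linarith
      simpa [hξ] using this
    have e2 : u 2 = 0 := by
      have : (s * u 2) ^ 2 = 0 := by linarith
      simpa [hs] using this
    ext i
    fin_cases i <;> assumption
  smooth u v := isSmooth_const _

theorem along_const (V : SO3 → R3) (t : ℝ) (p : SO3) : along V (fun _ => t) p = 0 := by
  simp [along, differential]

theorem bracket_const (u v : R3) :
    bracket (fun _ => u) (fun _ => v) = fun _ => crossProduct u v := by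
  funext p
  simp only [bracket, along_const, sub_zero]
  ext i
  simp

theorem inv_gram_gXiS {ξ s : ℝ} (hξ : ξ ≠ 0) (hs : s ≠ 0) (p : SO3) :
    (gram (gXiS ξ s) p)⁻¹ = Matrix.diagonal ![(ξ ^ 2)⁻¹, (ξ ^ 2)⁻¹, (s ^ 2)⁻¹] := by
  apply Matrix.inv_eq_right_inv
  ext i j
  fin_cases i <;> fin_cases j <;>
    simp [gram, gXiS, e, Matrix.mul_apply, Fin.sum_univ_three, hξ, hs]

/-- The Levi-Civita connection of `gXiS ξ s` on left-invariant fields. -/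
def leftNabla (ξ s : ℝ) (u v : R3) : R3 :=
  ![s ^ 2 / (2 * ξ ^ 2) * (u 1 * v 2) + (s ^ 2 / (2 * ξ ^ 2) - 1) * (u 2 * v 1),
    (1 - s ^ 2 / (2 * ξ ^ 2)) * (u 2 * v 0) - s ^ 2 / (2 * ξ ^ 2) * (u 0 * v 2),
    (u 0 * v 1 - u 1 * v 0) / 2]

theorem koszul_const (ξ s : ℝ) (u v w : R3) (p : SO3) :
    koszul (gXiS ξ s) (fun _ => u) (fun _ => v) (fun _ => w) p =
      (gXiS ξ s p (crossProduct u v) w - gXiS ξ s p (crossProduct u w) v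
        - gXiS ξ s p (crossProduct v w) u) / 2 := by
  have h : ∀ (V : SO3 → R3) (x y : R3), along V (fun q => gXiS ξ s q x y) p = 0 := fun V x y =>
    along_const V _ p
  simp only [koszul, bracket_const, h]
  ring

theorem nabla_const {ξ s : ℝ} (hξ : ξ ≠ 0) (hs : s ≠ 0) (u v : R3) :
    nabla (gXiS ξ s) (fun _ => u) (fun _ => v) = fun _ => leftNabla ξ s u v := by
  funext p
  rw [nabla, inv_gram_gXiS hξ hs]
  ext k
  simp only [koszul_const, Matrix.mulVec_diagonal]
  fin_cases k <;> simp [gXiS, e, crossProduct, leftNabla] <;> field_simp <;> ring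

theorem riemann_gXiS {ξ s : ℝ} (hξ : ξ ≠ 0) (hs : s ≠ 0) (p : SO3) (u v w z : R3) :
    riemann (gXiS ξ s) p u v w z =
      gXiS ξ s p (leftNabla ξ s u (leftNabla ξ s v w) - leftNabla ξ s v (leftNabla ξ s u w)
        - leftNabla ξ s (crossProduct u v) w) z := by
  rw [riemann, bracket_const]
  simp only [nabla_const hξ hs]

theorem traceRiemann_gXiS {ξ s : ℝ} (hξ : ξ ≠ 0) (hs : s ≠ 0) (p : SO3) :
    traceRiemann (gXiS ξ s) p = -(1 / ξ ^ 2 * (1 - s ^ 2 / (4 * ξ ^ 2))) := by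
  simp only [traceRiemann, inv_gram_gXiS hξ hs, riemann_gXiS hξ hs]
  simp [Fin.sum_univ_three, gXiS, e, crossProduct, leftNabla]
  field_simp
  ring

/-! ### The volume of the left-invariant metrics -/

/-- The denominator `1 + |a|² / 4` of the Cayley transform. -/
def cayleyDen (a : R3) : ℝ := 1 + (a ⬝ᵥ a) / 4

theorem cayleyDen_pos (a : R3) : 0 < cayleyDen a := by
  have := mul_self_nonneg (a 0)
  have := mul_self_nonneg (a 1)
  have := mul_self_nonneg (a 2)
  simp only [cayleyDen, dotProduct, Fin.sum_univ_three]
  positivity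

/-- `hat` as a linear function into `ℝ`, entry by entry. -/
def hatEntry (i j : Fin 3) : R3 →L[ℝ] ℝ := LinearMap.toContinuousLinearMap
  { toFun := fun v => hat v i j
    map_add' := fun u v => by fin_cases i <;> fin_cases j <;> simp [hat] <;> ring
    map_smul' := fun t v => by fin_cases i <;> fin_cases j <;> simp [hat] }

theorem hasFDerivAt_cayleyDen (a : R3) :
    HasFDerivAt cayleyDen ((1 / 2 : ℝ) • ∑ i, a i • ContinuousLinearMap.proj (R := ℝ) i) a := by
  have h : ∀ i, HasFDerivAt (fun x : R3 => x i) (ContinuousLinearMap.proj (R := ℝ) i) a :=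
    fun i => hasFDerivAt_apply i a
  have h2 := (((((h 0).mul (h 0)).add ((h 1).mul (h 1))).add ((h 2).mul (h 2))).mul_const
    (1 / 4)).const_add 1
  convert! h2 using 1
  · ext x; simp [cayleyDen, dotProduct, Fin.sum_univ_three]; ring
  · ext v; simp [Fin.sum_univ_three]; ring

theorem fderiv_cayleyMatrix (a v : R3) (i j : Fin 3) :
    fderiv ℝ (fun x => cayleyMatrix x i j) a v =
      (cayleyDen a)⁻¹ * (-((a ⬝ᵥ v) / 2) * (1 : Matrix (Fin 3) (Fin 3) ℝ) i j + hat v i j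
        + 1 / 2 * (v i * a j + a i * v j)) - (a ⬝ᵥ v) / 2 * (cayleyDen a)⁻¹ * cayleyMatrix a i j := by
  have hd := hasFDerivAt_cayleyDen a
  have hne := (cayleyDen_pos a).ne'
  have hi : HasFDerivAt (fun x : R3 => x i) (ContinuousLinearMap.proj (R := ℝ) i) a :=
    hasFDerivAt_apply i a
  have hj : HasFDerivAt (fun x : R3 => x j) (ContinuousLinearMap.proj (R := ℝ) j) a :=
    hasFDerivAt_apply j a
  -- the coefficient `1 - |a|² / 4` of the identity matrix is `2 - cayleyDen a`
  have hN := (((hd.const_sub 2).mul_const ((1 : Matrix (Fin 3) (Fin 3) ℝ) i j)).add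
    (hatEntry i j).hasFDerivAt).add ((hi.mul hj).const_mul (1 / 2))
  have hinv := (hasDerivAt_inv hne).comp_hasFDerivAt a hd
  have h := hinv.mul hN
  have h' := h.congr_of_eventuallyEq (f₁ := fun x => cayleyMatrix x i j)
    (Eventually.of_forall fun x => by
      simp [cayleyMatrix, hatEntry, Matrix.vecMulVec_apply, cayleyDen]
      ring_nf
      simp)
  rw [h'.fderiv]
  have hdot : a ⬝ᵥ v = ∑ i, a i * v i := rfl
  simp [hatEntry, cayleyMatrix, Matrix.vecMulVec_apply, hdot]
  simp only [← cayleyDen.eq_1]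
  have hd2 : a ⬝ᵥ a = 4 * (cayleyDen a - 1) := by simp [cayleyDen]; ring
  rw [hd2]
  field_simp
  ring

theorem cayleyMatrix_transpose_mul (a : R3) :
    (cayleyMatrix a).transpose * cayleyMatrix a = 1 := by
  have := cayleyMatrix_mem a
  rw [Matrix.mem_specialOrthogonalGroup_iff, Matrix.mem_orthogonalGroup_iff'] at this
  exact this.1

/-- The differential of the Cayley transform, left-translated to the identity. -/
theorem velocity_cayley (a v : R3) :
    velocity cayley a v = (cayleyDen a)⁻¹ • (v - (1 / 2 : ℝ) • crossProduct a v) := by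
  have hne := (cayleyDen_pos a).ne'
  have hM : (Matrix.of fun i j => fderiv ℝ (fun x => (cayley x : Matrix (Fin 3) (Fin 3) ℝ) i j) a v)
      = (cayleyDen a)⁻¹ • (-((a ⬝ᵥ v) / 2) • (1 : Matrix (Fin 3) (Fin 3) ℝ) + hat v
        + (1 / 2 : ℝ) • (Matrix.vecMulVec v a + Matrix.vecMulVec a v))
        - ((a ⬝ᵥ v) / 2 * (cayleyDen a)⁻¹) • cayleyMatrix a := by
    ext i j
    have := fderiv_cayleyMatrix a v i j
    simp only [Matrix.of_apply]
    refine this.trans ?_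
    simp [Matrix.vecMulVec_apply]
    ring
  rw [velocity, hM]
  change vee ((cayleyMatrix a).transpose * _) = _
  rw [Matrix.mul_sub, Matrix.mul_smul, Matrix.mul_smul, cayleyMatrix_transpose_mul]
  have hd : 1 + (a 0 * a 0 + a 1 * a 1 + a 2 * a 2) / 4 ≠ 0 := by
    simpa [cayleyDen, dotProduct, Fin.sum_univ_three] using hne
  ext i
  fin_cases i <;>
    simp [vee, cayleyMatrix, hat, Matrix.mul_apply, Fin.sum_univ_three, dotProduct, cayleyDen,
      Matrix.vecMulVec_apply, cross_apply, Matrix.vecHead, Matrix.vecTail] <;>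
    field_simp <;> ring_nf <;> simp

theorem det_chartGram_cayley (ξ s : ℝ) (a : R3) :
    (chartGram (gXiS ξ s) cayley a).det = (ξ ^ 2 * |s| * (cayleyDen a ^ 2)⁻¹) ^ 2 := by
  have hne := (cayleyDen_pos a).ne'
  have h : chartGram (gXiS ξ s) cayley a = ((cayleyDen a)⁻¹ ^ 2) • Matrix.of fun i j =>
      gXiS ξ s 1 (e i - (1 / 2 : ℝ) • crossProduct a (e i))
        (e j - (1 / 2 : ℝ) • crossProduct a (e j)) := by
    ext i j
    simp only [chartGram, velocity_cayley, Matrix.of_apply, Matrix.smul_apply]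
    simp [gXiS]
    ring
  have h2 : (Matrix.of fun i j =>
      gXiS ξ s 1 (e i - (1 / 2 : ℝ) • crossProduct a (e i))
        (e j - (1 / 2 : ℝ) • crossProduct a (e j))).det = ξ ^ 4 * s ^ 2 * cayleyDen a ^ 2 := by
    simp [Matrix.det_fin_three, gXiS, e, crossProduct, cayleyDen, dotProduct, Fin.sum_univ_three]
    ring
  rw [h, Matrix.det_smul, h2, Fintype.card_fin, mul_pow, mul_pow, sq_abs]
  field_simp

theorem continuous_cayley : Continuous cayley := by
  have h : cayley = fun a => quatRot (cayleyQuat a) := funext cayley_eq_quatRot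
  rw [h]
  refine continuousOn_quatRot.comp_continuous ?_ fun a => cayleyQuat_ne_zero a
  refine continuous_pi fun i => ?_
  fin_cases i <;> simp [cayleyQuat] <;> fun_prop

theorem continuous_coverChart (k : Fin 4) : Continuous (coverChart k) :=
  continuous_const.mul continuous_cayley

theorem coverChart_zero : coverChart 0 = cayley := by
  funext a
  have : halfTurn 0 = 1 := Subtype.ext (by simp [halfTurn, halfTurnMatrix])
  rw [coverChart, chart, this, one_mul]

theorem halfTurn_eq_quatRot (k : Fin 4) : halfTurn k = quatRot (Pi.single k 1) := by
  have hne : (Pi.single k 1 : Fin 4 → ℝ) ≠ 0 := by simp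
  apply Subtype.ext
  rw [quatRot_val hne]
  ext i j
  fin_cases k <;> fin_cases i <;> fin_cases j <;>
    simp [halfTurn, halfTurnMatrix, quatMatrix, quatNormSq]

/-- The rotations outside the image of the Cayley transform are the half turns, which in the
`k`-th chart form a coordinate plane. -/
theorem coverChart_mem_range_cayley {k : Fin 3} {a : R3} (h : a k ≠ 0) :
    coverChart k.succ a ∈ Set.range (coverChart 0) := by
  have hne : (Pi.single k.succ 1 : Fin 4 → ℝ) ≠ 0 := by simp
  set q := quatMul (Pi.single k.succ 1) (cayleyQuat a) with hq
  have hq0 : q 0 ≠ 0 := by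
    have : q 0 = -(a k / 2) := by
      rw [hq]
      fin_cases k <;> simp [quatMul, cayleyQuat]
    rw [this]
    simpa using h
  have hqne : q ≠ 0 := quatMul_ne_zero hne (cayleyQuat_ne_zero a)
  refine ⟨![2 * q 1 / q 0, 2 * q 2 / q 0, 2 * q 3 / q 0], ?_⟩
  rw [coverChart_zero, cayley_eq_quatRot, coverChart, halfTurn_eq_quatRot, chart_quatRot hne,
    ← hq, ← quatRot_smul (inv_ne_zero hq0) hqne]
  congr 1
  ext i
  fin_cases i <;> simp [cayleyQuat, hq0] <;> field_simp

/-- An antiderivative of the integrand is `4 (arctan x - x / (1 + x²))` with `x = r / 2`. -/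
theorem integral_radial :
    ∫ r in Set.Ioi (0 : ℝ), r ^ 2 * ((1 + r ^ 2 / 4) ^ 2)⁻¹ = 2 * Real.pi := by
  have hpos : ∀ r : ℝ, 0 < 1 + (r / 2) ^ 2 := fun r => by positivity
  have h1 : Tendsto (fun r : ℝ => r / 2) atTop atTop := tendsto_id.atTop_div_const (by norm_num)
  have h2 : Tendsto (fun r : ℝ => (r / 2) / (1 + (r / 2) ^ 2)) atTop (𝓝 0) := by
    have h3 : Tendsto (fun x : ℝ => x / (1 + x ^ 2)) atTop (𝓝 0) := by
      refine squeeze_zero' (g := fun x => x⁻¹) ?_ ?_ tendsto_inv_atTop_zero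
      · filter_upwards [eventually_ge_atTop 0] with x hx
        positivity
      · filter_upwards [eventually_gt_atTop 0] with x hx
        rw [div_le_iff₀ (by positivity), inv_mul_eq_div, le_div_iff₀ hx]
        nlinarith
    exact h3.comp h1
  have hlim : Tendsto (fun r : ℝ => 4 * (Real.arctan (r / 2) - (r / 2) / (1 + (r / 2) ^ 2))) atTop
      (𝓝 (4 * (Real.pi / 2 - 0))) :=
    (((Real.tendsto_arctan_atTop.mono_right nhdsWithin_le_nhds).comp h1).sub h2).const_mul 4
  rw [integral_Ioi_of_hasDerivAt_of_nonneg' (l := 4 * (Real.pi / 2 - 0))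
    (g := fun r : ℝ => 4 * (Real.arctan (r / 2) - (r / 2) / (1 + (r / 2) ^ 2))) ?_ ?_ hlim]
  · simp; ring
  · intro r _
    have hr : HasDerivAt (fun r : ℝ => r / 2) (1 / 2) r := (hasDerivAt_id r).div_const 2
    have h := ((hr.arctan).sub (hr.div ((hr.pow 2).const_add 1) (hpos r).ne')).const_mul 4
    have hne := (hpos r).ne'
    convert! h using 1
    simp only [Pi.pow_apply]
    field_simp
    ring
  · intro r _
    positivity

theorem integral_cayleyDen : ∫ a : R3, (cayleyDen a ^ 2)⁻¹ = 8 * Real.pi ^ 2 := by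
  have h := (PiLp.volume_preserving_ofLp (Fin 3)).integral_comp
    (MeasurableEquiv.toLp 2 (Fin 3 → ℝ)).symm.measurableEmbedding
    (fun a : R3 => (cayleyDen a ^ 2)⁻¹)
  rw [← h]
  have h2 : ∀ x : EuclideanSpace ℝ (Fin 3), (cayleyDen (WithLp.ofLp x) ^ 2)⁻¹ =
      (fun r : ℝ => ((1 + r ^ 2 / 4) ^ 2)⁻¹) ‖x‖ := fun x => by
    have hn : ‖x‖ ^ 2 = x 0 * x 0 + x 1 * x 1 + x 2 * x 2 := by
      rw [EuclideanSpace.norm_sq_eq]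
      simp [Fin.sum_univ_three, pow_two]
    simp only [hn]
    simp [cayleyDen, dotProduct, Fin.sum_univ_three]
  simp only [h2]
  rw [integral_fun_norm_addHaar volume (fun r : ℝ => ((1 + r ^ 2 / 4) ^ 2)⁻¹)]
  have hb : (volume : Measure (EuclideanSpace ℝ (Fin 3))).real (Metric.ball 0 1) =
      Real.pi * 4 / 3 := by
    rw [Measure.real, EuclideanSpace.volume_ball_fin_three]
    simp
    positivity
  simp only [finrank_euclideanSpace, Fintype.card_fin, hb, smul_eq_mul, nsmul_eq_mul,
    Nat.add_one_sub_one]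
  rw [integral_radial]
  push_cast
  ring

/-- The first chart carries all of the volume, as the half turns form a null set in the others. -/
theorem riemannianVolume_gXiS_univ (ξ s : ℝ) :
    (riemannianVolume (gXiS ξ s) Set.univ).toReal = 8 * Real.pi ^ 2 * ξ ^ 2 * |s| := by
  have hsucc : ∀ k : Fin 3, ((((volume : Measure R3).restrict
      {a | ∀ j < k.succ, coverChart k.succ a ∉ Set.range (coverChart j)}).withDensity
      fun a => ENNReal.ofReal (Real.sqrt (chartGram (gXiS ξ s) (coverChart k.succ) a).det)).map
        (coverChart k.succ)) Set.univ = 0 := by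
    intro k
    have h0 : (volume : Measure R3)
        {a | ∀ j < k.succ, coverChart k.succ a ∉ Set.range (coverChart j)} = 0 := by
      refine measure_mono_null ?_ (Measure.pi_hyperplane (fun _ => (volume : Measure ℝ)) k 0)
      intro a ha
      by_contra hne
      exact ha 0 (Fin.succ_pos k) (coverChart_mem_range_cayley hne)
    rw [Measure.restrict_eq_zero.2 h0]
    simp
  have hzero : {a | ∀ j < (0 : Fin 4), coverChart 0 a ∉ Set.range (coverChart j)} = Set.univ :=
    Set.eq_univ_of_forall fun a j hj => absurd hj (by simp)
  rw [riemannianVolume, Measure.sum_apply _ MeasurableSet.univ, tsum_fintype, Fin.sum_univ_succ]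
  simp only [hsucc, Finset.sum_const_zero, add_zero]
  rw [hzero, Measure.restrict_univ, Measure.map_apply (continuous_coverChart 0).measurable
    MeasurableSet.univ, Set.preimage_univ, withDensity_apply _ MeasurableSet.univ,
    Measure.restrict_univ, coverChart_zero]
  have hnn : ∀ a : R3, 0 ≤ ξ ^ 2 * |s| * (cayleyDen a ^ 2)⁻¹ := fun a => by positivity
  have hd : ∀ a : R3, Real.sqrt (chartGram (gXiS ξ s) cayley a).det =
      ξ ^ 2 * |s| * (cayleyDen a ^ 2)⁻¹ := fun a => by
    rw [det_chartGram_cayley, Real.sqrt_sq (hnn a)]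
  simp only [hd]
  rw [← integral_eq_lintegral_of_nonneg_ae (Eventually.of_forall hnn) ?_, integral_const_mul,
    integral_cayleyDen]
  · ring
  · have hc : Continuous cayleyDen := by
      unfold cayleyDen
      simp only [dotProduct, Fin.sum_univ_three]
      fun_prop
    exact (((hc.pow 2).inv₀ fun a => pow_ne_zero 2 (cayleyDen_pos a).ne').const_mul
      _).aestronglyMeasurable

/-! ### Lipschitz-Killing curvatures -/

theorem lipschitzKilling_zero (g : SO3 → R3 → R3 → ℝ) : lipschitzKilling g 0 = 0 := by
  simp [lipschitzKilling, lkIntegrand]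

theorem lipschitzKilling_two (g : SO3 → R3 → R3 → ℝ) : lipschitzKilling g 2 = 0 := by
  simp [lipschitzKilling, lkIntegrand]

theorem lipschitzKilling_three (g : SO3 → R3 → R3 → ℝ) :
    lipschitzKilling g 3 = (riemannianVolume g Set.univ).toReal := by
  simp [lipschitzKilling, lkIntegrand, Measure.real]

theorem lipschitzKilling_one_gXiS {ξ s : ℝ} (hξ : ξ ≠ 0) (hs : s ≠ 0) :
    lipschitzKilling (gXiS ξ s) 1 = 4 * |s| * Real.pi * (1 - s ^ 2 / (4 * ξ ^ 2)) := by
  have h0 : ∀ p, lkIntegrand (gXiS ξ s) 0 1 p = 0 := fun p => by simp [lkIntegrand]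
  have h1 : ∀ p, lkIntegrand (gXiS ξ s) 1 1 p = -(1 / ξ ^ 2 * (1 - s ^ 2 / (4 * ξ ^ 2))) :=
    fun p => by simp only [lkIntegrand, and_self, if_true, traceRiemann_gXiS hξ hs]
  have hpow : (2 * Real.pi) ^ (-((3 - ((1 : ℕ) : ℝ)) / 2)) = (2 * Real.pi)⁻¹ := by
    rw [← Real.rpow_neg_one]
    norm_num
  rw [lipschitzKilling, show (3 - 1) / 2 + 1 = 2 from rfl, Finset.sum_range_succ,
    Finset.sum_range_one]
  simp only [h0, h1, integral_zero, mul_zero, zero_add, integral_const, hpow, Measure.real,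
    riemannianVolume_gXiS_univ, smul_eq_mul]
  have := Real.pi_ne_zero
  simp
  field_simp
  ring

/-! ### Binary forms and their invariant inner product -/

open Polynomial in
/-- The binary form `(α x + β y)^a (-β̄ x + ᾱ y)^b`, dehomogenized by `x = 1`. -/
def binForm (α β : ℂ) (a b : ℕ) : ℂ[X] :=
  (C α + C β * X) ^ a * (C (-starRingEnd ℂ β) + C (starRingEnd ℂ α) * X) ^ b

/-- The invariant inner product on binary forms of degree `N`, multiplied by `N!`. -/
def formInner (N : ℕ) (F G : Polynomial ℂ) : ℂ :=
  ∑ k ∈ Finset.range (N + 1),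
    ((k.factorial : ℂ) * ((N - k).factorial : ℂ)) * F.coeff k * starRingEnd ℂ (G.coeff k)

theorem formInner_add_left (N : ℕ) (F G H : Polynomial ℂ) :
    formInner N (F + G) H = formInner N F H + formInner N G H := by
  simp only [formInner, Polynomial.coeff_add, mul_add, add_mul, Finset.sum_add_distrib]

theorem formInner_C_mul_left (N : ℕ) (c : ℂ) (F G : Polynomial ℂ) :
    formInner N (Polynomial.C c * F) G = c * formInner N F G := by
  simp only [formInner, Polynomial.coeff_C_mul, Finset.mul_sum]
  exact Finset.sum_congr rfl fun k _ => by ring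

theorem formInner_conj_symm (N : ℕ) (F G : Polynomial ℂ) :
    starRingEnd ℂ (formInner N F G) = formInner N G F := by
  simp only [formInner, map_sum, map_mul, map_natCast, Complex.conj_conj]
  exact Finset.sum_congr rfl fun k _ => by ring

theorem formInner_add_right (N : ℕ) (F G H : Polynomial ℂ) :
    formInner N F (G + H) = formInner N F G + formInner N F H := by
  simp only [formInner, Polynomial.coeff_add, map_add, mul_add, Finset.sum_add_distrib]

theorem formInner_C_mul_right (N : ℕ) (c : ℂ) (F G : Polynomial ℂ) :
    formInner N F (Polynomial.C c * G) = starRingEnd ℂ c * formInner N F G := by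
  simp only [formInner, Polynomial.coeff_C_mul, Finset.mul_sum, map_mul]
  exact Finset.sum_congr rfl fun k _ => by ring

open Polynomial in
/-- The derivation of binary forms that is adjoint to multiplication by `μ x + ν y`, on forms of
degree `N`. -/
def formDeriv (μ ν : ℂ) (N : ℕ) (G : ℂ[X]) : ℂ[X] :=
  C (starRingEnd ℂ μ) * (C (N : ℂ) * G - X * derivative G) + C (starRingEnd ℂ ν) * derivative G

open Polynomial in
theorem coeff_formDeriv (μ ν : ℂ) (N : ℕ) (G : ℂ[X]) (k : ℕ) :
    (formDeriv μ ν N G).coeff k = starRingEnd ℂ μ * ((N - k) * G.coeff k)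
      + starRingEnd ℂ ν * ((k + 1) * G.coeff (k + 1)) := by
  cases k with
  | zero => simp [formDeriv, coeff_derivative]
  | succ k => simp [formDeriv, coeff_derivative, coeff_X_mul]; ring

open Polynomial in
theorem formInner_linear_mul (μ ν : ℂ) (N : ℕ) (F G : ℂ[X]) (hF : F.coeff (N + 1) = 0) :
    formInner (N + 1) ((C μ + C ν * X) * F) G = formInner N F (formDeriv μ ν (N + 1) G) := by
  have h1 : formInner (N + 1) (C μ * F) G = ∑ k ∈ Finset.range (N + 1),
      ((k.factorial : ℂ) * ((N - k).factorial : ℂ)) * F.coeff k *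
        (μ * ((N + 1 - k) * starRingEnd ℂ (G.coeff k))) := by
    rw [formInner, Finset.sum_range_succ]
    simp only [coeff_C_mul, hF, mul_zero, zero_mul, add_zero]
    refine Finset.sum_congr rfl fun k hk => ?_
    have hk' : k ≤ N := by simpa [Nat.lt_succ_iff] using hk
    rw [show N + 1 - k = (N - k) + 1 by omega, Nat.factorial_succ]
    push_cast [Nat.cast_sub hk']
    ring
  have h2 : formInner (N + 1) (C ν * X * F) G = ∑ k ∈ Finset.range (N + 1),
      ((k.factorial : ℂ) * ((N - k).factorial : ℂ)) * F.coeff k *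
        (ν * ((k + 1) * starRingEnd ℂ (G.coeff (k + 1)))) := by
    rw [formInner, Finset.sum_range_succ']
    simp only [mul_assoc (C ν), coeff_C_mul, coeff_X_mul, coeff_X_mul_zero, mul_zero, zero_mul,
      add_zero]
    refine Finset.sum_congr rfl fun k hk => ?_
    rw [show N + 1 - (k + 1) = N - k by omega, Nat.factorial_succ]
    push_cast
    ring
  rw [add_mul, formInner_add_left, h1, h2, formInner, ← Finset.sum_add_distrib]
  refine Finset.sum_congr rfl fun k _ => ?_
  rw [coeff_formDeriv]
  simp only [map_add, map_mul, Complex.conj_conj, map_sub, map_natCast, map_one]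
  push_cast
  ring

open Polynomial in
theorem natDegree_binForm_le (α β : ℂ) (a b : ℕ) : (binForm α β a b).natDegree ≤ a + b := by
  have h : ∀ μ ν : ℂ, ∀ n : ℕ, ((C μ + C ν * X) ^ n).natDegree ≤ n := fun μ ν n => by
    refine natDegree_pow_le.trans ?_
    have : (C μ + C ν * X).natDegree ≤ 1 := by compute_degree
    nlinarith
  exact natDegree_mul_le.trans (add_le_add (h _ _ a) (h _ _ b))

theorem coeff_binForm_of_lt (α β : ℂ) {a b k : ℕ} (h : a + b < k) :
    (binForm α β a b).coeff k = 0 :=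
  Polynomial.coeff_eq_zero_of_natDegree_lt ((natDegree_binForm_le α β a b).trans_lt h)

theorem binForm_succ_left (α β : ℂ) (a b : ℕ) : binForm α β (a + 1) b =
    (Polynomial.C α + Polynomial.C β * Polynomial.X) * binForm α β a b := by
  simp only [binForm, pow_succ]; ring

theorem binForm_succ_right (α β : ℂ) (a b : ℕ) : binForm α β a (b + 1) =
    (Polynomial.C (-starRingEnd ℂ β) + Polynomial.C (starRingEnd ℂ α) * Polynomial.X)
      * binForm α β a b := by
  simp only [binForm, pow_succ]; ring

open Polynomial in
theorem formDeriv_binForm (μ ν α β : ℂ) (a b : ℕ) :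
    formDeriv μ ν (a + b) (binForm α β a b) =
      C (a * (starRingEnd ℂ μ * α + starRingEnd ℂ ν * β)) * binForm α β (a - 1) b
      + C (b * (-(starRingEnd ℂ μ * starRingEnd ℂ β) + starRingEnd ℂ ν * starRingEnd ℂ α))
        * binForm α β a (b - 1) := by
  have hA : derivative (C α + C β * X) = C β := by simp
  have hB : derivative (C (-starRingEnd ℂ β) + C (starRingEnd ℂ α) * X) =
      C (starRingEnd ℂ α) := by simp
  rw [formDeriv, binForm, derivative_mul, derivative_pow, derivative_pow, hA, hB]
  cases a with
  | zero =>
    cases b with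
    | zero => simp
    | succ b =>
      simp [binForm, pow_succ]
      ring
  | succ a =>
    cases b with
    | zero =>
      simp [binForm, pow_succ]
      ring
    | succ b =>
      simp [binForm, pow_succ]
      ring

/-- For `|α|² + |β|² = 1`, the powers of the two linear forms are orthogonal. -/
theorem formInner_binForm {α β : ℂ}
    (h : α * starRingEnd ℂ α + β * starRingEnd ℂ β = 1) (N : ℕ) :
    ∀ a b a' b' : ℕ, a + b = N → a' + b' = N →
      formInner N (binForm α β a b) (binForm α β a' b') =
        if a = a' then (a.factorial * b.factorial : ℂ) else 0 := by
  induction N with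
  | zero =>
    intro a b a' b' h1 h2
    obtain ⟨rfl, rfl⟩ : a = 0 ∧ b = 0 := by omega
    obtain ⟨rfl, rfl⟩ : a' = 0 ∧ b' = 0 := by omega
    simp [formInner, binForm]
  | succ N ih =>
    intro a b a' b' h1 h2
    rcases a with _ | a
    · obtain ⟨b, rfl⟩ : ∃ c, b = c + 1 := ⟨b - 1, by omega⟩
      rw [binForm_succ_right, formInner_linear_mul _ _ _ _ _ (coeff_binForm_of_lt α β (by omega)),
        ← h2, formDeriv_binForm]
      have e1 : starRingEnd ℂ (-starRingEnd ℂ β) * α + starRingEnd ℂ (starRingEnd ℂ α) * β = 0 := by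
        simp; ring
      have e2 : -(starRingEnd ℂ (-starRingEnd ℂ β) * starRingEnd ℂ β) +
          starRingEnd ℂ (starRingEnd ℂ α) * starRingEnd ℂ α = 1 := by
        simp; linear_combination h
      rw [e1, e2, mul_zero, Polynomial.C_0, zero_mul, zero_add, mul_one, formInner_C_mul_right]
      rcases b' with _ | b'
      · rw [if_neg (by omega)]; simp
      · rw [Nat.add_sub_cancel, ih 0 b a' b' (by omega) (by omega)]
        split_ifs with h0
        · obtain rfl : b = b' := by omega
          simp [Nat.factorial_succ]
        · simp
    · rw [binForm_succ_left, formInner_linear_mul _ _ _ _ _ (coeff_binForm_of_lt α β (by omega)),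
        ← h2, formDeriv_binForm]
      have e1 : starRingEnd ℂ α * α + starRingEnd ℂ β * β = 1 := by linear_combination h
      have e2 : -(starRingEnd ℂ α * starRingEnd ℂ β) +
          starRingEnd ℂ β * starRingEnd ℂ α = 0 := by ring
      rw [e1, e2, mul_zero, Polynomial.C_0, zero_mul, add_zero, mul_one, formInner_C_mul_right]
      rcases a' with _ | a'
      · rw [if_neg (by omega)]; simp
      · rw [Nat.add_sub_cancel, ih a b a' b' (by omega) (by omega)]
        split_ifs with h0 h3 h3
        · subst h0
          simp [Nat.factorial_succ]
          ring
        · omega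
        · omega
        · simp

/-! ### The derivative of the binary forms along the group -/

/-- The polynomial `F' v` is, coefficient by coefficient, the derivative at `x` in direction `v` of
the polynomial-valued function `F`. -/
def HasCoeffDerivAt {E : Type*} [NormedAddCommGroup E] [NormedSpace ℝ E]
    (F : E → Polynomial ℂ) (F' : E → Polynomial ℂ) (x : E) : Prop :=
  ∀ k, ∃ L : E →L[ℝ] ℂ, HasFDerivAt (fun y => (F y).coeff k) L x ∧ ∀ v, L v = (F' v).coeff k

section

variable {E : Type*} [NormedAddCommGroup E] [NormedSpace ℝ E]

theorem HasCoeffDerivAt.mul {F G F' G' : E → Polynomial ℂ} {x : E}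
    (hF : HasCoeffDerivAt F F' x) (hG : HasCoeffDerivAt G G' x) :
    HasCoeffDerivAt (fun y => F y * G y) (fun v => F' v * G x + F x * G' v) x := by
  intro k
  choose L hL hL' using hF
  choose M hM hM' using hG
  have h := HasFDerivAt.fun_sum (u := Finset.HasAntidiagonal.antidiagonal k)
    (A := fun p y => (F y).coeff p.1 * (G y).coeff p.2)
    (A' := fun p => (F x).coeff p.1 • M p.2 + (G x).coeff p.2 • L p.1) (x := x)
    fun p _ => (hL p.1).mul (hM p.2)
  refine ⟨_, h.congr_of_eventuallyEq (Eventually.of_forall fun y => ?_), fun v => ?_⟩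
  · simp only [Polynomial.coeff_mul]
  · simp only [sum_apply, add_apply,
      smul_apply, Polynomial.coeff_add, Polynomial.coeff_mul, hL', hM',
      smul_eq_mul, ← Finset.sum_add_distrib]
    exact Finset.sum_congr rfl fun p _ => by ring

theorem HasCoeffDerivAt.pow {F F' : E → Polynomial ℂ} {x : E} (hF : HasCoeffDerivAt F F' x)
    (n : ℕ) :
    HasCoeffDerivAt (fun y => F y ^ n)
      (fun v => Polynomial.C (n : ℂ) * (F x ^ (n - 1) * F' v)) x := by
  induction n with
  | zero =>
    intro k
    exact ⟨0, by simpa using hasFDerivAt_const _ _, fun v => by simp⟩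
  | succ n ih =>
    have h := ih.mul hF
    have e1 : (fun y => F y ^ (n + 1)) = fun y => F y ^ n * F y := by simp only [pow_succ]
    have e2 : (fun v => Polynomial.C ((n + 1 : ℕ) : ℂ) * (F x ^ (n + 1 - 1) * F' v)) =
        fun v => Polynomial.C (n : ℂ) * (F x ^ (n - 1) * F' v) * F x + F x ^ n * F' v := by
      funext v
      rcases n with _ | n
      · simp
      · simp [pow_succ]; ring
    rw [e1, e2]
    exact h

theorem hasCoeffDerivAt_linear {μ ν : E → ℂ} {μ' ν' : E →L[ℝ] ℂ} {x : E}
    (hμ : HasFDerivAt μ μ' x) (hν : HasFDerivAt ν ν' x) :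
    HasCoeffDerivAt (fun y => Polynomial.C (μ y) + Polynomial.C (ν y) * Polynomial.X)
      (fun v => Polynomial.C (μ' v) + Polynomial.C (ν' v) * Polynomial.X) x := by
  intro k
  rcases k with _ | _ | k
  · exact ⟨μ', by simpa using hμ, fun v => by simp⟩
  · exact ⟨ν', by simpa [Polynomial.coeff_C] using hν, fun v => by simp [Polynomial.coeff_C]⟩
  · exact ⟨0, by simpa [Polynomial.coeff_C, Polynomial.coeff_X] using hasFDerivAt_const _ _,
      fun v => by simp⟩

/-- The diagonal part of the left-translated derivative of the curve `(α, β)` in `SU(2)`. -/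
def diagVel (α β : ℂ) (α' β' : E →L[ℝ] ℂ) (v : E) : ℂ :=
  starRingEnd ℂ α * α' v + starRingEnd ℂ β * β' v

/-- The off-diagonal part of the left-translated derivative of the curve `(α, β)` in `SU(2)`. -/
def offVel (α β : ℂ) (α' β' : E →L[ℝ] ℂ) (v : E) : ℂ := α * β' v - β * α' v

theorem hasFDerivAt_conj {f : E → ℂ} {f' : E →L[ℝ] ℂ} {x : E} (h : HasFDerivAt f f' x) :
    HasFDerivAt (fun y => starRingEnd ℂ (f y)) (Complex.conjCLE.toContinuousLinearMap.comp f') x :=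
  (Complex.conjCLE.toContinuousLinearMap.hasFDerivAt (x := f x)).comp x h

theorem conj_diagVel {α β : E → ℂ} {α' β' : E →L[ℝ] ℂ} {x : E}
    (hα : HasFDerivAt α α' x) (hβ : HasFDerivAt β β' x)
    (h : ∀ y, α y * starRingEnd ℂ (α y) + β y * starRingEnd ℂ (β y) = 1) (v : E) :
    starRingEnd ℂ (diagVel (α x) (β x) α' β' v) = -diagVel (α x) (β x) α' β' v := by
  have h1 := (hα.mul (hasFDerivAt_conj hα)).add (hβ.mul (hasFDerivAt_conj hβ))
  have h2 := h1.congr_of_eventuallyEq (f₁ := fun _ => (1 : ℂ))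
    (Eventually.of_forall fun y => (h y).symm)
  have h3 := h2.unique (hasFDerivAt_const 1 x)
  have h4 := congrArg (fun L : E →L[ℝ] ℂ => L v) h3
  simp at h4
  simp only [diagVel, map_add, map_mul, Complex.conj_conj]
  linear_combination h4

/-- The derivative of `binForm` is that of the representation of the Lie algebra of `SU(2)`: the
lowering and raising operators change the exponents by one. -/
theorem hasCoeffDerivAt_binForm {α β : E → ℂ} {α' β' : E →L[ℝ] ℂ} {x : E}
    (hα : HasFDerivAt α α' x) (hβ : HasFDerivAt β β' x)
    (h : ∀ y, α y * starRingEnd ℂ (α y) + β y * starRingEnd ℂ (β y) = 1) (a b : ℕ) :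
    HasCoeffDerivAt (fun y => binForm (α y) (β y) a b) (fun v =>
      Polynomial.C (((a : ℂ) - b) * diagVel (α x) (β x) α' β' v) * binForm (α x) (β x) a b
      + (Polynomial.C ((a : ℂ) * offVel (α x) (β x) α' β' v)
          * binForm (α x) (β x) (a - 1) (b + 1)
        + Polynomial.C (-((b : ℂ) * starRingEnd ℂ (offVel (α x) (β x) α' β' v)))
          * binForm (α x) (β x) (a + 1) (b - 1))) x := by
  have hA := hasCoeffDerivAt_linear hα hβ
  have hB := hasCoeffDerivAt_linear (hasFDerivAt_conj hβ).neg (hasFDerivAt_conj hα)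
  have hAB := (hA.pow a).mul (hB.pow b)
  have hρ := conj_diagVel hα hβ h
  have key : ∀ v,
      Polynomial.C (α' v) + Polynomial.C (β' v) * Polynomial.X =
        Polynomial.C (diagVel (α x) (β x) α' β' v) *
          (Polynomial.C (α x) + Polynomial.C (β x) * Polynomial.X)
        + Polynomial.C (offVel (α x) (β x) α' β' v) *
          (Polynomial.C (-starRingEnd ℂ (β x)) + Polynomial.C (starRingEnd ℂ (α x))
            * Polynomial.X) := by
    intro v
    have e1 : α' v = diagVel (α x) (β x) α' β' v * α x
        + offVel (α x) (β x) α' β' v * (-starRingEnd ℂ (β x)) := by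
      simp only [diagVel, offVel]
      linear_combination (-α' v) * h x
    have e2 : β' v = diagVel (α x) (β x) α' β' v * β x
        + offVel (α x) (β x) α' β' v * starRingEnd ℂ (α x) := by
      simp only [diagVel, offVel]
      linear_combination (-β' v) * h x
    conv_lhs => rw [e1, e2]
    simp only [Polynomial.C_add, Polynomial.C_mul]
    ring
  have key' : ∀ v,
      Polynomial.C (-starRingEnd ℂ (β' v)) + Polynomial.C (starRingEnd ℂ (α' v)) * Polynomial.X =
        Polynomial.C (-diagVel (α x) (β x) α' β' v) *
          (Polynomial.C (-starRingEnd ℂ (β x)) + Polynomial.C (starRingEnd ℂ (α x))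
            * Polynomial.X)
        + Polynomial.C (-starRingEnd ℂ (offVel (α x) (β x) α' β' v)) *
          (Polynomial.C (α x) + Polynomial.C (β x) * Polynomial.X) := by
    intro v
    have e1 : -starRingEnd ℂ (β' v) = -diagVel (α x) (β x) α' β' v * -starRingEnd ℂ (β x)
        + -starRingEnd ℂ (offVel (α x) (β x) α' β' v) * α x := by
      rw [← hρ]
      simp only [diagVel, offVel, map_add, map_sub, map_mul, Complex.conj_conj]
      linear_combination starRingEnd ℂ (β' v) * h x
    have e2 : starRingEnd ℂ (α' v) = -diagVel (α x) (β x) α' β' v * starRingEnd ℂ (α x)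
        + -starRingEnd ℂ (offVel (α x) (β x) α' β' v) * β x := by
      rw [← hρ]
      simp only [diagVel, offVel, map_add, map_sub, map_mul, Complex.conj_conj]
      linear_combination (-starRingEnd ℂ (α' v)) * h x
    conv_lhs => rw [e1, e2]
    simp only [Polynomial.C_add, Polynomial.C_mul]
    ring
  convert! hAB using 1
  funext v
  have hn : ((-Complex.conjCLE.toContinuousLinearMap.comp β') v) = -starRingEnd ℂ (β' v) := rfl
  have hc : ((Complex.conjCLE.toContinuousLinearMap.comp α') v) = starRingEnd ℂ (α' v) := rfl
  rw [hn, hc, key, key']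
  simp only [binForm, Polynomial.C_mul, Polynomial.C_sub, Polynomial.C_neg]
  rcases a with _ | a <;> rcases b with _ | b <;> simp [pow_succ] <;> ring

end

/-! ### Wigner functions as matrix coefficients -/

/-- The Wigner function as a function on `SU(2)`: a coefficient of a binary form. -/
def wignerSU2 (l : ℕ) (m s : ℤ) (α β : ℂ) : ℂ :=
  (Real.sqrt (((l + m).toNat.factorial * (l - m).toNat.factorial : ℝ)
      / ((l + s).toNat.factorial * (l - s).toNat.factorial : ℝ)) : ℂ) *
    (binForm α β (l + s).toNat (l - s).toNat).coeff (l - m).toNat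

open Polynomial in
theorem coeff_linear_pow (μ ν : ℂ) (n k : ℕ) :
    ((C μ + C ν * X) ^ n).coeff k = (n.choose k : ℂ) * μ ^ (n - k) * ν ^ k := by
  rw [add_comm, add_pow, finsetSum_coeff]
  have h : ∀ i, ((C ν * X) ^ i * C μ ^ (n - i) * (n.choose i : ℂ[X])).coeff k =
      if k = i then (n.choose i : ℂ) * μ ^ (n - i) * ν ^ i else 0 := by
    intro i
    rw [mul_pow, ← C_pow, ← C_pow, ← C_eq_natCast,
      show C (ν ^ i) * X ^ i * C (μ ^ (n - i)) * C ((n.choose i : ℕ) : ℂ) =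
        C (ν ^ i * μ ^ (n - i) * (n.choose i : ℂ)) * X ^ i by simp only [C_mul]; ring,
      coeff_C_mul, coeff_X_pow]
    split_ifs <;> ring
  simp only [h, Finset.sum_ite_eq, Finset.mem_range]
  split_ifs with hk
  · rfl
  · rw [Nat.choose_eq_zero_of_lt (by omega)]; simp

theorem coeff_binForm (α β : ℂ) (a b k : ℕ) : (binForm α β a b).coeff k =
    ∑ p ∈ Finset.HasAntidiagonal.antidiagonal k, ((a.choose p.1 : ℂ) * α ^ (a - p.1) * β ^ p.1)
      * ((b.choose p.2 : ℂ) * (-starRingEnd ℂ β) ^ (b - p.2) * (starRingEnd ℂ α) ^ p.2) := by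
  simp only [binForm, Polynomial.coeff_mul, coeff_linear_pow]

/-- The first entry of the matrix in `SU(2)` of a unit quaternion. -/
def quatAlpha (q : Fin 4 → ℝ) : ℂ := ⟨q 0, -q 3⟩

/-- The second entry of the matrix in `SU(2)` of a unit quaternion. -/
def quatBeta (q : Fin 4 → ℝ) : ℂ := ⟨q 2, -q 1⟩

theorem quatAlpha_beta_unit {q : Fin 4 → ℝ} (hq : quatNormSq q = 1) :
    quatAlpha q * starRingEnd ℂ (quatAlpha q) + quatBeta q * starRingEnd ℂ (quatBeta q) = 1 := by
  unfold quatNormSq at hq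
  apply Complex.ext
  · simp [quatAlpha, quatBeta]; linarith
  · simp [quatAlpha, quatBeta]; ring

theorem norm_quatAlpha_beta {q : Fin 4 → ℝ} (hq : quatNormSq q = 1) :
    ‖quatAlpha q‖ ^ 2 + ‖quatBeta q‖ ^ 2 = 1 := by
  unfold quatNormSq at hq
  rw [← Complex.normSq_eq_norm_sq, ← Complex.normSq_eq_norm_sq]
  simp [quatAlpha, quatBeta, Complex.normSq_apply]
  linarith

theorem half_arccos {x y : ℝ} (hx : 0 ≤ x) (hy : 0 ≤ y) (h : x ^ 2 + y ^ 2 = 1) :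
    Real.cos (Real.arccos (x ^ 2 - y ^ 2) / 2) = x ∧
      Real.sin (Real.arccos (x ^ 2 - y ^ 2) / 2) = y := by
  have hx1 : x ≤ 1 := by nlinarith
  have hc : Real.cos (Real.arccos x) = x := Real.cos_arccos (by linarith) hx1
  have hs : Real.sin (Real.arccos x) = y := by
    rw [Real.sin_arccos, show 1 - x ^ 2 = y ^ 2 by linarith, Real.sqrt_sq hy]
  have h2 : Real.arccos (x ^ 2 - y ^ 2) = 2 * Real.arccos x := by
    rw [← Real.arccos_cos (x := 2 * Real.arccos x)]
    · rw [Real.cos_two_mul, hc]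
      congr 1
      linarith
    · have := Real.arccos_nonneg x; linarith
    · have := Real.arccos_le_pi_div_two.2 hx; linarith
  rw [h2, mul_div_cancel_left₀ _ (two_ne_zero)]
  exact ⟨hc, hs⟩

theorem cexp_arg_mul_I {z : ℂ} (hz : z ≠ 0) :
    Complex.exp (Complex.arg z * Complex.I) = z / ‖z‖ := by
  have h := Complex.norm_mul_exp_arg_mul_I z
  have h0 : (‖z‖ : ℂ) ≠ 0 := by simpa using hz
  rw [eq_div_iff h0, mul_comm]
  exact h

theorem exists_phase (z : ℂ) : ∃ a : ℂ, ‖a‖ = 1 ∧ z = ‖z‖ * a :=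
  ⟨Complex.exp (Complex.arg z * Complex.I), Complex.norm_exp_ofReal_mul_I _,
    (Complex.norm_mul_exp_arg_mul_I z).symm⟩

/-- The relation of the Euler angles with the phases of the entries of a matrix in `SU(2)`. At the
poles, where one of the two entries vanishes, its phase is chosen so that the relation persists. -/
theorem exists_euler_phases {q : Fin 4 → ℝ} (hq : quatNormSq q = 1) :
    ∃ a b : ℂ, ‖a‖ = 1 ∧ ‖b‖ = 1 ∧ quatAlpha q = ‖quatAlpha q‖ * a ∧
      quatBeta q = ‖quatBeta q‖ * b ∧
      Complex.exp (eulerPhi (quatRot q) * Complex.I) = b * starRingEnd ℂ a ∧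
      Complex.exp (eulerPsi (quatRot q) * Complex.I) = starRingEnd ℂ a * starRingEnd ℂ b := by
  have hne : q ≠ 0 := fun h => by simp [h, quatNormSq] at hq
  set α := quatAlpha q with hα
  set β := quatBeta q with hβ
  have h1 : (⟨(quatRot q).1 0 2, (quatRot q).1 1 2⟩ : ℂ) = 2 * (starRingEnd ℂ α * β) := by
    rw [quatRot_val hne]
    apply Complex.ext <;> simp [quatMatrix, hq, hα, hβ, quatAlpha, quatBeta] <;> ring
  have h2 : (⟨-(quatRot q).1 2 0, (quatRot q).1 2 1⟩ : ℂ) =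
      2 * (starRingEnd ℂ α * starRingEnd ℂ β) := by
    rw [quatRot_val hne]
    apply Complex.ext <;> simp [quatMatrix, hq, hα, hβ, quatAlpha, quatBeta] <;> ring
  have h3 : (⟨(quatRot q).1 1 1, -(quatRot q).1 0 1⟩ : ℂ) =
      starRingEnd ℂ α * starRingEnd ℂ α + β * β := by
    rw [quatRot_val hne]
    apply Complex.ext <;> simp [quatMatrix, hq, hα, hβ, quatAlpha, quatBeta] <;> ring
  have hpole : ((quatRot q).1 0 2 = 0 ∧ (quatRot q).1 1 2 = 0) ↔ α = 0 ∨ β = 0 := by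
    have : (⟨(quatRot q).1 0 2, (quatRot q).1 1 2⟩ : ℂ) = 0 ↔ α = 0 ∨ β = 0 := by
      rw [h1]; simp
    rw [← this, Complex.ext_iff]
    simp
  have hconj : ∀ a : ℂ, ‖a‖ = 1 → starRingEnd ℂ a * a = 1 := fun a ha => by
    rw [mul_comm, Complex.mul_conj, Complex.normSq_eq_norm_sq, ha]; simp
  have hunit := norm_quatAlpha_beta hq
  rw [← hα, ← hβ] at hunit
  by_cases h0 : α = 0 ∨ β = 0
  · have hphi : eulerPhi (quatRot q) = Complex.arg (starRingEnd ℂ α * starRingEnd ℂ α + β * β) := by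
      rw [eulerPhi, if_pos (hpole.2 h0), h3]
    have hpsi : eulerPsi (quatRot q) = 0 := by rw [eulerPsi, if_pos (hpole.2 h0)]
    rw [hphi, hpsi]
    rcases h0 with h0 | h0
    · obtain ⟨b, hb, hβb⟩ := exists_phase β
      have hn : ‖β‖ = 1 := by
        rw [h0, norm_zero] at hunit
        nlinarith [norm_nonneg β]
      rw [hn] at hβb
      refine ⟨starRingEnd ℂ b, b, by simpa using hb, hb, by simp [h0], by rw [hn]; exact hβb, ?_, ?_⟩
      · have hz : starRingEnd ℂ α * starRingEnd ℂ α + β * β = b * b := by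
          rw [h0, hβb]; simp
        have hb0 : b ≠ 0 := fun h => by simp [h] at hb
        rw [hz, cexp_arg_mul_I (mul_ne_zero hb0 hb0), norm_mul, hb]
        simp
      · simpa using (by rw [mul_comm]; exact (hconj b hb).symm : (1 : ℂ) = b * starRingEnd ℂ b)
    · obtain ⟨a, ha, hαa⟩ := exists_phase α
      have hn : ‖α‖ = 1 := by
        rw [h0, norm_zero] at hunit
        nlinarith [norm_nonneg α]
      rw [hn] at hαa
      refine ⟨a, starRingEnd ℂ a, ha, by simpa using ha, by rw [hn]; exact hαa, by simp [h0], ?_, ?_⟩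
      · have hz : starRingEnd ℂ α * starRingEnd ℂ α + β * β = starRingEnd ℂ a * starRingEnd ℂ a := by
          rw [h0, hαa]; simp
        have ha0 : starRingEnd ℂ a ≠ 0 := fun h => by
          rw [map_eq_zero] at h
          simp [h] at ha
        rw [hz, cexp_arg_mul_I (mul_ne_zero ha0 ha0), norm_mul, Complex.norm_conj, ha]
        simp
      · simpa using (hconj a ha).symm
  · have hphi : eulerPhi (quatRot q) = Complex.arg (2 * (starRingEnd ℂ α * β)) := by
      rw [eulerPhi, if_neg (fun h => h0 (hpole.1 h)), h1]
    have hpsi : eulerPsi (quatRot q) = Complex.arg (2 * (starRingEnd ℂ α * starRingEnd ℂ β)) := by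
      rw [eulerPsi, if_neg (fun h => h0 (hpole.1 h)), h2]
    push Not at h0
    obtain ⟨a, ha, hαa⟩ := exists_phase α
    obtain ⟨b, hb, hβb⟩ := exists_phase β
    have hnα : (‖α‖ : ℂ) ≠ 0 := by simpa using h0.1
    have hnβ : (‖β‖ : ℂ) ≠ 0 := by simpa using h0.2
    refine ⟨a, b, ha, hb, hαa, hβb, ?_, ?_⟩
    · rw [hphi, cexp_arg_mul_I (by simpa using h0)]
      have : starRingEnd ℂ α * β = ‖α‖ * ‖β‖ * (b * starRingEnd ℂ a) := by
        conv_lhs => rw [hαa, hβb]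
        rw [map_mul, Complex.conj_ofReal]
        ring
      rw [norm_mul, norm_mul, Complex.norm_conj, this]
      simp
      field_simp
    · rw [hpsi, cexp_arg_mul_I (by simpa using h0)]
      have : starRingEnd ℂ α * starRingEnd ℂ β =
          ‖α‖ * ‖β‖ * (starRingEnd ℂ a * starRingEnd ℂ b) := by
        conv_lhs => rw [hαa, hβb]
        rw [map_mul, map_mul, Complex.conj_ofReal, Complex.conj_ofReal]
        ring
      rw [norm_mul, norm_mul, Complex.norm_conj, Complex.norm_conj, this]
      simp
      field_simp

theorem eulerTheta_quatRot {q : Fin 4 → ℝ} (hq : quatNormSq q = 1) :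
    Real.cos (eulerTheta (quatRot q) / 2) = ‖quatAlpha q‖ ∧
      Real.sin (eulerTheta (quatRot q) / 2) = ‖quatBeta q‖ := by
  have hne : q ≠ 0 := fun h => by simp [h, quatNormSq] at hq
  have h : (quatRot q).1 2 2 = ‖quatAlpha q‖ ^ 2 - ‖quatBeta q‖ ^ 2 := by
    rw [quatRot_val hne, ← Complex.normSq_eq_norm_sq, ← Complex.normSq_eq_norm_sq]
    simp [quatMatrix, hq, quatAlpha, quatBeta, Complex.normSq_apply]
    ring
  rw [eulerTheta, h]
  exact half_arccos (norm_nonneg _) (norm_nonneg _) (norm_quatAlpha_beta hq)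

/-- Wigner's formula, with the phases of the Euler angles absorbed into the complex entries of the
matrix in `SU(2)`. -/
theorem wignerD_quatRot {q : Fin 4 → ℝ} (hq : quatNormSq q = 1) {l : ℕ} {m s : ℤ}
    (hm : m.natAbs ≤ l) (hs : s.natAbs ≤ l) :
    wignerD l m s (quatRot q) = wignerSU2 l m s (quatAlpha q) (quatBeta q) := by
  obtain ⟨a, b, ha, hb, hαa, hβb, hphi, hpsi⟩ := exists_euler_phases hq
  obtain ⟨hcos, hsin⟩ := eulerTheta_quatRot hq
  have ha0 : a ≠ 0 := fun h => by simp [h] at ha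
  have hb0 : b ≠ 0 := fun h => by simp [h] at hb
  have hca : starRingEnd ℂ a = a⁻¹ := by
    rw [Complex.inv_def, Complex.normSq_eq_norm_sq, ha]; simp
  have hcb : starRingEnd ℂ b = b⁻¹ := by
    rw [Complex.inv_def, Complex.normSq_eq_norm_sq, hb]; simp
  rw [hca] at hphi hpsi
  rw [hcb] at hpsi
  have e1 : Complex.exp (-Complex.I * m * eulerPhi (quatRot q)) = (b * a⁻¹) ^ (-m) := by
    rw [← hphi, ← Complex.exp_int_mul]
    congr 1
    push_cast
    ring
  have e2 : Complex.exp (-Complex.I * s * eulerPsi (quatRot q)) = (a⁻¹ * b⁻¹) ^ (-s) := by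
    rw [← hpsi, ← Complex.exp_int_mul]
    congr 1
    push_cast
    ring
  rw [wignerD, e1, e2, wignerSmallD, hcos, hsin, wignerSU2, coeff_binForm]
  push_cast
  rw [mul_comm _ ((Real.sqrt _ : ℂ) * _), mul_assoc, mul_assoc, Finset.sum_mul]
  congr 1
  refine Finset.sum_congr rfl fun k hk => ?_
  rw [Finset.HasAntidiagonal.mem_antidiagonal] at hk
  by_cases h1 : k.1 ≤ (l + s).toNat
  swap
  · rw [Nat.choose_eq_zero_of_lt (not_le.1 h1)]; simp
  by_cases h2 : k.2 ≤ (l - s).toNat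
  swap
  · rw [Nat.choose_eq_zero_of_lt (not_le.1 h2)]; simp
  generalize ‖quatAlpha q‖ = x at hαa ⊢
  generalize ‖quatBeta q‖ = y at hβb ⊢
  rw [hαa, hβb]
  have hα' : starRingEnd ℂ ((x : ℂ) * a) = x * a⁻¹ := by rw [map_mul, hca, Complex.conj_ofReal]
  have hβ' : starRingEnd ℂ ((y : ℂ) * b) = y * b⁻¹ := by rw [map_mul, hcb, Complex.conj_ofReal]
  rw [hα', hβ']
  obtain ⟨i, hi⟩ : ∃ i, i = (l + s).toNat - k.1 := ⟨_, rfl⟩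
  obtain ⟨j, hj⟩ : ∃ j, j = (l - s).toNat - k.2 := ⟨_, rfl⟩
  rw [← hi, ← hj]
  have hphase : (b * a⁻¹) ^ (-m) * (a⁻¹ * b⁻¹) ^ (-s) =
      a ^ i * (a⁻¹) ^ k.2 * (b ^ k.1 * (b⁻¹) ^ j) := by
    have ea : a ^ i * (a⁻¹) ^ k.2 = a ^ (m + s) := by
      rw [← zpow_natCast, ← zpow_natCast, inv_zpow', ← zpow_add₀ ha0]
      congr 1
      omega
    have eb : b ^ k.1 * (b⁻¹) ^ j = b ^ (s - m) := by
      rw [← zpow_natCast, ← zpow_natCast, inv_zpow', ← zpow_add₀ hb0]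
      congr 1
      omega
    rw [ea, eb, mul_zpow, mul_zpow, inv_zpow', inv_zpow', inv_zpow', neg_neg, neg_neg,
      zpow_add₀ ha0, zpow_sub₀ hb0, zpow_neg]
    field_simp
  calc _ = (((l + s).toNat.choose k.1 : ℂ) * ((l - s).toNat.choose k.2 : ℂ) * (-1) ^ j
        * (x : ℂ) ^ (i + k.2) * (y : ℂ) ^ (k.1 + j))
        * ((b * a⁻¹) ^ (-m) * (a⁻¹ * b⁻¹) ^ (-s)) := by ring
    _ = _ := by
      rw [hphase, neg_pow ((y : ℂ) * b⁻¹)]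
      ring

/-! ### Sums over the rows of the Wigner functions -/

theorem sum_Icc_toNat {M : Type*} [AddCommMonoid M] (l : ℕ) (f : ℕ → M) :
    ∑ m ∈ Finset.Icc (-(l : ℤ)) (l : ℤ), f ((l : ℤ) - m).toNat =
      ∑ k ∈ Finset.range (2 * l + 1), f k := by
  refine Finset.sum_nbij' (fun m => ((l : ℤ) - m).toNat) (fun k => (l : ℤ) - k) ?_ ?_ ?_ ?_ ?_
  · intro m hm
    rw [Finset.mem_Icc] at hm
    rw [Finset.mem_range]
    omega
  · intro k hk
    rw [Finset.mem_range] at hk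
    rw [Finset.mem_Icc]
    omega
  · intro m hm
    rw [Finset.mem_Icc] at hm
    omega
  · intro k hk
    omega
  · intro m _
    rfl

/-- Summing over the rows of normalized coefficients gives the invariant inner product. -/
theorem sum_normalized_coeff (l : ℕ) (s : ℤ) (F G : Polynomial ℂ) :
    ∑ m ∈ Finset.Icc (-(l : ℤ)) (l : ℤ),
      ((Real.sqrt (((l + m).toNat.factorial * (l - m).toNat.factorial : ℝ)
        / ((l + s).toNat.factorial * (l - s).toNat.factorial : ℝ)) : ℂ) *
          F.coeff (l - m).toNat) *
        starRingEnd ℂ ((Real.sqrt (((l + m).toNat.factorial * (l - m).toNat.factorial : ℝ)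
        / ((l + s).toNat.factorial * (l - s).toNat.factorial : ℝ)) : ℂ) *
          G.coeff (l - m).toNat) =
      ((l + s).toNat.factorial * (l - s).toNat.factorial : ℂ)⁻¹ * formInner (2 * l) F G := by
  rw [formInner, Finset.mul_sum, ← sum_Icc_toNat]
  refine Finset.sum_congr rfl fun m hm => ?_
  rw [Finset.mem_Icc] at hm
  rw [show 2 * l - ((l : ℤ) - m).toNat = ((l : ℤ) + m).toNat by omega]
  set r : ℝ := ((l + m).toNat.factorial * (l - m).toNat.factorial : ℝ)
        / ((l + s).toNat.factorial * (l - s).toNat.factorial : ℝ) with hr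
  have hr0 : 0 ≤ r := by positivity
  have h2 : ((Real.sqrt r : ℝ) : ℂ) * ((Real.sqrt r : ℝ) : ℂ) = (r : ℂ) := by
    rw [← Complex.ofReal_mul, Real.mul_self_sqrt hr0]
  rw [map_mul, Complex.conj_ofReal]
  calc _ = (((Real.sqrt r : ℝ) : ℂ) * ((Real.sqrt r : ℝ) : ℂ)) * (F.coeff ((l : ℤ) - m).toNat
        * starRingEnd ℂ (G.coeff ((l : ℤ) - m).toNat)) := by ring
    _ = _ := by
      rw [h2, hr]
      push_cast
      ring

/-- The derivative of `wignerSU2` in the direction with left-translated velocity `(ρ, σ)`. -/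
def wignerDeriv (l : ℕ) (m s : ℤ) (α β ρ σ : ℂ) : ℂ :=
  (Real.sqrt (((l + m).toNat.factorial * (l - m).toNat.factorial : ℝ)
      / ((l + s).toNat.factorial * (l - s).toNat.factorial : ℝ)) : ℂ) *
    (Polynomial.C ((((l + s).toNat : ℂ) - (l - s).toNat) * ρ)
        * binForm α β (l + s).toNat (l - s).toNat
      + (Polynomial.C (((l + s).toNat : ℂ) * σ)
          * binForm α β ((l + s).toNat - 1) ((l - s).toNat + 1)
        + Polynomial.C (-(((l - s).toNat : ℂ) * starRingEnd ℂ σ))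
          * binForm α β ((l + s).toNat + 1) ((l - s).toNat - 1))).coeff (l - m).toNat

theorem hasFDerivAt_wignerSU2 {E : Type*} [NormedAddCommGroup E] [NormedSpace ℝ E]
    {α β : E → ℂ} {α' β' : E →L[ℝ] ℂ} {x : E}
    (hα : HasFDerivAt α α' x) (hβ : HasFDerivAt β β' x)
    (h : ∀ y, α y * starRingEnd ℂ (α y) + β y * starRingEnd ℂ (β y) = 1) (l : ℕ) (m s : ℤ) :
    ∃ L : E →L[ℝ] ℂ, HasFDerivAt (fun y => wignerSU2 l m s (α y) (β y)) L x ∧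
      ∀ v, L v = wignerDeriv l m s (α x) (β x) (diagVel (α x) (β x) α' β' v)
        (offVel (α x) (β x) α' β' v) := by
  obtain ⟨L, hL, hL'⟩ := hasCoeffDerivAt_binForm hα hβ h (l + s).toNat (l - s).toNat
    (l - m).toNat
  exact ⟨_, hL.const_mul _, fun v => by
    rw [smul_apply, hL', smul_eq_mul, wignerDeriv]⟩

theorem sum_wignerSU2_mul_conj {α β : ℂ}
    (h : α * starRingEnd ℂ α + β * starRingEnd ℂ β = 1) {l : ℕ} {s : ℤ} (hs : s.natAbs ≤ l) :
    ∑ m ∈ Finset.Icc (-(l : ℤ)) (l : ℤ),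
      wignerSU2 l m s α β * starRingEnd ℂ (wignerSU2 l m s α β) = 1 := by
  simp only [wignerSU2]
  rw [sum_normalized_coeff, formInner_binForm h _ _ _ _ _ (by omega) (by omega), if_pos rfl]
  exact inv_mul_cancel₀ (mul_ne_zero (Nat.cast_ne_zero.2 (Nat.factorial_ne_zero _))
    (Nat.cast_ne_zero.2 (Nat.factorial_ne_zero _)))

/-- The orthogonality of the binary forms turns the sum over the rows into a matrix element of
the product of two generators. -/
theorem sum_wignerDeriv_mul_conj {α β : ℂ}
    (h : α * starRingEnd ℂ α + β * starRingEnd ℂ β = 1) {l : ℕ} {s : ℤ} (hs : s.natAbs ≤ l)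
    (ρ σ ρ' σ' : ℂ) :
    ∑ m ∈ Finset.Icc (-(l : ℤ)) (l : ℤ),
      wignerDeriv l m s α β ρ σ * starRingEnd ℂ (wignerDeriv l m s α β ρ' σ') =
      (2 * s) ^ 2 * (ρ * starRingEnd ℂ ρ')
        + (l + s) * (l - s + 1) * (σ * starRingEnd ℂ σ')
        + (l - s) * (l + s + 1) * (starRingEnd ℂ σ * σ') := by
  simp only [wignerDeriv]
  rw [sum_normalized_coeff]
  obtain ⟨a, ha⟩ : ∃ a, a = ((l : ℤ) + s).toNat := ⟨_, rfl⟩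
  obtain ⟨b, hb⟩ : ∃ b, b = ((l : ℤ) - s).toNat := ⟨_, rfl⟩
  have hN : a + b = 2 * l := by omega
  have ha' : (l : ℂ) + s = a := by
    have : (l : ℤ) + s = a := by omega
    exact_mod_cast congrArg (fun z : ℤ => (z : ℂ)) this
  have hb' : (l : ℂ) - s = b := by
    have : (l : ℤ) - s = b := by omega
    exact_mod_cast congrArg (fun z : ℤ => (z : ℂ)) this
  have hs' : 2 * (s : ℂ) = a - b := by rw [← ha', ← hb']; ring
  rw [← ha, ← hb, ha', hb', hs', ← hN]
  have key : ∀ i j i' j', i + j = a + b → i' + j' = a + b →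
      formInner (a + b) (binForm α β i j) (binForm α β i' j') =
        if i = i' then (i.factorial * j.factorial : ℂ) else 0 :=
    fun i j i' j' h1 h2 => formInner_binForm h _ i j i' j' h1 h2
  have hfa : (a.factorial : ℂ) ≠ 0 := by exact_mod_cast a.factorial_ne_zero
  have hfb : (b.factorial : ℂ) ≠ 0 := by exact_mod_cast b.factorial_ne_zero
  rw [inv_mul_eq_div, div_eq_iff (mul_ne_zero hfa hfb)]
  simp only [formInner_add_left, formInner_add_right, formInner_C_mul_left, formInner_C_mul_right]
  -- for `a = 0` or `b = 0` the truncated subtraction is harmless, its term having the factor `0`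
  rcases a with _ | a <;> rcases b with _ | b
  · rw [key 0 0 0 0 rfl rfl]
    simp
  · simp only [Nat.add_sub_cancel]
    rw [key 0 (b + 1) 0 (b + 1) (by omega) (by omega), key 0 (b + 1) (0 + 1) b (by omega) (by omega),
      key (0 + 1) b 0 (b + 1) (by omega) (by omega), key (0 + 1) b (0 + 1) b (by omega) (by omega)]
    simp [Nat.factorial_succ]
    ring
  · simp only [Nat.add_sub_cancel]
    rw [key (a + 1) 0 (a + 1) 0 (by omega) (by omega), key (a + 1) 0 a (0 + 1) (by omega) (by omega),
      key a (0 + 1) (a + 1) 0 (by omega) (by omega), key a (0 + 1) a (0 + 1) (by omega) (by omega)]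
    simp [Nat.factorial_succ]
    ring
  · simp only [Nat.add_sub_cancel]
    rw [key (a + 1) (b + 1) (a + 1) (b + 1) (by omega) (by omega),
      key (a + 1) (b + 1) a (b + 1 + 1) (by omega) (by omega),
      key (a + 1) (b + 1) (a + 1 + 1) b (by omega) (by omega),
      key a (b + 1 + 1) (a + 1) (b + 1) (by omega) (by omega),
      key a (b + 1 + 1) a (b + 1 + 1) (by omega) (by omega),
      key a (b + 1 + 1) (a + 1 + 1) b (by omega) (by omega),
      key (a + 1 + 1) b (a + 1) (b + 1) (by omega) (by omega),
      key (a + 1 + 1) b a (b + 1 + 1) (by omega) (by omega),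
      key (a + 1 + 1) b (a + 1 + 1) b (by omega) (by omega)]
    simp [Nat.factorial_succ, show ¬a = a + 1 + 1 by omega, show ¬a + 1 + 1 = a by omega]
    ring

/-- The Wigner functions of degree `l` are the entries of a unitary matrix. -/
theorem norm_wignerSU2_le {α β : ℂ}
    (h : α * starRingEnd ℂ α + β * starRingEnd ℂ β = 1) {l : ℕ} {m s : ℤ} (hs : s.natAbs ≤ l)
    (hm : m ∈ Finset.Icc (-(l : ℤ)) (l : ℤ)) : ‖wignerSU2 l m s α β‖ ≤ 1 := by
  have h1 := sum_wignerSU2_mul_conj h hs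
  simp only [Complex.mul_conj, Complex.normSq_eq_norm_sq] at h1
  have h2 : ∑ m ∈ Finset.Icc (-(l : ℤ)) (l : ℤ), ‖wignerSU2 l m s α β‖ ^ 2 = 1 := by
    exact_mod_cast h1
  have h3 := Finset.single_le_sum (f := fun m => ‖wignerSU2 l m s α β‖ ^ 2)
    (fun i _ => sq_nonneg _) hm
  rw [h2] at h3
  exact (sq_le_one_iff₀ (norm_nonneg _)).1 h3

/-- A single term of the sum over the rows is at most the sum, which is `O(l²)`. -/
theorem norm_wignerDeriv_le {α β : ℂ}
    (h : α * starRingEnd ℂ α + β * starRingEnd ℂ β = 1) {l : ℕ} {m s : ℤ} (hs : s.natAbs ≤ l)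
    (hm : m ∈ Finset.Icc (-(l : ℤ)) (l : ℤ)) {ρ σ : ℂ} {K : ℝ} (hρ : ‖ρ‖ ≤ K) (hσ : ‖σ‖ ≤ K) :
    ‖wignerDeriv l m s α β ρ σ‖ ≤ 3 * (l * K) := by
  have hK : 0 ≤ K := (norm_nonneg _).trans hρ
  have h1 := sum_wignerDeriv_mul_conj h hs ρ σ ρ σ
  rw [mul_comm (starRingEnd ℂ σ)] at h1
  simp only [Complex.mul_conj, Complex.normSq_eq_norm_sq] at h1
  have h2 : ∑ m ∈ Finset.Icc (-(l : ℤ)) (l : ℤ), ‖wignerDeriv l m s α β ρ σ‖ ^ 2 =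
      (2 * (s : ℝ)) ^ 2 * ‖ρ‖ ^ 2 + ((l : ℝ) + s) * (l - s + 1) * ‖σ‖ ^ 2
        + ((l : ℝ) - s) * (l + s + 1) * ‖σ‖ ^ 2 := by
    exact_mod_cast h1
  have h3 := Finset.single_le_sum (f := fun m => ‖wignerDeriv l m s α β ρ σ‖ ^ 2)
    (fun i _ => sq_nonneg _) hm
  rw [h2] at h3
  have hs2 : (s : ℝ) ^ 2 ≤ (l : ℝ) ^ 2 := by
    have : ((s.natAbs : ℕ) : ℝ) ≤ l := by exact_mod_cast hs
    rw [← sq_abs (s : ℝ), ← Int.cast_abs, Int.abs_eq_natAbs, Int.cast_natCast]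
    gcongr
  have hl : (l : ℝ) ≤ (l : ℝ) ^ 2 := by
    have : l ≤ l ^ 2 := Nat.le_self_pow (by norm_num) l
    exact_mod_cast this
  have hρ2 : ‖ρ‖ ^ 2 ≤ K ^ 2 := by gcongr
  have hσ2 : ‖σ‖ ^ 2 ≤ K ^ 2 := by gcongr
  refine abs_le_of_sq_le_sq' ?_ (by positivity) |>.2
  refine h3.trans ?_
  have e1 : (2 * (s : ℝ)) ^ 2 * ‖ρ‖ ^ 2 ≤ 4 * (l : ℝ) ^ 2 * K ^ 2 := by
    rw [mul_pow]
    norm_num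
    gcongr
  have e2 : ((l : ℝ) + s) * (l - s + 1) * ‖σ‖ ^ 2 + ((l : ℝ) - s) * (l + s + 1) * ‖σ‖ ^ 2 ≤
      4 * (l : ℝ) ^ 2 * K ^ 2 := by
    have e3 : ((l : ℝ) + s) * (l - s + 1) * ‖σ‖ ^ 2 + ((l : ℝ) - s) * (l + s + 1) * ‖σ‖ ^ 2
        = (2 * ((l : ℝ) ^ 2 - s ^ 2) + 2 * l) * ‖σ‖ ^ 2 := by ring
    rw [e3]
    have e4 : 2 * ((l : ℝ) ^ 2 - s ^ 2) + 2 * l ≤ 4 * (l : ℝ) ^ 2 := by nlinarith [sq_nonneg (s : ℝ)]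
    have e5 : 0 ≤ 4 * (l : ℝ) ^ 2 := by positivity
    nlinarith [sq_nonneg ‖σ‖]
  have e6 : 0 ≤ (l : ℝ) ^ 2 * K ^ 2 := by positivity
  nlinarith

/-! ### The Wigner functions in the charts of `SO3` -/

/-- The factor that normalizes the quaternion of the Cayley transform. -/
def cayleyScale (a : R3) : ℝ := (Real.sqrt (cayleyDen a))⁻¹

/-- A unit quaternion of the rotation `chart (quatRot q) a`. -/
def chartQuat (q : Fin 4 → ℝ) (a : R3) : Fin 4 → ℝ :=
  cayleyScale a • quatMul q (cayleyQuat a)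

theorem quatNormSq_cayleyQuat (a : R3) : quatNormSq (cayleyQuat a) = cayleyDen a := by
  simp [quatNormSq, cayleyQuat, cayleyDen, dotProduct, Fin.sum_univ_three]; ring

theorem cayleyScale_pos (a : R3) : 0 < cayleyScale a :=
  inv_pos.2 (Real.sqrt_pos.2 (cayleyDen_pos a))

theorem quatNormSq_chartQuat {q : Fin 4 → ℝ} (hq : quatNormSq q = 1) (a : R3) :
    quatNormSq (chartQuat q a) = 1 := by
  have h : ∀ (t : ℝ) (r : Fin 4 → ℝ), quatNormSq (t • r) = t ^ 2 * quatNormSq r := fun t r => by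
    simp [quatNormSq]; ring
  rw [chartQuat, h, quatNormSq_mul, hq, quatNormSq_cayleyQuat, cayleyScale, inv_pow,
    Real.sq_sqrt (cayleyDen_pos a).le, one_mul, inv_mul_cancel₀ (cayleyDen_pos a).ne']

theorem chart_eq_chartQuat {q : Fin 4 → ℝ} (hq : quatNormSq q = 1) (a : R3) :
    chart (quatRot q) a = quatRot (chartQuat q a) := by
  have hne : q ≠ 0 := fun h => by simp [h, quatNormSq] at hq
  rw [chart_quatRot hne, chartQuat,
    quatRot_smul (cayleyScale_pos a).ne' (quatMul_ne_zero hne (cayleyQuat_ne_zero a))]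

theorem quatAlpha_chartQuat (q : Fin 4 → ℝ) (a : R3) :
    quatAlpha (chartQuat q a) = (cayleyScale a : ℂ) * (quatAlpha q
      + (-(Complex.I / 2 * quatAlpha q) * (a 2 : ℂ)
        - starRingEnd ℂ (quatBeta q) / 2 * ((a 1 : ℂ) - Complex.I * (a 0 : ℂ)))) := by
  apply Complex.ext
  · simp [chartQuat, quatAlpha, quatBeta, quatMul, cayleyQuat]
    ring_nf
    simp
  · simp [chartQuat, quatAlpha, quatBeta, quatMul, cayleyQuat]
    ring

theorem quatBeta_chartQuat (q : Fin 4 → ℝ) (a : R3) :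
    quatBeta (chartQuat q a) = (cayleyScale a : ℂ) * (quatBeta q
      + (-(Complex.I / 2 * quatBeta q) * (a 2 : ℂ)
        + starRingEnd ℂ (quatAlpha q) / 2 * ((a 1 : ℂ) - Complex.I * (a 0 : ℂ)))) := by
  apply Complex.ext
  · simp [chartQuat, quatAlpha, quatBeta, quatMul, cayleyQuat]
    ring_nf
    simp
  · simp [chartQuat, quatAlpha, quatBeta, quatMul, cayleyQuat]
    ring

theorem contDiff_cayleyScale : ContDiff ℝ 1 cayleyScale := by
  have h : ContDiff ℝ 1 cayleyDen := by
    unfold cayleyDen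
    simp only [dotProduct, Fin.sum_univ_three]
    fun_prop
  exact (h.sqrt fun a => (cayleyDen_pos a).ne').inv fun a =>
    (Real.sqrt_pos.2 (cayleyDen_pos a)).ne'

theorem hasFDerivAt_cayleyScale_zero : HasFDerivAt cayleyScale (0 : R3 →L[ℝ] ℝ) 0 := by
  have h := hasFDerivAt_cayleyDen 0
  have h1 : (cayleyDen 0) = 1 := by simp [cayleyDen]
  simp only [Pi.zero_apply, zero_smul, Finset.sum_const_zero, smul_zero] at h
  have h2 : HasDerivAt (fun t : ℝ => (Real.sqrt t)⁻¹) _ (cayleyDen 0) :=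
    (Real.hasDerivAt_sqrt (by rw [h1]; norm_num)).inv (by rw [h1]; norm_num)
  have h3 := h2.comp_hasFDerivAt 0 h
  rw [smul_zero] at h3
  exact h3

/-- The coordinate `a i` as a complex number. -/
def coordC (i : Fin 3) : R3 →L[ℝ] ℂ :=
  Complex.ofRealCLM.comp (ContinuousLinearMap.proj (R := ℝ) i)

/-- The differential at `0` of a function `scale * (z + z₂ a₂ + w (a₁ - i a₀))`. -/
theorem hasFDerivAt_scaled_zero (z z₂ w : ℂ) :
    HasFDerivAt (fun a : R3 => (cayleyScale a : ℂ) * (z + (z₂ * (a 2 : ℂ)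
        + w * ((a 1 : ℂ) - Complex.I * (a 0 : ℂ)))))
      (z₂ • coordC 2 + w • (coordC 1 - Complex.I • coordC 0)) 0 := by
  have h0 : HasFDerivAt (fun a : R3 => (cayleyScale a : ℂ)) (0 : R3 →L[ℝ] ℂ) 0 := by
    have := Complex.ofRealCLM.hasFDerivAt.comp (0 : R3) hasFDerivAt_cayleyScale_zero
    simpa [Function.comp_def] using this
  have hc : cayleyScale 0 = 1 := by simp [cayleyScale, cayleyDen]
  have h1 : HasFDerivAt (fun a : R3 => z + (z₂ * (a 2 : ℂ)
      + w * ((a 1 : ℂ) - Complex.I * (a 0 : ℂ))))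
      (z₂ • coordC 2 + w • (coordC 1 - Complex.I • coordC 0)) 0 :=
    (z₂ • coordC 2 + w • (coordC 1 - Complex.I • coordC 0)).hasFDerivAt.const_add z
  have h2 := h0.mul h1
  refine h2.congr_fderiv ?_
  ext v
  simp [hc]

theorem contDiff_scaled (z z₂ w : ℂ) :
    ContDiff ℝ 1 fun a : R3 => (cayleyScale a : ℂ) * (z + (z₂ * (a 2 : ℂ)
      + w * ((a 1 : ℂ) - Complex.I * (a 0 : ℂ)))) := by
  have h0 : ContDiff ℝ 1 (fun a : R3 => (cayleyScale a : ℂ)) :=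
    Complex.ofRealCLM.contDiff.comp contDiff_cayleyScale
  have h1 : ContDiff ℝ 1 (fun a : R3 => z + (z₂ * (a 2 : ℂ)
      + w * ((a 1 : ℂ) - Complex.I * (a 0 : ℂ)))) :=
    contDiff_const.add (z₂ • coordC 2 + w • (coordC 1 - Complex.I • coordC 0)).contDiff
  exact h0.mul h1

theorem exists_unit_quatRot (p : SO3) : ∃ q : Fin 4 → ℝ, quatNormSq q = 1 ∧ quatRot q = p := by
  obtain ⟨r, hr, hp⟩ := exists_quatRot p
  have hn := quatNormSq_pos hr
  have ht : 0 < (Real.sqrt (quatNormSq r))⁻¹ := inv_pos.2 (Real.sqrt_pos.2 hn)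
  refine ⟨(Real.sqrt (quatNormSq r))⁻¹ • r, ?_, by rw [quatRot_smul ht.ne' hr, hp]⟩
  have h : ∀ t : ℝ, quatNormSq (t • r) = t ^ 2 * quatNormSq r := fun t => by
    simp [quatNormSq]; ring
  rw [h, inv_pow, Real.sq_sqrt hn.le, inv_mul_cancel₀ hn.ne']

theorem norm_wignerD_le (p : SO3) {l : ℕ} {m s : ℤ} (hs : s.natAbs ≤ l)
    (hm : m ∈ Finset.Icc (-(l : ℤ)) (l : ℤ)) : ‖wignerD l m s p‖ ≤ 1 := by
  obtain ⟨q, hq, rfl⟩ := exists_unit_quatRot p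
  have hm' := Finset.mem_Icc.1 hm
  rw [wignerD_quatRot hq (by omega) hs]
  exact norm_wignerSU2_le (quatAlpha_beta_unit hq) hs hm

/-- In a chart, the Wigner functions are differentiable with a differential of norm `O(l)`, and
their differentials at the centre of the chart are given by the representation of the Lie
algebra. -/
theorem exists_wignerD_chart (p : SO3) :
    ∃ (α β : ℂ) (K : ℝ), 0 ≤ K ∧ α * starRingEnd ℂ α + β * starRingEnd ℂ β = 1 ∧
      ∀ (l : ℕ) (m s : ℤ), s.natAbs ≤ l → m ∈ Finset.Icc (-(l : ℤ)) (l : ℤ) →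
        ∃ L : R3 → R3 →L[ℝ] ℂ, ∀ a ∈ Metric.ball (0 : R3) 1,
          HasFDerivAt (fun a => wignerD l m s (chart p a)) (L a) a ∧ ‖L a‖ ≤ K * l ∧
          ∀ v, L 0 v = wignerDeriv l m s α β (-(Complex.I / 2 * v 2))
            (((v 1 : ℂ) - Complex.I * v 0) / 2) := by
  obtain ⟨q, hq, rfl⟩ := exists_unit_quatRot p
  have hα0' : (fun a => quatAlpha (chartQuat q a)) = fun a : R3 => (cayleyScale a : ℂ) *
      (quatAlpha q + (-(Complex.I / 2 * quatAlpha q) * (a 2 : ℂ)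
        + -(starRingEnd ℂ (quatBeta q) / 2) * ((a 1 : ℂ) - Complex.I * (a 0 : ℂ)))) :=
    funext fun a => by
      rw [quatAlpha_chartQuat]
      ring
  have hβ0' : (fun a => quatBeta (chartQuat q a)) = fun a : R3 => (cayleyScale a : ℂ) *
      (quatBeta q + (-(Complex.I / 2 * quatBeta q) * (a 2 : ℂ)
        + starRingEnd ℂ (quatAlpha q) / 2 * ((a 1 : ℂ) - Complex.I * (a 0 : ℂ)))) :=
    funext fun a => quatBeta_chartQuat q a
  have hα1 : ContDiff ℝ 1 fun a => quatAlpha (chartQuat q a) := by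
    rw [hα0']
    exact contDiff_scaled _ _ _
  have hβ1 : ContDiff ℝ 1 fun a => quatBeta (chartQuat q a) := by
    rw [hβ0']
    exact contDiff_scaled _ _ _
  have hα0 := hasFDerivAt_scaled_zero (quatAlpha q) (-(Complex.I / 2 * quatAlpha q))
      (-(starRingEnd ℂ (quatBeta q) / 2))
  have hβ0 := hasFDerivAt_scaled_zero (quatBeta q) (-(Complex.I / 2 * quatBeta q))
      (starRingEnd ℂ (quatAlpha q) / 2)
  rw [← hα0'] at hα0
  rw [← hβ0'] at hβ0
  have hα := fun a => (hα1.differentiable one_ne_zero a).hasFDerivAt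
  have hβ := fun a => (hβ1.differentiable one_ne_zero a).hasFDerivAt
  have hunit := fun a => quatAlpha_beta_unit (quatNormSq_chartQuat hq a)
  have hcompact : IsCompact (Metric.closedBall (0 : R3) 1) := isCompact_closedBall 0 1
  obtain ⟨Kα, hKα⟩ := hcompact.exists_bound_of_continuousOn
    (hα1.continuous_fderiv one_ne_zero).continuousOn
  obtain ⟨Kβ, hKβ⟩ := hcompact.exists_bound_of_continuousOn
    (hβ1.continuous_fderiv one_ne_zero).continuousOn
  have hKα0 : 0 ≤ Kα := (norm_nonneg _).trans (hKα 0 (by simp))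
  have hKβ0 : 0 ≤ Kβ := (norm_nonneg _).trans (hKβ 0 (by simp))
  refine ⟨quatAlpha q, quatBeta q, 3 * (Kα + Kβ), by positivity, quatAlpha_beta_unit hq, ?_⟩
  intro l m s hs hm
  have hm' := Finset.mem_Icc.1 hm
  choose L hL hL' using fun a => hasFDerivAt_wignerSU2 (hα a) (hβ a) hunit l m s
  have hfun : (fun a => wignerD l m s (chart (quatRot q) a)) =
      fun a => wignerSU2 l m s (quatAlpha (chartQuat q a)) (quatBeta (chartQuat q a)) :=
    funext fun a => by
      rw [chart_eq_chartQuat hq, wignerD_quatRot (quatNormSq_chartQuat hq a) (by omega) hs]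
  refine ⟨L, fun a ha => ⟨?_, ?_, ?_⟩⟩
  · rw [hfun]
    exact hL a
  · refine ContinuousLinearMap.opNorm_le_bound _ (by positivity) fun v => ?_
    rw [hL']
    have ha' := Metric.ball_subset_closedBall ha
    have hnα : ‖quatAlpha (chartQuat q a)‖ ≤ 1 := by
      have := norm_quatAlpha_beta (quatNormSq_chartQuat hq a)
      nlinarith [sq_nonneg ‖quatBeta (chartQuat q a)‖, norm_nonneg (quatAlpha (chartQuat q a))]
    have hnβ : ‖quatBeta (chartQuat q a)‖ ≤ 1 := by
      have := norm_quatAlpha_beta (quatNormSq_chartQuat hq a)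
      nlinarith [sq_nonneg ‖quatAlpha (chartQuat q a)‖, norm_nonneg (quatBeta (chartQuat q a))]
    have hvα := ContinuousLinearMap.le_of_opNorm_le _ (hKα a ha') v
    have hvβ := ContinuousLinearMap.le_of_opNorm_le _ (hKβ a ha') v
    refine (norm_wignerDeriv_le (K := (Kα + Kβ) * ‖v‖) (hunit a) hs hm ?_ ?_).trans
      (le_of_eq (by ring))
    · refine (norm_add_le _ _).trans ?_
      rw [norm_mul, norm_mul, Complex.norm_conj, Complex.norm_conj, add_mul]
      exact add_le_add
        ((mul_le_of_le_one_left (norm_nonneg _) hnα).trans hvα)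
        ((mul_le_of_le_one_left (norm_nonneg _) hnβ).trans hvβ)
    · refine (norm_sub_le _ _).trans ?_
      rw [norm_mul, norm_mul, add_comm, add_mul]
      exact add_le_add
        ((mul_le_of_le_one_left (norm_nonneg _) hnβ).trans hvα)
        ((mul_le_of_le_one_left (norm_nonneg _) hnα).trans hvβ)
  · intro v
    have hc : chartQuat q 0 = q := by
      have hs0 : cayleyScale 0 = 1 := by simp [cayleyScale, cayleyDen]
      rw [chartQuat, hs0, one_smul]
      ext i
      fin_cases i <;> simp [quatMul, cayleyQuat]
    have hu := quatAlpha_beta_unit hq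
    rw [hL' 0 v, hα0.fderiv, hβ0.fderiv, hc]
    congr 1
    · simp [diagVel, coordC]
      linear_combination (-(Complex.I / 2 * v 2)) * hu
    · simp [offVel, coordC]
      linear_combination (((v 1 : ℂ) - Complex.I * v 0) / 2) * hu

/-- The sum over the rows of products of differentials of Wigner functions, which is where the
coefficients of the metric come from. -/
theorem re_sum_wignerDeriv {α β : ℂ}
    (h : α * starRingEnd ℂ α + β * starRingEnd ℂ β = 1) {l : ℕ} {s : ℤ} (hs : s.natAbs ≤ l)
    (u v : R3) :
    (∑ m ∈ Finset.Icc (-(l : ℤ)) (l : ℤ),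
      wignerDeriv l m s α β (-(Complex.I / 2 * u 2)) (((u 1 : ℂ) - Complex.I * u 0) / 2) *
        starRingEnd ℂ (wignerDeriv l m s α β (-(Complex.I / 2 * v 2))
          (((v 1 : ℂ) - Complex.I * v 0) / 2))).re =
      ((l : ℝ) * (l + 1) - s ^ 2) / 2 * (u 0 * v 0 + u 1 * v 1) + (s : ℝ) ^ 2 * (u 2 * v 2) := by
  rw [sum_wignerDeriv_mul_conj h hs]
  have e1 : (2 * (s : ℂ)) ^ 2 = ((2 * (s : ℝ)) ^ 2 : ℝ) := by push_cast; ring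
  have e2 : ((l : ℂ) + s) * (l - s + 1) = (((l : ℝ) + s) * (l - s + 1) : ℝ) := by push_cast; ring
  have e3 : ((l : ℂ) - s) * (l + s + 1) = (((l : ℝ) - s) * (l + s + 1) : ℝ) := by push_cast; ring
  have hc2 : starRingEnd ℂ (2 : ℂ) = 2 := map_ofNat _ 2
  rw [e1, e2, e3]
  simp only [Complex.add_re, Complex.re_ofReal_mul]
  simp [hc2]
  ring

/-! ### Decay of the coefficients -/

open Polynomial in
/-- The generator `(y ∂_x - x ∂_y) / 2` of the rotations `R_2(θ)` on binary forms of degree `N`. -/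
def rotGen (N : ℕ) (F : ℂ[X]) : ℂ[X] :=
  C (1 / 2) * (X * formDeriv 1 0 N F - formDeriv 0 1 N F)

theorem coeff_rotGen_zero (N : ℕ) (F : Polynomial ℂ) :
    (rotGen N F).coeff 0 = -(1 / 2) * F.coeff 1 := by
  rw [rotGen, Polynomial.coeff_C_mul, Polynomial.coeff_sub, coeff_formDeriv]
  simp

theorem coeff_rotGen_succ (N : ℕ) (F : Polynomial ℂ) (k : ℕ) :
    (rotGen N F).coeff (k + 1) = 1 / 2 * ((N - k) * F.coeff k)
      - 1 / 2 * ((k + 2) * F.coeff (k + 2)) := by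
  rw [rotGen, Polynomial.coeff_C_mul, Polynomial.coeff_sub, Polynomial.coeff_X_mul,
    coeff_formDeriv, coeff_formDeriv]
  simp
  ring

theorem rotGen_C_mul (N : ℕ) (c : ℂ) (F : Polynomial ℂ) :
    rotGen N (Polynomial.C c * F) = Polynomial.C c * rotGen N F := by
  ext k
  rcases k with _ | k
  · simp only [coeff_rotGen_zero, Polynomial.coeff_C_mul]; ring
  · simp only [coeff_rotGen_succ, Polynomial.coeff_C_mul]; ring

theorem HasCoeffDerivAt.rotGen {E : Type*} [NormedAddCommGroup E] [NormedSpace ℝ E]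
    {F F' : E → Polynomial ℂ} {x : E} (h : HasCoeffDerivAt F F' x) (N : ℕ) :
    HasCoeffDerivAt (fun y => SpinSO3.rotGen N (F y)) (fun v => SpinSO3.rotGen N (F' v)) x := by
  intro k
  choose L hL hL' using h
  rcases k with _ | k
  · refine ⟨_, ((hL 1).const_mul (-(1 / 2))).congr_of_eventuallyEq
      (Eventually.of_forall fun y => coeff_rotGen_zero N (F y)), fun v => ?_⟩
    rw [coeff_rotGen_zero, smul_apply, hL', smul_eq_mul]
  · refine ⟨_, ((((hL k).const_mul ((N : ℂ) - k)).const_mul (1 / 2)).sub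
      (((hL (k + 2)).const_mul ((k : ℂ) + 2)).const_mul (1 / 2))).congr_of_eventuallyEq
      (Eventually.of_forall fun y => coeff_rotGen_succ N (F y) k), fun v => ?_⟩
    rw [coeff_rotGen_succ, sub_apply]
    simp only [smul_apply, hL', smul_eq_mul]

/-- The binary forms of degree `N`, that is, the polynomials of degree at most `N`. -/
def IsForm (N : ℕ) (F : Polynomial ℂ) : Prop := ∀ k, N < k → F.coeff k = 0

theorem IsForm.rotGen {N : ℕ} {F : Polynomial ℂ} (hF : IsForm N F) :
    IsForm N (SpinSO3.rotGen N F) := by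
  intro k hk
  obtain ⟨k, rfl⟩ : ∃ i, k = i + 1 := ⟨k - 1, by omega⟩
  rw [coeff_rotGen_succ, hF (k + 2) (by omega)]
  rcases Nat.lt_or_ge N k with h | h
  · rw [hF k h]; ring
  · obtain rfl : k = N := by omega
    ring

theorem formInner_rotGen_left {N : ℕ} {F G : Polynomial ℂ} (hF : IsForm (N + 1) F) :
    formInner (N + 1) (rotGen (N + 1) F) G =
      1 / 2 * (formInner N (formDeriv 1 0 (N + 1) F) (formDeriv 0 1 (N + 1) G)
        - formInner N (formDeriv 0 1 (N + 1) F) (formDeriv 1 0 (N + 1) G)) := by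
  have h1 : (formDeriv 1 0 (N + 1) F).coeff (N + 1) = 0 := by
    rw [coeff_formDeriv]
    simp
  have h2 : (formDeriv 0 1 (N + 1) F).coeff (N + 1) = 0 := by
    rw [coeff_formDeriv, hF (N + 1 + 1) (by omega)]
    simp
  have e1 := formInner_linear_mul 0 1 N _ G h1
  have e2 := formInner_linear_mul 1 0 N _ G h2
  simp only [Polynomial.C_0, Polynomial.C_1, zero_add, one_mul, zero_mul, add_zero] at e1 e2
  rw [rotGen, formInner_C_mul_left, sub_eq_add_neg, formInner_add_left, e1]
  have e3 : formInner (N + 1) (-formDeriv 0 1 (N + 1) F) G =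
      -formInner (N + 1) (formDeriv 0 1 (N + 1) F) G := by
    have := formInner_C_mul_left (N + 1) (-1) (formDeriv 0 1 (N + 1) F) G
    simpa using this
  rw [e3, e2]
  ring

/-- The generator is skew for the invariant inner product. -/
theorem formInner_rotGen {N : ℕ} {F G : Polynomial ℂ} (hF : IsForm (N + 1) F)
    (hG : IsForm (N + 1) G) :
    formInner (N + 1) F (rotGen (N + 1) G) = -formInner (N + 1) (rotGen (N + 1) F) G := by
  rw [← formInner_conj_symm, formInner_rotGen_left hG, formInner_rotGen_left hF, map_mul, map_sub,
    formInner_conj_symm, formInner_conj_symm]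
  have : starRingEnd ℂ (1 / 2 : ℂ) = 1 / 2 := by
    rw [map_div₀, map_one, map_ofNat]
  rw [this]
  ring

/-- The squared norm of a form. -/
def formNormSq (N : ℕ) (F : Polynomial ℂ) : ℝ :=
  ∑ k ∈ Finset.range (N + 1), ((k.factorial : ℝ) * ((N - k).factorial : ℝ)) * ‖F.coeff k‖ ^ 2

theorem formInner_self (N : ℕ) (F : Polynomial ℂ) : formInner N F F = (formNormSq N F : ℂ) := by
  rw [formInner, formNormSq]
  push_cast
  refine Finset.sum_congr rfl fun k _ => ?_
  rw [mul_assoc, Complex.mul_conj, Complex.normSq_eq_norm_sq]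
  push_cast
  ring

theorem norm_formInner_sq_le (N : ℕ) (F G : Polynomial ℂ) :
    ‖formInner N F G‖ ^ 2 ≤ formNormSq N F * formNormSq N G := by
  set w : ℕ → ℝ := fun k => (k.factorial : ℝ) * ((N - k).factorial : ℝ) with hw
  have hw0 : ∀ k, 0 ≤ w k := fun k => by positivity
  have h1 : ‖formInner N F G‖ ≤ ∑ k ∈ Finset.range (N + 1),
      (Real.sqrt (w k) * ‖F.coeff k‖) * (Real.sqrt (w k) * ‖G.coeff k‖) := by
    refine (norm_sum_le _ _).trans (le_of_eq (Finset.sum_congr rfl fun k _ => ?_))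
    have h2 := Real.mul_self_sqrt (hw0 k)
    rw [norm_mul, norm_mul, norm_mul, Complex.norm_conj, Complex.norm_natCast,
      Complex.norm_natCast]
    calc _ = w k * (‖F.coeff k‖ * ‖G.coeff k‖) := by rw [hw]; ring
      _ = (Real.sqrt (w k) * Real.sqrt (w k)) * (‖F.coeff k‖ * ‖G.coeff k‖) := by rw [h2]
      _ = _ := by ring
  have h3 := Finset.sum_mul_sq_le_sq_mul_sq (Finset.range (N + 1))
    (fun k => Real.sqrt (w k) * ‖F.coeff k‖) (fun k => Real.sqrt (w k) * ‖G.coeff k‖)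
  have h4 : ∀ H : Polynomial ℂ, ∑ k ∈ Finset.range (N + 1), (Real.sqrt (w k) * ‖H.coeff k‖) ^ 2 =
      formNormSq N H := fun H => by
    refine Finset.sum_congr rfl fun k _ => ?_
    rw [mul_pow, Real.sq_sqrt (hw0 k)]
  rw [h4, h4] at h3
  exact (pow_le_pow_left₀ (norm_nonneg _) h1 2).trans h3

/-- The Cauchy-Schwarz inequality makes the norms of the iterates of a skew operator
logarithmically convex. -/
theorem formNormSq_rotGen_sq_le {N : ℕ} {F : Polynomial ℂ} (hF : IsForm (N + 1) F) :
    formNormSq (N + 1) (rotGen (N + 1) F) ^ 2 ≤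
      formNormSq (N + 1) F * formNormSq (N + 1) (rotGen (N + 1) (rotGen (N + 1) F)) := by
  have h := norm_formInner_sq_le (N + 1) F (rotGen (N + 1) (rotGen (N + 1) F))
  rw [formInner_rotGen hF hF.rotGen, norm_neg, formInner_self, Complex.norm_real, Real.norm_eq_abs,
    sq_abs] at h
  exact h

theorem formInner_iterate_six_rotGen {N : ℕ} {F : Polynomial ℂ} (hF : IsForm (N + 1) F) :
    formInner (N + 1) ((rotGen (N + 1))^[6] F) F =
      -(formNormSq (N + 1) (rotGen (N + 1) (rotGen (N + 1) (rotGen (N + 1) F))) : ℂ) := by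
  have e1 := formInner_rotGen hF.rotGen.rotGen.rotGen.rotGen.rotGen hF
  have e2 := formInner_rotGen hF.rotGen.rotGen.rotGen.rotGen hF.rotGen
  have e3 := formInner_rotGen hF.rotGen.rotGen.rotGen hF.rotGen.rotGen
  simp only [Function.iterate_succ_apply', Function.iterate_zero, id]
  rw [← formInner_self]
  linear_combination e1 - e2 + e3

/-- On the forms at a real rotation the generator acts by lowering and raising operators. -/
theorem rotGen_binForm (x y : ℝ) (a b : ℕ) :
    rotGen (a + b) (binForm x y a b) =
      Polynomial.C ((a : ℂ) * (1 / 2)) * binForm x y (a - 1) (b + 1)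
        + Polynomial.C (-((b : ℂ) * (1 / 2))) * binForm x y (a + 1) (b - 1) := by
  rw [rotGen, formDeriv_binForm, formDeriv_binForm]
  rcases a with _ | a <;> rcases b with _ | b <;>
    simp [binForm, pow_succ] <;> ring

/-- The forms of the rotation `R_2(θ)`. -/
def rotForm (a b : ℕ) (θ : ℝ) : Polynomial ℂ :=
  binForm (Real.cos (θ / 2) : ℝ) (Real.sin (θ / 2) : ℝ) a b

theorem hasCoeffDerivAt_rotForm (a b : ℕ) (θ : ℝ) :
    HasCoeffDerivAt (rotForm a b)
      (fun v => Polynomial.C (v : ℂ) * rotGen (a + b) (rotForm a b θ)) θ := by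
  have hθ : HasDerivAt (fun t : ℝ => t / 2) (1 / 2) θ := (hasDerivAt_id θ).div_const 2
  have hc : HasFDerivAt (fun t : ℝ => ((Real.cos (t / 2) : ℝ) : ℂ)) _ θ :=
    (hθ.cos.ofReal_comp).hasFDerivAt
  have hs : HasFDerivAt (fun t : ℝ => ((Real.sin (t / 2) : ℝ) : ℂ)) _ θ :=
    (hθ.sin.ofReal_comp).hasFDerivAt
  have hunit : ∀ t : ℝ, ((Real.cos (t / 2) : ℝ) : ℂ) * starRingEnd ℂ ((Real.cos (t / 2) : ℝ) : ℂ)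
      + ((Real.sin (t / 2) : ℝ) : ℂ) * starRingEnd ℂ ((Real.sin (t / 2) : ℝ) : ℂ) = 1 := fun t => by
    rw [Complex.conj_ofReal, Complex.conj_ofReal]
    have := Real.cos_sq_add_sin_sq (t / 2)
    rw [pow_two, pow_two] at this
    exact_mod_cast this
  have h := hasCoeffDerivAt_binForm hc hs hunit a b
  convert! h using 1
  funext v
  have h1 := hunit θ
  rw [Complex.conj_ofReal, Complex.conj_ofReal] at h1
  have hd : diagVel ((Real.cos (θ / 2) : ℝ) : ℂ) ((Real.sin (θ / 2) : ℝ) : ℂ)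
      (ContinuousLinearMap.toSpanSingleton ℝ (((-Real.sin (θ / 2) * (1 / 2) : ℝ)) : ℂ))
      (ContinuousLinearMap.toSpanSingleton ℝ (((Real.cos (θ / 2) * (1 / 2) : ℝ)) : ℂ)) v = 0 := by
    simp only [diagVel, Complex.conj_ofReal, ContinuousLinearMap.toSpanSingleton_apply,
      Complex.real_smul]
    push_cast
    ring
  have ho : offVel ((Real.cos (θ / 2) : ℝ) : ℂ) ((Real.sin (θ / 2) : ℝ) : ℂ)
      (ContinuousLinearMap.toSpanSingleton ℝ (((-Real.sin (θ / 2) * (1 / 2) : ℝ)) : ℂ))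
      (ContinuousLinearMap.toSpanSingleton ℝ (((Real.cos (θ / 2) * (1 / 2) : ℝ)) : ℂ)) v =
      v * (1 / 2) := by
    simp only [offVel, ContinuousLinearMap.toSpanSingleton_apply, Complex.real_smul]
    push_cast at h1 ⊢
    linear_combination (v / 2 : ℂ) * h1
  rw [hd, ho, rotForm, rotGen_binForm]
  have hv : starRingEnd ℂ ((v : ℂ) * (1 / 2)) = v * (1 / 2) := by
    rw [map_mul, Complex.conj_ofReal, map_div₀, map_one, map_ofNat]
  rw [hv]
  simp only [Polynomial.C_mul, Polynomial.C_neg, mul_zero, Polynomial.C_0, zero_mul, zero_add]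
  ring

theorem hasDerivAt_coeff_iterate_rotGen (a b j k : ℕ) (θ : ℝ) :
    HasDerivAt (fun t => ((rotGen (a + b))^[j] (rotForm a b t)).coeff k)
      (((rotGen (a + b))^[j + 1] (rotForm a b θ)).coeff k) θ := by
  have h : HasCoeffDerivAt (fun t => (rotGen (a + b))^[j] (rotForm a b t))
      (fun v => Polynomial.C (v : ℂ) * (rotGen (a + b))^[j + 1] (rotForm a b θ)) θ := by
    induction j with
    | zero => exact hasCoeffDerivAt_rotForm a b θ
    | succ j ih =>
      have h' := ih.rotGen (a + b)
      simp only [rotGen_C_mul] at h'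
      simp only [Function.iterate_succ_apply'] at h' ⊢
      exact h'
  obtain ⟨L, hL, hL'⟩ := h k
  have := hL.hasDerivAt
  rw [hL' 1] at this
  simpa using this

theorem ofReal_wignerSmallD_self {l : ℕ} {s : ℤ} (θ : ℝ) :
    (wignerSmallD l s s θ : ℂ) = (rotForm (l + s).toNat (l - s).toNat θ).coeff (l - s).toNat := by
  have hr : Real.sqrt (((l + s).toNat.factorial * (l - s).toNat.factorial : ℝ)
      / ((l + s).toNat.factorial * (l - s).toNat.factorial : ℝ)) = 1 := by
    rw [div_self (mul_ne_zero (Nat.cast_ne_zero.2 (Nat.factorial_ne_zero _))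
      (Nat.cast_ne_zero.2 (Nat.factorial_ne_zero _))), Real.sqrt_one]
  rw [wignerSmallD, hr, one_mul, rotForm, coeff_binForm]
  push_cast
  refine Finset.sum_congr rfl fun k _ => ?_
  have h1 : starRingEnd ℂ (Complex.cos (θ / 2)) = Complex.cos (θ / 2) := by
    rw [← Complex.ofReal_ofNat, ← Complex.ofReal_div, ← Complex.ofReal_cos, Complex.conj_ofReal]
  have h2 : starRingEnd ℂ (Complex.sin (θ / 2)) = Complex.sin (θ / 2) := by
    rw [← Complex.ofReal_ofNat, ← Complex.ofReal_div, ← Complex.ofReal_sin, Complex.conj_ofReal]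
  rw [h1, h2, neg_pow (Complex.sin (θ / 2)), pow_add, pow_add]
  ring

/-- The derivatives of `d^l_{s,s}` are matrix elements of the powers of the generator. -/
theorem iteratedDeriv_wignerSmallD_self (l : ℕ) (s : ℤ) (j : ℕ) :
    iteratedDeriv j (wignerSmallD l s s) = fun θ =>
      (((rotGen ((l + s).toNat + (l - s).toNat))^[j]
        (rotForm (l + s).toNat (l - s).toNat θ)).coeff (l - s).toNat).re := by
  induction j with
  | zero =>
    funext θ
    rw [iteratedDeriv_zero, Function.iterate_zero, id, ← ofReal_wignerSmallD_self,
      Complex.ofReal_re]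
  | succ j ih =>
    rw [iteratedDeriv_succ, ih]
    funext θ
    have h := hasDerivAt_coeff_iterate_rotGen (l + s).toNat (l - s).toNat j (l - s).toNat θ
    have h2 : HasDerivAt (fun t => (((rotGen ((l + s).toNat + (l - s).toNat))^[j]
        (rotForm (l + s).toNat (l - s).toNat t)).coeff (l - s).toNat).re) _ θ :=
      (Complex.reCLM.hasFDerivAt.comp_hasDerivAt θ h)
    exact h2.deriv

/-- The sixth derivative of `d^l_{s,s}` at `0` is `-‖J³ e‖²` for the skew generator `J` of the
rotations `R_2(θ)` and the unit vector `e` of weight `s`, so that it dominates the cube of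
`‖J e‖² = (l (l + 1) - s²) / 2`. -/
theorem iteratedDeriv_six_wignerSmallD_le {l : ℕ} {s : ℤ} (hs : s.natAbs ≤ l) (hl : 1 ≤ l) :
    (((l : ℝ) * (l + 1) - s ^ 2) / 2) ^ 3 ≤ -iteratedDeriv 6 (wignerSmallD l s s) 0 := by
  rw [iteratedDeriv_wignerSmallD_self]
  obtain ⟨a, ha⟩ : ∃ a, a = ((l : ℤ) + s).toNat := ⟨_, rfl⟩
  obtain ⟨b, hb⟩ : ∃ b, b = ((l : ℤ) - s).toNat := ⟨_, rfl⟩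
  obtain ⟨N, hN⟩ : ∃ N, a + b = N + 1 := ⟨a + b - 1, by omega⟩
  rw [← ha, ← hb, hN]
  set T := rotGen (N + 1) with hT
  set x := rotForm a b 0 with hx
  have hx1 : x = binForm 1 0 a b := by simp [hx, rotForm]
  have h10 : (1 : ℂ) * starRingEnd ℂ 1 + 0 * starRingEnd ℂ 0 = 1 := by simp
  have hf0 : IsForm (N + 1) x := fun k hk => by
    rw [hx1]
    exact coeff_binForm_of_lt _ _ (by omega)
  have hf1 : IsForm (N + 1) (T x) := hf0.rotGen
  set M : ℝ := (a.factorial : ℝ) * b.factorial with hM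
  have hM0 : 0 < M := by positivity
  have hI0 : formNormSq (N + 1) x = M := by
    have h := formInner_binForm h10 (N + 1) a b a b hN hN
    rw [← hx1, formInner_self, if_pos rfl] at h
    rw [hM]
    exact_mod_cast h
  have hI1 : formNormSq (N + 1) (T x) = ((l : ℝ) * (l + 1) - s ^ 2) / 2 * M := by
    have h := sum_wignerDeriv_mul_conj h10 hs 0 (1 / 2) 0 (1 / 2)
    simp only [wignerDeriv] at h
    rw [sum_normalized_coeff, ← ha, ← hb, show 2 * l = N + 1 by omega] at h
    have hTx : T x = Polynomial.C ((a : ℂ) * (1 / 2)) * binForm 1 0 (a - 1) (b + 1)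
        + Polynomial.C (-((b : ℂ) * (1 / 2))) * binForm 1 0 (a + 1) (b - 1) := by
      have := rotGen_binForm 1 0 a b
      rw [hN] at this
      simpa [hx1, hT] using this
    have hc : starRingEnd ℂ (1 / 2 : ℂ) = 1 / 2 := by rw [map_div₀, map_one, map_ofNat]
    simp only [mul_zero, Polynomial.C_0, zero_mul, zero_add, hc] at h
    rw [← hTx, formInner_self, inv_mul_eq_div, div_eq_iff (mul_ne_zero
      (Nat.cast_ne_zero.2 (Nat.factorial_ne_zero _))
      (Nat.cast_ne_zero.2 (Nat.factorial_ne_zero _)))] at h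
    have h' : formNormSq (N + 1) (T x) = (((l : ℝ) + s) * (l - s + 1) * (1 / 2 * (1 / 2))
        + ((l : ℝ) - s) * (l + s + 1) * (1 / 2 * (1 / 2))) * ((a.factorial : ℝ) * b.factorial) := by
      apply Complex.ofReal_injective
      rw [h]
      push_cast
      ring
    rw [h', hM]
    ring
  have hcoeff : ∀ F : Polynomial ℂ, formInner (N + 1) F x = (M : ℂ) * F.coeff b := by
    intro F
    have hxb : x = Polynomial.X ^ b := by rw [hx1]; simp [binForm]
    rw [formInner, hxb, Finset.sum_eq_single b]
    · rw [show N + 1 - b = a by omega, hM, Polynomial.coeff_X_pow_self, map_one]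
      push_cast
      ring
    · intro k _ hk
      rw [Polynomial.coeff_X_pow, if_neg hk]
      simp
    · intro h
      exact absurd (Finset.mem_range.2 (by omega)) h
  have h6 : (M : ℂ) * ((T^[6] x).coeff b) = -(formNormSq (N + 1) (T (T (T x))) : ℂ) := by
    rw [← hcoeff, formInner_iterate_six_rotGen hf0]
  have h6' : M * ((T^[6] x).coeff b).re = -formNormSq (N + 1) (T (T (T x))) := by
    have := congrArg Complex.re h6
    rwa [Complex.re_ofReal_mul, Complex.neg_re, Complex.ofReal_re] at this
  have c1 := formNormSq_rotGen_sq_le hf0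
  have c2 := formNormSq_rotGen_sq_le hf1
  rw [← hT, hI0, hI1] at c1
  rw [← hT, hI1] at c2
  set lam : ℝ := ((l : ℝ) * (l + 1) - s ^ 2) / 2 with hlam
  have hlam0 : 0 < lam := by
    have h1 : ((s.natAbs : ℕ) : ℝ) ≤ l := by exact_mod_cast hs
    have h2 : (s : ℝ) ^ 2 = ((s.natAbs : ℕ) : ℝ) ^ 2 := by
      rw [← sq_abs (s : ℝ), ← Int.cast_abs, Int.abs_eq_natAbs, Int.cast_natCast]
    have h3 : (1 : ℝ) ≤ l := by exact_mod_cast hl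
    have h4 : (0 : ℝ) ≤ (s.natAbs : ℕ) := Nat.cast_nonneg _
    rw [hlam, h2]
    nlinarith
  set I2 := formNormSq (N + 1) (T (T x)) with hI2
  set I3 := formNormSq (N + 1) (T (T (T x))) with hI3
  have d1 : lam ^ 2 * M ≤ I2 := by
    have : M * (lam ^ 2 * M) ≤ M * I2 := by linarith [c1]
    exact le_of_mul_le_mul_left this hM0
  have d2 : lam ^ 3 * M ≤ I3 := by
    have h1 : (lam ^ 2 * M) ^ 2 ≤ I2 ^ 2 := pow_le_pow_left₀ (by positivity) d1 2
    have : lam * M * (lam ^ 3 * M) ≤ lam * M * I3 := by linarith [c2, h1]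
    exact le_of_mul_le_mul_left this (by positivity)
  have : M * lam ^ 3 ≤ M * (-((T^[6] x).coeff b).re) := by linarith
  exact le_of_mul_le_mul_left this hM0

/-- Smoothness of the covariance makes the coefficients decay. The convergence of the sixth
derivatives at `0`, whose terms have a constant sign and are bounded below in modulus by a multiple of
`c_l² l⁶`, makes `∑ c_l² l⁶` finite, and `c_l l² ≤ c_l² l⁶ + l⁻²`. -/
theorem SmoothCovariance.summable {s : ℤ} (hs : s ≠ 0) {c : ℕ → ℝ}
    (hc : ∀ l, s.natAbs ≤ l → 0 ≤ c l) (h : SmoothCovariance s c) :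
    Summable fun n : ℕ => c (s.natAbs + n) * ((s.natAbs + n : ℕ) : ℝ) ^ 2 := by
  obtain ⟨k, -, hk⟩ := h
  have h6 := ((hk 6).tendstoLocallyUniformlyOn (s := Set.univ)).tendsto_at (Set.mem_univ 0)
  set S := s.natAbs with hS
  have hS1 : 1 ≤ S := Int.natAbs_pos.2 hs
  have hterm : ∀ n : ℕ, c (S + n) ^ 2 *
      (((((S + n : ℕ) : ℝ)) * (((S + n : ℕ) : ℝ) + 1) - (s : ℝ) ^ 2) / 2) ^ 3 ≤
      -(c (S + n) ^ 2 * iteratedDeriv 6 (wignerSmallD (S + n) s s) 0) := fun n => by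
    rw [← mul_neg]
    exact mul_le_mul_of_nonneg_left
      (iteratedDeriv_six_wignerSmallD_le (by omega) (by omega)) (sq_nonneg _)
  have hlam : ∀ n : ℕ, ((S + n : ℕ) : ℝ) ^ 2 / (2 * S) ≤
      (((S + n : ℕ) : ℝ) * (((S + n : ℕ) : ℝ) + 1) - (s : ℝ) ^ 2) / 2 := fun n => by
    have h2 : (s : ℝ) ^ 2 = (S : ℝ) ^ 2 := by
      rw [← sq_abs (s : ℝ), ← Int.cast_abs, Int.abs_eq_natAbs, Int.cast_natCast]
    have h3 : (1 : ℝ) ≤ S := by exact_mod_cast hS1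
    have h4 : (0 : ℝ) ≤ n := Nat.cast_nonneg _
    rw [h2, div_le_iff₀ (by positivity)]
    push_cast
    nlinarith [mul_nonneg h4 h4, mul_nonneg h4 (by linarith : (0 : ℝ) ≤ S),
      mul_nonneg (mul_nonneg h4 (by linarith : (0 : ℝ) ≤ S)) (by linarith : (0 : ℝ) ≤ (S : ℝ) - 1),
      mul_nonneg (mul_nonneg h4 h4) (by linarith : (0 : ℝ) ≤ (S : ℝ) - 1)]
  have hlam3 : ∀ n : ℕ, (((S + n : ℕ) : ℝ) ^ 2 / (2 * S)) ^ 3 ≤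
      ((((S + n : ℕ) : ℝ) * (((S + n : ℕ) : ℝ) + 1) - (s : ℝ) ^ 2) / 2) ^ 3 := fun n =>
    pow_le_pow_left₀ (by positivity) (hlam n) 3
  have hneg : Summable fun n : ℕ =>
      -(c (S + n) ^ 2 * iteratedDeriv 6 (wignerSmallD (S + n) s s) 0) := by
    have hnn : ∀ n : ℕ, 0 ≤ -(c (S + n) ^ 2 * iteratedDeriv 6 (wignerSmallD (S + n) s s) 0) :=
      fun n => le_trans (mul_nonneg (sq_nonneg _) (le_trans (by positivity) (hlam3 n))) (hterm n)
    refine ((hasSum_iff_tendsto_nat_of_nonneg hnn (-iteratedDeriv 6 k 0)).2 ?_).summable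
    simp only [Finset.sum_neg_distrib]
    exact h6.neg
  have hsum6 : Summable fun n : ℕ => c (S + n) ^ 2 * (((S + n : ℕ) : ℝ) ^ 2 / (2 * S)) ^ 3 :=
    Summable.of_nonneg_of_le (fun n => by positivity)
      (fun n => (mul_le_mul_of_nonneg_left (hlam3 n) (sq_nonneg _)).trans (hterm n)) hneg
  have hinv : Summable fun n : ℕ => (1 : ℝ) / ((S + n : ℕ) : ℝ) ^ 2 := by
    have := (summable_nat_add_iff (f := fun n : ℕ => (1 : ℝ) / (n : ℝ) ^ 2) S).2
      (Real.summable_one_div_nat_pow.2 (by norm_num))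
    simpa [add_comm] using this
  refine Summable.of_nonneg_of_le (fun n => mul_nonneg (hc _ (by omega)) (by positivity)) ?_
    ((hsum6.mul_left ((2 * (S : ℝ)) ^ 3)).add hinv)
  intro n
  have hL : (0 : ℝ) < ((S + n : ℕ) : ℝ) := by exact_mod_cast (by omega : 0 < S + n)
  have hSr : (0 : ℝ) < S := by exact_mod_cast hS1
  generalize ((S + n : ℕ) : ℝ) = L at hL ⊢
  -- `2 x y ≤ x² + y²` for `x = c L³` and `y = 1 / L`
  have e1 : (2 * (S : ℝ)) ^ 3 * (c (S + n) ^ 2 * (L ^ 2 / (2 * S)) ^ 3) = (c (S + n) * L ^ 3) ^ 2 := by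
    field_simp
  have e2 : c (S + n) * L ^ 2 = (c (S + n) * L ^ 3) * (1 / L) := by field_simp
  have e3 : (1 : ℝ) / L ^ 2 = (1 / L) ^ 2 := by rw [div_pow, one_pow]
  rw [e1, e2, e3]
  nlinarith [sq_nonneg (c (S + n) * L ^ 3 - 1 / L), sq_nonneg (c (S + n) * L ^ 3),
    sq_nonneg (1 / L)]

/-! ### Second moments of the Gaussian family -/

theorem measurable_complex_mk : Measurable fun x : ℝ × ℝ => (⟨x.1, x.2⟩ : ℂ) :=
  Complex.measurableEquivRealProd.symm.measurable

section Moments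

variable {Ω : Type*} [MeasurableSpace Ω] {P : Measure Ω} {X Y : Ω → ℂ}

theorem hasLaw_re (hX : HasLaw X complexGaussian P) :
    HasLaw (fun ω => (X ω).re) (gaussianReal 0 (1 / 2)) P := by
  have h : HasLaw Complex.re (gaussianReal 0 (1 / 2)) complexGaussian := by
    refine ⟨Complex.measurable_re.aemeasurable, ?_⟩
    rw [complexGaussian, Measure.map_map Complex.measurable_re measurable_complex_mk]
    exact measurePreserving_fst.map_eq
  exact h.comp hX

theorem hasLaw_im (hX : HasLaw X complexGaussian P) :
    HasLaw (fun ω => (X ω).im) (gaussianReal 0 (1 / 2)) P := by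
  have h : HasLaw Complex.im (gaussianReal 0 (1 / 2)) complexGaussian := by
    refine ⟨Complex.measurable_im.aemeasurable, ?_⟩
    rw [complexGaussian, Measure.map_map Complex.measurable_im measurable_complex_mk]
    exact measurePreserving_snd.map_eq
  exact h.comp hX

theorem memLp_of_hasLaw_gaussian {A : Ω → ℝ} {v : NNReal} (hA : HasLaw A (gaussianReal 0 v) P) :
    MemLp A 2 P := by
  have h := memLp_id_gaussianReal (μ := 0) (v := v) 2
  rw [← hA.map_eq] at h
  exact h.comp_of_map hA.aemeasurable

theorem integral_of_hasLaw_gaussian {A : Ω → ℝ} {v : NNReal} (hA : HasLaw A (gaussianReal 0 v) P) :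
    ∫ ω, A ω ∂P = 0 := by
  rw [hA.integral_eq, integral_id_gaussianReal]

theorem integral_sq_of_hasLaw_gaussian {A : Ω → ℝ} {v : NNReal}
    (hA : HasLaw A (gaussianReal 0 v) P) : ∫ ω, A ω ^ 2 ∂P = v := by
  have h : Var[A; P] = v := by
    rw [hA.variance_eq, ← variance_id_gaussianReal (μ := 0) (v := v)]
  rw [variance_of_integral_eq_zero hA.aemeasurable (integral_of_hasLaw_gaussian hA)] at h
  exact h

theorem integral_re_mul_im (hX : HasLaw X complexGaussian P) :
    ∫ ω, (X ω).re * (X ω).im ∂P = 0 := by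
  have hm : Measurable fun z : ℂ => z.re * z.im := Complex.measurable_re.mul Complex.measurable_im
  have h := hX.integral_comp (f := fun z : ℂ => z.re * z.im) hm.aestronglyMeasurable
  change ∫ ω, (X ω).re * (X ω).im ∂P = _ at h
  rw [h, complexGaussian, integral_map measurable_complex_mk.aemeasurable hm.aestronglyMeasurable]
  have := integral_prod_mul (μ := gaussianReal 0 (1 / 2)) (ν := gaussianReal 0 (1 / 2))
    (fun x : ℝ => x) (fun y : ℝ => y)
  simp only [integral_id_gaussianReal, zero_mul] at this
  exact this

theorem memLp_of_hasLaw_complexGaussian (hX : HasLaw X complexGaussian P) : MemLp X 2 P :=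
  memLp_re_im_iff.1
    ⟨memLp_of_hasLaw_gaussian (hasLaw_re hX), memLp_of_hasLaw_gaussian (hasLaw_im hX)⟩

theorem integral_norm_sq (hX : HasLaw X complexGaussian P) : ∫ ω, ‖X ω‖ ^ 2 ∂P = 1 := by
  have h1 := integral_sq_of_hasLaw_gaussian (hasLaw_re hX)
  have h2 := integral_sq_of_hasLaw_gaussian (hasLaw_im hX)
  have e : ∀ ω, ‖X ω‖ ^ 2 = (X ω).re ^ 2 + (X ω).im ^ 2 := fun ω => by
    rw [← Complex.normSq_eq_norm_sq, Complex.normSq_apply]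
    ring
  simp only [e]
  rw [integral_add (memLp_of_hasLaw_gaussian (hasLaw_re hX)).integrable_sq
    (memLp_of_hasLaw_gaussian (hasLaw_im hX)).integrable_sq, h1, h2]
  norm_num

theorem integrable_norm_mul_norm (hX : HasLaw X complexGaussian P)
    (hY : HasLaw Y complexGaussian P) : Integrable (fun ω => ‖X ω‖ * ‖Y ω‖) P :=
  (memLp_of_hasLaw_complexGaussian hX).norm.integrable_mul
    (memLp_of_hasLaw_complexGaussian hY).norm

theorem integral_norm_mul_norm_le (hX : HasLaw X complexGaussian P)
    (hY : HasLaw Y complexGaussian P) : ∫ ω, ‖X ω‖ * ‖Y ω‖ ∂P ≤ 1 := by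
  have i1 := (memLp_of_hasLaw_complexGaussian hX).norm.integrable_sq
  have i2 := (memLp_of_hasLaw_complexGaussian hY).norm.integrable_sq
  calc ∫ ω, ‖X ω‖ * ‖Y ω‖ ∂P ≤ ∫ ω, (‖X ω‖ ^ 2 + ‖Y ω‖ ^ 2) / 2 ∂P :=
        integral_mono (integrable_norm_mul_norm hX hY) ((i1.add i2).div_const 2) fun ω => by
          have := two_mul_le_add_sq ‖X ω‖ ‖Y ω‖
          simp only
          linarith
    _ = 1 := by
      rw [integral_div, integral_add i1 i2, integral_norm_sq hX, integral_norm_sq hY]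
      norm_num

theorem integrable_norm [IsProbabilityMeasure P] (hX : HasLaw X complexGaussian P) :
    Integrable (fun ω => ‖X ω‖) P :=
  (memLp_of_hasLaw_complexGaussian hX).norm.integrable one_le_two

theorem integral_norm_le [IsProbabilityMeasure P] (hX : HasLaw X complexGaussian P) :
    ∫ ω, ‖X ω‖ ∂P ≤ 1 := by
  have i1 := (memLp_of_hasLaw_complexGaussian hX).norm.integrable_sq
  calc ∫ ω, ‖X ω‖ ∂P ≤ ∫ ω, (‖X ω‖ ^ 2 + 1) / 2 ∂P :=
        integral_mono (integrable_norm hX)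
          ((i1.add (integrable_const 1)).div_const 2) fun ω => by
          have := two_mul_le_add_sq ‖X ω‖ 1
          simp only
          linarith
    _ = 1 := by
      rw [integral_div, integral_add i1 (integrable_const 1), integral_norm_sq hX]
      simp

theorem memLp_re_mul (hX : HasLaw X complexGaussian P) (z : ℂ) :
    MemLp (fun ω => (X ω * z).re) 2 P := by
  have h := ((memLp_of_hasLaw_gaussian (hasLaw_re hX)).mul_const z.re).sub
    ((memLp_of_hasLaw_gaussian (hasLaw_im hX)).mul_const z.im)
  exact h

theorem integral_re_mul_mul_re_mul (hX : HasLaw X complexGaussian P) (z w : ℂ) :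
    ∫ ω, (X ω * z).re * (X ω * w).re ∂P = (z * starRingEnd ℂ w).re / 2 := by
  have hr := memLp_of_hasLaw_gaussian (hasLaw_re hX)
  have hi := memLp_of_hasLaw_gaussian (hasLaw_im hX)
  have e : ∀ ω, (X ω * z).re * (X ω * w).re =
      ((z.re * w.re) * (X ω).re ^ 2 + (z.im * w.im) * (X ω).im ^ 2)
        + (-(z.re * w.im + z.im * w.re)) * ((X ω).re * (X ω).im) := fun ω => by
    simp only [Complex.mul_re]
    ring
  have i1 : Integrable (fun ω => (z.re * w.re) * (X ω).re ^ 2) P := hr.integrable_sq.const_mul _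
  have i2 : Integrable (fun ω => (z.im * w.im) * (X ω).im ^ 2) P := hi.integrable_sq.const_mul _
  have i3 : Integrable (fun ω => (-(z.re * w.im + z.im * w.re)) * ((X ω).re * (X ω).im)) P :=
    (hr.integrable_mul hi).const_mul _
  have i12 : Integrable (fun ω => (z.re * w.re) * (X ω).re ^ 2 + (z.im * w.im) * (X ω).im ^ 2) P :=
    i1.add i2
  simp only [e]
  rw [integral_add i12 i3, integral_add i1 i2,
    integral_const_mul, integral_const_mul, integral_const_mul,
    integral_sq_of_hasLaw_gaussian (hasLaw_re hX), integral_sq_of_hasLaw_gaussian (hasLaw_im hX),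
    integral_re_mul_im hX]
  simp
  ring

theorem integral_re_mul (hX : HasLaw X complexGaussian P) [IsFiniteMeasure P] (z : ℂ) :
    ∫ ω, (X ω * z).re ∂P = 0 := by
  simp only [Complex.mul_re]
  rw [integral_sub
    (((memLp_of_hasLaw_gaussian (hasLaw_re hX)).integrable one_le_two).mul_const _)
    (((memLp_of_hasLaw_gaussian (hasLaw_im hX)).integrable one_le_two).mul_const _),
    integral_mul_const, integral_mul_const, integral_of_hasLaw_gaussian (hasLaw_re hX),
    integral_of_hasLaw_gaussian (hasLaw_im hX)]
  ring

theorem integral_re_mul_mul_re_mul_of_indepFun [IsFiniteMeasure P]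
    (hX : HasLaw X complexGaussian P) (hY : HasLaw Y complexGaussian P) (h : IndepFun X Y P)
    (z w : ℂ) : ∫ ω, (X ω * z).re * (Y ω * w).re ∂P = 0 := by
  have hz : ∀ z : ℂ, Measurable fun x : ℂ => (x * z).re := fun z =>
    Complex.measurable_re.comp (measurable_id.mul_const z)
  have h' : IndepFun (fun ω => (X ω * z).re) (fun ω => (Y ω * w).re) P := h.comp (hz z) (hz w)
  rw [h'.integral_fun_mul_eq_mul_integral (memLp_re_mul hX z).1 (memLp_re_mul hY w).1,
    integral_re_mul hX, zero_mul]

end Moments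

/-! ### Integration of random series -/

section Series

variable {Ω : Type*} [MeasurableSpace Ω] {P : Measure Ω}

theorem ae_summable_of_summable_integral {F : ℕ → Ω → ℝ} (h0 : ∀ n ω, 0 ≤ F n ω)
    (hF : ∀ n, Integrable (F n) P) (h : Summable fun n => ∫ ω, F n ω ∂P) :
    ∀ᵐ ω ∂P, Summable fun n => F n ω := by
  have hm : ∀ n, AEMeasurable (fun ω => ENNReal.ofReal (F n ω)) P := fun n =>
    (hF n).1.aemeasurable.ennreal_ofReal
  have hfin : ∫⁻ ω, ∑' n, ENNReal.ofReal (F n ω) ∂P ≠ ⊤ := by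
    rw [lintegral_tsum hm]
    have : ∀ n, ∫⁻ ω, ENNReal.ofReal (F n ω) ∂P = ENNReal.ofReal (∫ ω, F n ω ∂P) := fun n =>
      (ofReal_integral_eq_lintegral_ofReal (hF n) (Eventually.of_forall (h0 n))).symm
    simp only [this]
    exact h.tsum_ofReal_ne_top
  filter_upwards [ae_lt_top' (AEMeasurable.tsum hm) hfin] with ω hω
  refine (ENNReal.summable_toReal hω.ne).congr fun n => ?_
  exact ENNReal.toReal_ofReal (h0 n ω)

/-- The mean of the product of two random series with uncorrelated terms of different index. -/
theorem integral_tsum_mul_tsum {Y Z : ℕ → Ω → ℝ} {a b d : ℕ → ℝ} (ha : Summable a)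
    (hb : Summable b) (ha0 : ∀ n, 0 ≤ a n) (hb0 : ∀ n, 0 ≤ b n)
    (hY : ∀ᵐ ω ∂P, Summable fun n => ‖Y n ω‖) (hZ : ∀ᵐ ω ∂P, Summable fun n => ‖Z n ω‖)
    (hint : ∀ n k, Integrable (fun ω => Y n ω * Z k ω) P)
    (hle : ∀ n k, ∫ ω, ‖Y n ω * Z k ω‖ ∂P ≤ a n * b k)
    (hd : ∀ n, ∫ ω, Y n ω * Z n ω ∂P = d n)
    (ho : ∀ n k, n ≠ k → ∫ ω, Y n ω * Z k ω ∂P = 0) :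
    ∫ ω, (∑' n, Y n ω) * ∑' n, Z n ω ∂P = ∑' n, d n := by
  have e : (fun ω => (∑' n, Y n ω) * ∑' n, Z n ω) =ᵐ[P]
      fun ω => ∑' i : ℕ × ℕ, Y i.1 ω * Z i.2 ω := by
    filter_upwards [hY, hZ] with ω h1 h2
    exact tsum_mul_tsum_of_summable_norm h1 h2
  have hs : Summable fun i : ℕ × ℕ => ∫ ω, ‖Y i.1 ω * Z i.2 ω‖ ∂P :=
    Summable.of_nonneg_of_le (fun i => integral_nonneg fun ω => norm_nonneg _)
      (fun i => hle i.1 i.2)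
      (summable_mul_of_summable_norm (f := a) (g := b)
        (by simpa only [Real.norm_of_nonneg (ha0 _)] using ha)
        (by simpa only [Real.norm_of_nonneg (hb0 _)] using hb))
  have h := hasSum_integral_of_summable_integral_norm
    (F := fun (i : ℕ × ℕ) ω => Y i.1 ω * Z i.2 ω) (fun i => hint i.1 i.2) hs
  rw [integral_congr_ae e, ← h.tsum_eq, h.summable.tsum_prod]
  refine tsum_congr fun n => ?_
  rw [tsum_eq_single n fun k hk => ho n k (Ne.symm hk), hd]

end Series

/-! ### The Adler-Taylor metric of a spin field -/

/-- The sum of the moduli of the Gaussian variables of degree `l`. -/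
def gaussianAbs {Ω : Type*} (γ : ℕ → ℤ → Ω → ℂ) (l : ℕ) (ω : Ω) : ℝ :=
  ∑ m ∈ Finset.Icc (-(l : ℤ)) (l : ℤ), ‖γ l m ω‖

theorem gaussianAbs_nonneg {Ω : Type*} {γ : ℕ → ℤ → Ω → ℂ} (l : ℕ) (ω : Ω) : 0 ≤ gaussianAbs γ l ω :=
  Finset.sum_nonneg fun _ _ => norm_nonneg _

section Field

variable {Ω : Type*} [MeasurableSpace Ω] {P : Measure Ω} {s : ℤ} {c : ℕ → ℝ}
  {γ : ℕ → ℤ → Ω → ℂ}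

theorem natAbs_le_of_mem_Icc {l : ℕ} {m : ℤ} (hm : m ∈ Finset.Icc (-(l : ℤ)) (l : ℤ)) :
    m.natAbs ≤ l := by
  have := Finset.mem_Icc.1 hm
  omega

theorem integrable_gaussianAbs_mul (hγ : IsGaussianFamily P s γ) {l l' : ℕ}
    (hl : s.natAbs ≤ l) (hl' : s.natAbs ≤ l') :
    Integrable (fun ω => gaussianAbs γ l ω * gaussianAbs γ l' ω) P := by
  simp only [gaussianAbs, Finset.sum_mul_sum]
  exact integrable_finsetSum _ fun m hm => integrable_finsetSum _ fun m' hm' =>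
    integrable_norm_mul_norm (hγ.law l m hl (natAbs_le_of_mem_Icc hm))
      (hγ.law l' m' hl' (natAbs_le_of_mem_Icc hm'))

theorem card_Icc_neg (l : ℕ) : ((Finset.Icc (-(l : ℤ)) (l : ℤ)).card : ℝ) = 2 * l + 1 := by
  rw [Int.card_Icc, show ((l : ℤ) + 1 - -(l : ℤ)).toNat = 2 * l + 1 by omega]
  push_cast
  rfl

theorem integral_gaussianAbs_mul_le (hγ : IsGaussianFamily P s γ) {l l' : ℕ}
    (hl : s.natAbs ≤ l) (hl' : s.natAbs ≤ l') :
    ∫ ω, gaussianAbs γ l ω * gaussianAbs γ l' ω ∂P ≤ (2 * l + 1) * (2 * l' + 1) := by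
  simp only [gaussianAbs, Finset.sum_mul_sum]
  have hi : ∀ m ∈ Finset.Icc (-(l : ℤ)) (l : ℤ), ∀ m' ∈ Finset.Icc (-(l' : ℤ)) (l' : ℤ),
      Integrable (fun ω => ‖γ l m ω‖ * ‖γ l' m' ω‖) P := fun m hm m' hm' =>
    integrable_norm_mul_norm (hγ.law l m hl (natAbs_le_of_mem_Icc hm))
      (hγ.law l' m' hl' (natAbs_le_of_mem_Icc hm'))
  rw [integral_finsetSum _ fun m hm => integrable_finsetSum _ (hi m hm)]
  calc _ ≤ ∑ m ∈ Finset.Icc (-(l : ℤ)) (l : ℤ), ∑ m' ∈ Finset.Icc (-(l' : ℤ)) (l' : ℤ), (1 : ℝ) :=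
        Finset.sum_le_sum fun m hm => by
          rw [integral_finsetSum _ (hi m hm)]
          exact Finset.sum_le_sum fun m' hm' =>
            integral_norm_mul_norm_le (hγ.law l m hl (natAbs_le_of_mem_Icc hm))
              (hγ.law l' m' hl' (natAbs_le_of_mem_Icc hm'))
    _ = _ := by
      rw [Finset.sum_const, Finset.sum_const, nsmul_eq_mul, nsmul_eq_mul, mul_one, card_Icc_neg,
        card_Icc_neg]

variable [IsProbabilityMeasure P]

theorem integrable_gaussianAbs (hγ : IsGaussianFamily P s γ) {l : ℕ} (hl : s.natAbs ≤ l) :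
    Integrable (gaussianAbs γ l) P :=
  integrable_finsetSum _ fun m hm => integrable_norm (hγ.law l m hl (natAbs_le_of_mem_Icc hm))

theorem integral_gaussianAbs_le (hγ : IsGaussianFamily P s γ) {l : ℕ} (hl : s.natAbs ≤ l) :
    ∫ ω, gaussianAbs γ l ω ∂P ≤ 2 * l + 1 := by
  simp only [gaussianAbs]
  rw [integral_finsetSum _ fun m hm => integrable_norm (hγ.law l m hl (natAbs_le_of_mem_Icc hm)),
    ← card_Icc_neg, ← mul_one ((Finset.Icc (-(l : ℤ)) (l : ℤ)).card : ℝ), ← nsmul_eq_mul]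
  exact Finset.sum_le_card_nsmul _ _ _ fun m hm =>
    integral_norm_le (hγ.law l m hl (natAbs_le_of_mem_Icc hm))

theorem summable_coeff_mul (hs : s ≠ 0) (hc : ∀ l, s.natAbs ≤ l → 0 ≤ c l)
    (h : SmoothCovariance s c) :
    Summable fun n : ℕ => c (s.natAbs + n) * ((s.natAbs + n : ℕ) : ℝ)
      * (2 * ((s.natAbs + n : ℕ) : ℝ) + 1) := by
  refine Summable.of_nonneg_of_le
    (fun n => mul_nonneg (mul_nonneg (hc _ (by omega)) (by positivity)) (by positivity)) ?_
    ((SmoothCovariance.summable hs hc h).mul_left 3)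
  intro n
  have h0 := hc (s.natAbs + n) (by omega)
  have h1 : (1 : ℝ) ≤ ((s.natAbs + n : ℕ) : ℝ) := by
    have := Int.natAbs_pos.2 hs
    exact_mod_cast (by omega : 1 ≤ s.natAbs + n)
  generalize ((s.natAbs + n : ℕ) : ℝ) = L at h1 ⊢
  nlinarith [mul_nonneg (mul_nonneg h0 (by linarith : (0 : ℝ) ≤ L)) (sub_nonneg.2 h1)]

theorem ae_summable_gaussianAbs (hs : s ≠ 0) (hc : ∀ l, s.natAbs ≤ l → 0 ≤ c l)
    (h : SmoothCovariance s c) (hγ : IsGaussianFamily P s γ) :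
    ∀ᵐ ω ∂P, Summable fun n : ℕ => c (s.natAbs + n) * ((s.natAbs + n : ℕ) : ℝ)
      * gaussianAbs γ (s.natAbs + n) ω := by
  have h0 : ∀ n : ℕ, 0 ≤ c (s.natAbs + n) * ((s.natAbs + n : ℕ) : ℝ) := fun n =>
    mul_nonneg (hc _ (by omega)) (by positivity)
  refine ae_summable_of_summable_integral (fun n ω => mul_nonneg (h0 n) (gaussianAbs_nonneg _ _))
    (fun n => (integrable_gaussianAbs hγ (by omega)).const_mul _) ?_
  refine Summable.of_nonneg_of_le (fun n => integral_nonneg fun ω =>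
    mul_nonneg (h0 n) (gaussianAbs_nonneg _ _)) (fun n => ?_) (summable_coeff_mul hs hc h)
  rw [integral_const_mul]
  exact mul_le_mul_of_nonneg_left (integral_gaussianAbs_le hγ (by omega)) (h0 n)

end Field

section Differential

variable {Ω : Type*} {s : ℤ} {c : ℕ → ℝ} {γ : ℕ → ℤ → Ω → ℂ}

/-- The differential of the field is the sum of the differentials of its terms wherever a series of
bounds on these converges. -/
theorem differential_spinField (hs : s ≠ 0) (hc : ∀ l, s.natAbs ≤ l → 0 ≤ c l) {p : SO3}
    {K : ℝ} {D : ℕ → ℤ → R3 → ℂ}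
    (hD : ∀ l m, s.natAbs ≤ l → m ∈ Finset.Icc (-(l : ℤ)) (l : ℤ) →
      ∃ L : R3 → R3 →L[ℝ] ℂ, ∀ a ∈ Metric.ball (0 : R3) 1,
        HasFDerivAt (fun a => wignerD l m s (chart p a)) (L a) a ∧ ‖L a‖ ≤ K * l ∧
          ∀ v, L 0 v = D l m v)
    {ω : Ω} (hω : Summable fun n : ℕ => c (s.natAbs + n) * ((s.natAbs + n : ℕ) : ℝ)
      * gaussianAbs γ (s.natAbs + n) ω) (v : R3) :
    differential (fun q => spinField s c γ q ω) p v =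
      ∑' n : ℕ, c (s.natAbs + n) * ∑ m ∈ Finset.Icc (-((s.natAbs + n : ℕ) : ℤ))
        ((s.natAbs + n : ℕ) : ℤ), (γ (s.natAbs + n) m ω * D (s.natAbs + n) m v).re := by
  set S := s.natAbs with hS
  have hS1 : 1 ≤ S := Int.natAbs_pos.2 hs
  have h00 : (0 : R3) ∈ Metric.ball (0 : R3) 1 := Metric.mem_ball_self one_pos
  choose! L hL using hD
  set L' : ℕ → R3 → R3 →L[ℝ] ℂ := fun n a => (c (S + n) : ℂ) •
    ∑ m ∈ Finset.Icc (-((S + n : ℕ) : ℤ)) ((S + n : ℕ) : ℤ), γ (S + n) m ω • L (S + n) m a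
  have hderiv : ∀ (n : ℕ), ∀ a ∈ Metric.ball (0 : R3) 1,
      HasFDerivAt (fun a => (c (S + n) : ℂ) * ∑ m ∈ Finset.Icc (-((S + n : ℕ) : ℤ))
        ((S + n : ℕ) : ℤ), γ (S + n) m ω * wignerD (S + n) m s (chart p a)) (L' n a) a :=
    fun n a ha => (HasFDerivAt.fun_sum fun m hm =>
      ((hL (S + n) m (by omega) hm a ha).1.const_mul _)).const_mul _
  have hbound : ∀ (n : ℕ), ∀ a ∈ Metric.ball (0 : R3) 1,
      ‖L' n a‖ ≤ K * (c (S + n) * ((S + n : ℕ) : ℝ) * gaussianAbs γ (S + n) ω) := by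
    intro n a ha
    have hcn : 0 ≤ c (S + n) := hc _ (by omega)
    rw [norm_smul, Complex.norm_real, Real.norm_of_nonneg hcn]
    have : ‖∑ m ∈ Finset.Icc (-((S + n : ℕ) : ℤ)) ((S + n : ℕ) : ℤ), γ (S + n) m ω •
        L (S + n) m a‖ ≤ gaussianAbs γ (S + n) ω * (K * ((S + n : ℕ) : ℝ)) := by
      refine (norm_sum_le _ _).trans ?_
      rw [gaussianAbs, Finset.sum_mul]
      refine Finset.sum_le_sum fun m hm => ?_
      rw [norm_smul]
      exact mul_le_mul_of_nonneg_left (hL (S + n) m (by omega) hm a ha).2.1 (norm_nonneg _)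
    refine (mul_le_mul_of_nonneg_left this hcn).trans (le_of_eq (by ring))
  have hval : Summable fun n : ℕ => (c (S + n) : ℂ) * ∑ m ∈ Finset.Icc (-((S + n : ℕ) : ℤ))
        ((S + n : ℕ) : ℤ), γ (S + n) m ω * wignerD (S + n) m s (chart p 0) := by
    refine Summable.of_norm_bounded hω fun n => ?_
    have hcn : 0 ≤ c (S + n) := hc _ (by omega)
    rw [norm_mul, Complex.norm_real, Real.norm_of_nonneg hcn, mul_assoc]
    refine mul_le_mul_of_nonneg_left ?_ hcn
    have h1 : (1 : ℝ) ≤ ((S + n : ℕ) : ℝ) := by exact_mod_cast (by omega : 1 ≤ S + n)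
    refine le_trans ?_ (le_mul_of_one_le_left (gaussianAbs_nonneg _ _) h1)
    refine (norm_sum_le _ _).trans (Finset.sum_le_sum fun m hm => ?_)
    rw [norm_mul]
    exact mul_le_of_le_one_right (norm_nonneg _) (norm_wignerD_le _ (by omega) hm)
  have hsum := hω.mul_left K
  have hmain := hasFDerivAt_tsum_of_isPreconnected hsum Metric.isOpen_ball
    (convex_ball (0 : R3) 1).isPreconnected hderiv hbound h00 hval h00
  have hre : HasFDerivAt (fun a => spinField s c γ (chart p a) ω)
      (Complex.reCLM.comp (∑' n, L' n 0)) 0 := Complex.reCLM.hasFDerivAt.comp (0 : R3) hmain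
  have hL's : Summable fun n => L' n 0 := Summable.of_norm_bounded hsum fun n => hbound n 0 h00
  rw [differential, hre.fderiv, ContinuousLinearMap.comp_apply]
  have e1 : (∑' n, L' n 0) v = ∑' n, L' n 0 v :=
    (ContinuousLinearMap.apply ℝ ℂ v).map_tsum hL's
  have hsv := (ContinuousLinearMap.apply ℝ ℂ v).summable hL's
  simp only [ContinuousLinearMap.apply_apply] at hsv
  rw [e1, Complex.reCLM.map_tsum hsv]
  refine tsum_congr fun n => ?_
  have e2 : L' n 0 v = (c (S + n) : ℂ) * ∑ m ∈ Finset.Icc (-((S + n : ℕ) : ℤ)) ((S + n : ℕ) : ℤ),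
      γ (S + n) m ω * D (S + n) m v := by
    simp only [L', smul_apply, sum_apply, smul_eq_mul]
    congr 1
    refine Finset.sum_congr rfl fun m hm => ?_
    rw [(hL (S + n) m (by omega) hm 0 h00).2.2 v]
  rw [e2, Complex.reCLM_apply, Complex.re_ofReal_mul, Complex.re_sum]

end Differential

/-- The Adler-Taylor metric of a spin field is left-invariant and diagonal. The expectation is
computed term by term: different Gaussian variables are uncorrelated, and the sum over the rows `m`
of a given degree is `re_sum_wignerDeriv`. -/
theorem adlerTaylorMetric_spinField {Ω : Type*} [MeasurableSpace Ω] {P : Measure Ω}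
    [IsProbabilityMeasure P] {s : ℤ} {c : ℕ → ℝ} {γ : ℕ → ℤ → Ω → ℂ} {ξ : ℝ} (hs : s ≠ 0)
    (hc : ∀ l, s.natAbs ≤ l → 0 ≤ c l) (h : SmoothCovariance s c)
    (h1 : HasSum (fun n : ℕ => c (s.natAbs + n) ^ 2 / 2) 1)
    (hξ : HasSum (fun n : ℕ => c (s.natAbs + n) ^ 2 / 2 *
      ((((s.natAbs + n : ℕ) : ℝ) * (((s.natAbs + n : ℕ) : ℝ) + 1) - (s : ℝ) ^ 2) / 2)) (ξ ^ 2))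
    (hγ : IsGaussianFamily P s γ) :
    adlerTaylorMetric P (spinField s c γ) = gXiS ξ s := by
  funext p u v
  obtain ⟨α, β, K, hK, hunit, hD⟩ := exists_wignerD_chart p
  set D : ℕ → ℤ → R3 → ℂ := fun l m v => wignerDeriv l m s α β (-(Complex.I / 2 * v 2))
    (((v 1 : ℂ) - Complex.I * v 0) / 2) 
  have hDbound : ∀ l m v, s.natAbs ≤ l → m ∈ Finset.Icc (-(l : ℤ)) (l : ℤ) →
      ‖D l m v‖ ≤ K * l * ‖v‖ := fun l m v hl hm => by
    obtain ⟨L, hL⟩ := hD l m s hl hm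
    have := hL 0 (Metric.mem_ball_self one_pos)
    refine (congrArg norm (this.2.2 v)).symm.le.trans ?_
    exact ContinuousLinearMap.le_of_opNorm_le _ this.2.1 v
  set S := s.natAbs with hS
  have hcn : ∀ n, 0 ≤ c (S + n) := fun n => hc _ (by omega)
  set Y : R3 → ℕ → Ω → ℝ := fun v n ω => c (S + n) * ∑ m ∈ Finset.Icc (-((S + n : ℕ) : ℤ))
    ((S + n : ℕ) : ℤ), (γ (S + n) m ω * D (S + n) m v).re with hY
  have hYle : ∀ v n ω, ‖Y v n ω‖ ≤
      (K * ‖v‖) * (c (S + n) * ((S + n : ℕ) : ℝ) * gaussianAbs γ (S + n) ω) := by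
    intro v n ω
    rw [hY, norm_mul, Real.norm_of_nonneg (hcn n)]
    have : ‖∑ m ∈ Finset.Icc (-((S + n : ℕ) : ℤ)) ((S + n : ℕ) : ℤ),
        (γ (S + n) m ω * D (S + n) m v).re‖ ≤
        gaussianAbs γ (S + n) ω * (K * ((S + n : ℕ) : ℝ) * ‖v‖) := by
      refine (norm_sum_le _ _).trans ?_
      rw [gaussianAbs, Finset.sum_mul]
      refine Finset.sum_le_sum fun m hm => (Complex.abs_re_le_norm _).trans ?_
      rw [norm_mul]
      exact mul_le_mul_of_nonneg_left (hDbound _ _ _ (by omega) hm) (norm_nonneg _)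
    exact (mul_le_mul_of_nonneg_left this (hcn n)).trans (le_of_eq (by ring))
  have hae := ae_summable_gaussianAbs hs hc h hγ
  have hdiff : adlerTaylorMetric P (spinField s c γ) p u v =
      ∫ ω, (∑' n, Y u n ω) * ∑' n, Y v n ω ∂P := by
    refine integral_congr_ae ?_
    filter_upwards [hae] with ω hω
    rw [differential_spinField hs hc (D := D) (fun l m hl hm => hD l m s hl hm) hω,
      differential_spinField hs hc (D := D) (fun l m hl hm => hD l m s hl hm) hω]
  have hYs : ∀ v, ∀ᵐ ω ∂P, Summable fun n => ‖Y v n ω‖ := fun v => by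
    filter_upwards [hae] with ω hω
    exact Summable.of_nonneg_of_le (fun n => norm_nonneg _) (fun n => hYle v n ω) (hω.mul_left _)
  have hterm : ∀ n k, ∀ m ∈ Finset.Icc (-((S + n : ℕ) : ℤ)) ((S + n : ℕ) : ℤ),
      ∀ m' ∈ Finset.Icc (-((S + k : ℕ) : ℤ)) ((S + k : ℕ) : ℤ),
      Integrable (fun ω => (γ (S + n) m ω * D (S + n) m u).re *
        (γ (S + k) m' ω * D (S + k) m' v).re) P := fun n k m hm m' hm' =>
    (memLp_re_mul (hγ.law (S + n) m (by omega) (natAbs_le_of_mem_Icc hm)) _).integrable_mul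
      (memLp_re_mul (hγ.law (S + k) m' (by omega) (natAbs_le_of_mem_Icc hm')) _)
  have hYY : ∀ n k, (fun ω => Y u n ω * Y v k ω) = fun ω => (c (S + n) * c (S + k)) *
      ∑ m ∈ Finset.Icc (-((S + n : ℕ) : ℤ)) ((S + n : ℕ) : ℤ),
        ∑ m' ∈ Finset.Icc (-((S + k : ℕ) : ℤ)) ((S + k : ℕ) : ℤ),
          (γ (S + n) m ω * D (S + n) m u).re * (γ (S + k) m' ω * D (S + k) m' v).re := by
    intro n k
    funext ω
    rw [hY, ← Finset.sum_mul_sum]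
    ring
  have hint : ∀ n k, Integrable (fun ω => Y u n ω * Y v k ω) P := fun n k => by
    rw [hYY]
    exact (integrable_finsetSum _ fun m hm => integrable_finsetSum _ (hterm n k m hm)).const_mul _
  have hIval : ∀ n k, ∫ ω, Y u n ω * Y v k ω ∂P = (c (S + n) * c (S + k)) *
      ∑ m ∈ Finset.Icc (-((S + n : ℕ) : ℤ)) ((S + n : ℕ) : ℤ),
        ∑ m' ∈ Finset.Icc (-((S + k : ℕ) : ℤ)) ((S + k : ℕ) : ℤ),
          ∫ ω, (γ (S + n) m ω * D (S + n) m u).re * (γ (S + k) m' ω * D (S + k) m' v).re ∂P := by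
    intro n k
    rw [hYY, integral_const_mul, integral_finsetSum _ fun m hm =>
      integrable_finsetSum _ (hterm n k m hm)]
    congr 1
    exact Finset.sum_congr rfl fun m hm => integral_finsetSum _ (hterm n k m hm)
  have hindep : ∀ n k, ∀ m ∈ Finset.Icc (-((S + n : ℕ) : ℤ)) ((S + n : ℕ) : ℤ),
      ∀ m' ∈ Finset.Icc (-((S + k : ℕ) : ℤ)) ((S + k : ℕ) : ℤ), (n, m) ≠ (k, m') →
      ∫ ω, (γ (S + n) m ω * D (S + n) m u).re * (γ (S + k) m' ω * D (S + k) m' v).re ∂P = 0 := by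
    intro n k m hm m' hm' hne
    have hm1 := natAbs_le_of_mem_Icc hm
    have hm2 := natAbs_le_of_mem_Icc hm'
    refine integral_re_mul_mul_re_mul_of_indepFun (hγ.law _ m (by omega) hm1)
      (hγ.law _ m' (by omega) hm2) ?_ _ _
    refine hγ.indep.indepFun (i := ⟨(S + n, m), by omega, hm1⟩) (j := ⟨(S + k, m'), by omega, hm2⟩) ?_
    intro heq
    apply hne
    have := congrArg Subtype.val heq
    simp only [Prod.mk.injEq] at this ⊢
    exact ⟨by omega, this.2⟩
  have hdiag : ∀ n, ∫ ω, Y u n ω * Y v n ω ∂P = c (S + n) ^ 2 / 2 *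
      ((((S + n : ℕ) : ℝ) * (((S + n : ℕ) : ℝ) + 1) - (s : ℝ) ^ 2) / 2) * (u 0 * v 0 + u 1 * v 1)
        + c (S + n) ^ 2 / 2 * ((s : ℝ) ^ 2 * (u 2 * v 2)) := by
    intro n
    have hsum := re_sum_wignerDeriv hunit (l := S + n) (s := s) (by omega) u v
    rw [Complex.re_sum] at hsum
    rw [hIval]
    have : ∀ m ∈ Finset.Icc (-((S + n : ℕ) : ℤ)) ((S + n : ℕ) : ℤ),
        ∑ m' ∈ Finset.Icc (-((S + n : ℕ) : ℤ)) ((S + n : ℕ) : ℤ),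
          ∫ ω, (γ (S + n) m ω * D (S + n) m u).re * (γ (S + n) m' ω * D (S + n) m' v).re ∂P =
        (D (S + n) m u * starRingEnd ℂ (D (S + n) m v)).re / 2 := fun m hm => by
      rw [Finset.sum_eq_single_of_mem m hm fun m' hm' hne => hindep n n m hm m' hm'
        fun heq => hne (Prod.mk.inj heq).2.symm]
      exact integral_re_mul_mul_re_mul (hγ.law _ m (by omega) (natAbs_le_of_mem_Icc hm)) _ _
    rw [Finset.sum_congr rfl this, ← Finset.sum_div, hsum]
    ring
  have hoff : ∀ n k, n ≠ k → ∫ ω, Y u n ω * Y v k ω ∂P = 0 := fun n k hnk => by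
    rw [hIval, Finset.sum_eq_zero fun m hm => Finset.sum_eq_zero fun m' hm' =>
      hindep n k m hm m' hm' fun heq => hnk (Prod.mk.inj heq).1, mul_zero]
  have hnormint : ∀ n k, ∫ ω, ‖Y u n ω * Y v k ω‖ ∂P ≤
      ((K * ‖u‖) * (c (S + n) * ((S + n : ℕ) : ℝ) * (2 * ((S + n : ℕ) : ℝ) + 1))) *
      ((K * ‖v‖) * (c (S + k) * ((S + k : ℕ) : ℝ) * (2 * ((S + k : ℕ) : ℝ) + 1))) := by
    intro n k
    set A : ℝ := (K * ‖u‖ * (c (S + n) * ((S + n : ℕ) : ℝ))) *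
      (K * ‖v‖ * (c (S + k) * ((S + k : ℕ) : ℝ))) with hA
    have hA0 : 0 ≤ A := mul_nonneg
      (mul_nonneg (by positivity) (mul_nonneg (hcn n) (Nat.cast_nonneg _)))
      (mul_nonneg (by positivity) (mul_nonneg (hcn k) (Nat.cast_nonneg _)))
    calc ∫ ω, ‖Y u n ω * Y v k ω‖ ∂P
        ≤ ∫ ω, A * (gaussianAbs γ (S + n) ω * gaussianAbs γ (S + k) ω) ∂P := by
          refine integral_mono (hint n k).norm
            ((integrable_gaussianAbs_mul hγ (by omega) (by omega)).const_mul A) fun ω => ?_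
          simp only [norm_mul]
          refine (mul_le_mul (hYle u n ω) (hYle v k ω) (norm_nonneg _)
            ((norm_nonneg _).trans (hYle u n ω))).trans (le_of_eq ?_)
          rw [hA]
          ring
      _ ≤ A * ((2 * ((S + n : ℕ) : ℝ) + 1) * (2 * ((S + k : ℕ) : ℝ) + 1)) := by
          rw [integral_const_mul]
          exact mul_le_mul_of_nonneg_left
            (integral_gaussianAbs_mul_le hγ (by omega) (by omega)) hA0
      _ = _ := by
          rw [hA]
          ring
  have hsa := summable_coeff_mul hs hc h
  have hsa0 : ∀ (w : R3) (n : ℕ), 0 ≤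
      (K * ‖w‖) * (c (S + n) * ((S + n : ℕ) : ℝ) * (2 * ((S + n : ℕ) : ℝ) + 1)) := fun w n =>
    mul_nonneg (by positivity) (mul_nonneg (mul_nonneg (hcn n) (by positivity)) (by positivity))
  rw [hdiff, integral_tsum_mul_tsum (hsa.mul_left (K * ‖u‖)) (hsa.mul_left (K * ‖v‖))
    (hsa0 u) (hsa0 v) (hYs u) (hYs v) hint hnormint hdiag hoff,
    ((hξ.mul_right (u 0 * v 0 + u 1 * v 1)).add
      (h1.mul_right ((s : ℝ) ^ 2 * (u 2 * v 2)))).tsum_eq, gXiS]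
  ring

theorem ne_zero_of_hasSum_coeff {s : ℤ} (hs : s ≠ 0) {c : ℕ → ℝ} {ξ : ℝ}
    (h1 : HasSum (fun n : ℕ => c (s.natAbs + n) ^ 2 / 2) 1)
    (hξ : HasSum (fun n : ℕ => c (s.natAbs + n) ^ 2 / 2 *
      ((((s.natAbs + n : ℕ) : ℝ) * (((s.natAbs + n : ℕ) : ℝ) + 1) - (s : ℝ) ^ 2) / 2)) (ξ ^ 2)) :
    ξ ≠ 0 := by
  have hS1 : (1 : ℝ) ≤ (s.natAbs : ℕ) := by exact_mod_cast Int.natAbs_pos.2 hs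
  have h2 : (s : ℝ) ^ 2 = ((s.natAbs : ℕ) : ℝ) ^ 2 := by
    rw [← sq_abs (s : ℝ), ← Int.cast_abs, Int.abs_eq_natAbs, Int.cast_natCast]
  -- `l (l + 1) - s² ≥ |s| ≥ 1` bounds `ξ²` below by half the variance
  have hle := hasSum_le (fun n => ?_) (h1.mul_right (1 / 2)) hξ
  · rintro rfl
    norm_num at hle
  · refine mul_le_mul_of_nonneg_left ?_ (by positivity)
    have h4 : (0 : ℝ) ≤ n := Nat.cast_nonneg _
    rw [h2]
    push_cast
    nlinarith [mul_nonneg h4 h4, mul_nonneg h4 (by linarith : (0 : ℝ) ≤ (s.natAbs : ℕ))]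

end SpinSO3

end

theorem propositionA1 {Ω : Type*} [MeasurableSpace Ω] (P : MeasureTheory.Measure Ω)
    [MeasureTheory.IsProbabilityMeasure P] :
    (∀ (s : ℤ) (_ : s ≠ 0) (c : ℕ → ℝ) (_ : ∀ l, s.natAbs ≤ l → 0 ≤ c l)
      (_ : SpinSO3.SmoothCovariance s c)
      (_ : HasSum (fun n : ℕ => c (s.natAbs + n) ^ 2 / 2) 1)
      (ξ : ℝ)
      (_ : HasSum (fun n : ℕ => c (s.natAbs + n) ^ 2 / 2 *
        ((((s.natAbs + n : ℕ) : ℝ) * (((s.natAbs + n : ℕ) : ℝ) + 1) - (s : ℝ) ^ 2) / 2)) (ξ ^ 2))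
      (γ : ℕ → ℤ → Ω → ℂ) (_ : SpinSO3.IsGaussianFamily P s γ),
      let g := SpinSO3.adlerTaylorMetric P (SpinSO3.spinField s c γ)
      SpinSO3.IsRiemannianMetric g ∧
      (SpinSO3.HasEulerCharacteristic SpinSO3.SO3 0 ∧
        SpinSO3.lipschitzKilling g 0 = 0) ∧
      SpinSO3.lipschitzKilling g 1 = 4 * |(s : ℝ)| * Real.pi * (1 - (s : ℝ) ^ 2 / (4 * ξ ^ 2)) ∧
      SpinSO3.lipschitzKilling g 2 = 0 ∧
      (SpinSO3.lipschitzKilling g 3 = (SpinSO3.riemannianVolume g Set.univ).toReal ∧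
        SpinSO3.lipschitzKilling g 3 = 8 * Real.pi ^ 2 * ξ ^ 2 * |(s : ℝ)|)) ∧
    (∀ ξ s : ℝ, ξ ≠ 0 → s ≠ 0 →
      let g := SpinSO3.gXiS ξ s
      SpinSO3.IsRiemannianMetric g ∧
      SpinSO3.lipschitzKilling g 0 = 0 ∧
      SpinSO3.lipschitzKilling g 1 = 4 * |s| * Real.pi * (1 - s ^ 2 / (4 * ξ ^ 2)) ∧
      SpinSO3.lipschitzKilling g 2 = 0 ∧
      (SpinSO3.lipschitzKilling g 3 = (SpinSO3.riemannianVolume g Set.univ).toReal ∧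
        SpinSO3.lipschitzKilling g 3 = 8 * Real.pi ^ 2 * ξ ^ 2 * |s|)) := by
  refine ⟨?_, fun ξ s hξ hs => ?_⟩
  · intro s hs c hc h h1 ξ hξ γ hγ
    have hs' : (s : ℝ) ≠ 0 := Int.cast_ne_zero.2 hs
    have hξ0 := SpinSO3.ne_zero_of_hasSum_coeff hs h1 hξ
    rw [SpinSO3.adlerTaylorMetric_spinField hs hc h h1 hξ hγ]
    exact ⟨SpinSO3.isRiemannianMetric_gXiS hξ0 hs',
      ⟨SpinSO3.hasEulerCharacteristic_SO3, SpinSO3.lipschitzKilling_zero _⟩,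
      SpinSO3.lipschitzKilling_one_gXiS hξ0 hs', SpinSO3.lipschitzKilling_two _,
      SpinSO3.lipschitzKilling_three _,
      (SpinSO3.lipschitzKilling_three _).trans (SpinSO3.riemannianVolume_gXiS_univ ξ s)⟩
  · exact ⟨SpinSO3.isRiemannianMetric_gXiS hξ hs, SpinSO3.lipschitzKilling_zero _,
      SpinSO3.lipschitzKilling_one_gXiS hξ hs, SpinSO3.lipschitzKilling_two _,
      SpinSO3.lipschitzKilling_three _,
      (SpinSO3.lipschitzKilling_three _).trans (SpinSO3.riemannianVolume_gXiS_univ ξ s)⟩
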